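/- A local Lie groupoid $G\rightrightarrows M$ consists of smooth finite-dimensional manifolds $G$ (possibly non-Hausdorff) and $M$ (Hausdorff), submersions $s,t:G\to M$ with Hausdorff fibres, a smooth common section $u:M\to G$ of $s$ and $t$ (we write $x$ for $u(x)$), a submersion $m:\mathcal U\to G$, $m(g,h)=gh$, where $\mathcal U$ is open in $G\times_{s,t}G=\{(g,h):s(g)=t(h)\}$ and contains all $(g,s(g))$ and $(t(g),g)$, and a smooth map $i:\mathcal V\to\mathcal V$, where $\mathcal V\subset G$ is an open neighbourhood of $M$ with $\mathcal V\times_{s,t}\mathcal V\subset\mathcal U$, such that $s(gh)=s(h)$, $t(gh)=t(g)$, $g\,s(g)=g=t(g)\,g$, $i$ exchanges $s$ and $t$, $i(g)g=s(g)$ and $g\,i(g)=t(g)$ on $\mathcal V$, and $(gh)k=g(hk)$ (all products being defined) for all composable triples in a neighbourhood of those of the form $(t(g),t(g),g)$, $(t(g),g,s(g))$, $(g,s(g),s(g))$. It is 3-associative if $(gh)k=g(hk)$ whenever both sides are defined. It is strongly connected if $M$, $\mathcal U$, $\mathcal V$, all sets $\{(g,h)\in\mathcal U:s(g)=t(h)=x\}$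 and all fibres $s^{-1}(x)$, $t^{-1}(x)$ ($x\in M$) are connected, and $G$ is bi-regular: for all $(g,h)\in\mathcal U$, right multiplication by $h$ induces an isomorphism $\ker d_gs\to\ker d_{gh}s$ and left multiplication by $g$ induces an isomorphism $\ker d_ht\to\ker d_{gh}t$. Let $W(G)$ be the set of words $(w_1,\dots,w_k)$, $k\ge1$, $w_i\in G$, $s(w_i)=t(w_{i+1})$, with source $s(w_k)$ and target $t(w_1)$, and let $\sim$ be the equivalence relation generated by the contractions $(\dots,g,h,\dots)\to(\dots,gh,\dots)$, $(g,h)\in\mathcal U$. The associative completion is $\mathcal{AC}(G)=W(G)/{\sim}$, with object set $M$, multiplication given by juxtaposition and units $[(x)]$. Let $\mathbf G$ be the nerve of $G$: $G^{(0)}=M$, and $G^{(m)}$ ($m\ge1$) is the set of composable $m$-tuples all of whose $m$-fold products are defined and equal; face maps drop the first or last entry or multiply adjacent entries ($d_0=s$, $d_1=t$ on $G^{(1)}=G$), degeneracy maps insert units. Let $\Pi_1(\mathbf G)\rightrightarrows M$ be the restriction to $M=G^{(0)}$ of the fundamental groupoid of the geometric realization $|\mathbf G|$, where $\mathbf G$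 is regarded as a simplicial set. Let $F(G)$ be the free groupoid on the quiver $s,t:G\rightrightarrows M$, with product $\bullet$. For $\sigma=(g,h)\in G^{(2)}=\mathcal U$ put $\partial\sigma=g\bullet h\bullet(gh)^{-1}$, a loop at $t(g)$. For $x\in M$ let $\Gamma_2(x)$ be the group generated by the pairs $(w,\sigma)$ with $\sigma=(g,h)\in G^{(2)}$, $w\in F(G)$, $t(w)=x$, $s(w)=t(g)$, with relations $(w_1,\sigma_1)(w_1\bullet w_2,\sigma_2)=(w_1\bullet\partial\sigma_1\bullet w_2,\sigma_2)(w_1,\sigma_1)$, and let $\delta:\Gamma_2(x)\to F(G)_x$ be the homomorphism to the isotropy group at $x$ with $\delta(w,\sigma)=w\bullet\partial\sigma\bullet w^{-1}$. For $w,w'\in F(G)$ write $w\approx w'$ if $s(w)=s(w')$, $t(w)=t(w')$ and $w'=w\bullet\delta(\eta)$ for some $\eta\in\Gamma_2(s(w))$. For a word $w=(w_1,\dots,w_k)\in W(G)$ put $\bar w=w_1\bullet\cdots\bullet w_k\in F(G)$. **Theorem.** Let $G\rightrightarrows M$ be a strongly connected, 3-associative local Lie groupoid. Then $\mathcal{AC}(G)$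 is a groupoid, and there is an isomorphism of groupoids $$\mathcal{AC}(G)\simeq\Pi_1(\mathbf G)$$ which is the identity on the object set $M$. Moreover, for all $w,w'\in W(G)$: $w\sim w'$ if and only if $\bar w\approx\bar w'$. -/

import Mathlib

open CategoryTheory Opposite Set Manifold
open scoped ContDiff

universe u

/-! ### Local Lie groupoids -/

/-- A local Lie groupoid `G` over `M`.  The partially defined operations are total functions whose
values outside of their domains (`mulDom` for the multiplication, `invDom` for the inversion) are
irrelevant.  The arrow manifold `G` need not be Hausdorff. -/
structure LocalLieGroupoid (d n : ℕ) (M G : Type u)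
    [TopologicalSpace M] [ChartedSpace (EuclideanSpace ℝ (Fin d)) M] [IsManifold (𝓡 d) ∞ M]
    [T2Space M]
    [TopologicalSpace G] [ChartedSpace (EuclideanSpace ℝ (Fin n)) G] [IsManifold (𝓡 n) ∞ G] where
  /-- source -/
  s : G → M
  /-- target -/
  t : G → M
  s_submersion : IsSubmersion (𝓡 n) (𝓡 d) ∞ s
  t_submersion : IsSubmersion (𝓡 n) (𝓡 d) ∞ t
  s_fiber_t2 : ∀ x, T2Space (s ⁻¹' {x})
  t_fiber_t2 : ∀ x, T2Space (t ⁻¹' {x})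
  /-- unit map -/
  unit : M → G
  unit_smooth : ContMDiff (𝓡 d) (𝓡 n) ∞ unit
  s_unit : ∀ x, s (unit x) = x
  t_unit : ∀ x, t (unit x) = x
  /-- domain of the multiplication -/
  mulDom : Set (G × G)
  /-- `mulDom` is an open subset of the fibre product `G ₛ×ₜ G` -/
  mulDom_open : ∃ O : Set (G × G), IsOpen O ∧ mulDom = O ∩ {p | s p.1 = t p.2}
  mem_mulDom_unit : ∀ g, (g, unit (s g)) ∈ mulDom
  unit_mem_mulDom : ∀ g, (unit (t g), g) ∈ mulDom
  /-- multiplication -/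
  mul : G × G → G
  mul_smooth : ContMDiffOn ((𝓡 n).prod (𝓡 n)) (𝓡 n) ∞ mul mulDom
  /-- The differential of the multiplication maps the tangent space
  `{(a, b) | ds a = dt b}` of `mulDom` at `p` onto the tangent space of `G` at `mul p`. -/
  mul_submersion : ∀ p ∈ mulDom, ∀ v : TangentSpace (𝓡 n) (mul p),
    ∃ (a : TangentSpace (𝓡 n) p.1) (b : TangentSpace (𝓡 n) p.2),
      (mfderiv (𝓡 n) (𝓡 d) s p.1 a : EuclideanSpace ℝ (Fin d)) = mfderiv (𝓡 n) (𝓡 d) t p.2 b ∧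
      mfderivWithin ((𝓡 n).prod (𝓡 n)) (𝓡 n) mul mulDom p (a, b) = v
  /-- domain of the inversion -/
  invDom : Set G
  invDom_open : IsOpen invDom
  unit_mem_invDom : ∀ x, unit x ∈ invDom
  invDom_mulDom : ∀ g ∈ invDom, ∀ h ∈ invDom, s g = t h → (g, h) ∈ mulDom
  /-- inversion -/
  inv : G → G
  inv_mapsTo : MapsTo inv invDom invDom
  inv_smooth : ContMDiffOn (𝓡 n) (𝓡 n) ∞ inv invDom
  s_mul : ∀ p ∈ mulDom, s (mul p) = s p.2
  t_mul : ∀ p ∈ mulDom, t (mul p) = t p.1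
  /-- associativity on a neighborhood `O ∩ (G ₛ×ₜ G ₛ×ₜ G)` of the triples with two units -/
  locally_assoc : ∃ O : Set (G × G × G), IsOpen O ∧
    (∀ g, (unit (t g), unit (t g), g) ∈ O ∧ (unit (t g), g, unit (s g)) ∈ O ∧
      (g, unit (s g), unit (s g)) ∈ O) ∧
    ∀ g h k, (g, h, k) ∈ O → s g = t h → s h = t k →
      (g, h) ∈ mulDom ∧ (mul (g, h), k) ∈ mulDom ∧ (h, k) ∈ mulDom ∧ (g, mul (h, k)) ∈ mulDom ∧
      mul (mul (g, h), k) = mul (g, mul (h, k))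
  mul_unit : ∀ g, mul (g, unit (s g)) = g
  unit_mul : ∀ g, mul (unit (t g), g) = g
  s_inv : ∀ g ∈ invDom, s (inv g) = t g
  t_inv : ∀ g ∈ invDom, t (inv g) = s g
  inv_mul : ∀ g ∈ invDom, mul (inv g, g) = unit (s g)
  mul_inv : ∀ g ∈ invDom, mul (g, inv g) = unit (t g)

namespace LocalLieGroupoid

variable {d n : ℕ} {M G : Type u}
    [TopologicalSpace M] [ChartedSpace (EuclideanSpace ℝ (Fin d)) M] [IsManifold (𝓡 d) ∞ M]
    [T2Space M]
    [TopologicalSpace G] [ChartedSpace (EuclideanSpace ℝ (Fin n)) G] [IsManifold (𝓡 n) ∞ G]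
    (𝒢 : LocalLieGroupoid d n M G)

/-- `(gh)k = g(hk)` whenever both sides are defined. -/
def IsThreeAssociative : Prop :=
  ∀ g h k, (g, h) ∈ 𝒢.mulDom → (𝒢.mul (g, h), k) ∈ 𝒢.mulDom →
    (h, k) ∈ 𝒢.mulDom → (g, 𝒢.mul (h, k)) ∈ 𝒢.mulDom →
      𝒢.mul (𝒢.mul (g, h), k) = 𝒢.mul (g, 𝒢.mul (h, k))

/-- The tangent space at `g` of the source fibre through `g`. -/
def tangentS (g : G) : Set (TangentSpace (𝓡 n) g) := {v | mfderiv (𝓡 n) (𝓡 d) 𝒢.s g v = 0}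

/-- The tangent space at `g` of the target fibre through `g`. -/
def tangentT (g : G) : Set (TangentSpace (𝓡 n) g) := {v | mfderiv (𝓡 n) (𝓡 d) 𝒢.t g v = 0}

/-- The differential of right multiplication by `g`, a map defined on the open subset
`{k | (k, g) ∈ mulDom}` of the source fibre over `t g`, is an isomorphism `TˢG_h ≅ TˢG_{hg}`. -/
def RightRegularAt (g : G) : Prop :=
  ∀ h, (h, g) ∈ 𝒢.mulDom →
    BijOn (mfderivWithin (𝓡 n) (𝓡 n) (fun k => 𝒢.mul (k, g)) {k | (k, g) ∈ 𝒢.mulDom} h)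
      (𝒢.tangentS h) (𝒢.tangentS (𝒢.mul (h, g)))

/-- The differential of left multiplication by `g`, a map defined on the open subset
`{k | (g, k) ∈ mulDom}` of the target fibre over `s g`, is an isomorphism `TᵗG_h ≅ TᵗG_{gh}`. -/
def LeftRegularAt (g : G) : Prop :=
  ∀ h, (g, h) ∈ 𝒢.mulDom →
    BijOn (mfderivWithin (𝓡 n) (𝓡 n) (fun k => 𝒢.mul (g, k)) {k | (g, k) ∈ 𝒢.mulDom} h)
      (𝒢.tangentT h) (𝒢.tangentT (𝒢.mul (g, h)))

/-- Bi-regularity of a local Lie groupoid. -/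
def BiRegular : Prop := ∀ g, 𝒢.LeftRegularAt g ∧ 𝒢.RightRegularAt g

/-- Strongly connected local Lie groupoids. -/
structure StronglyConnected : Prop where
  base : ConnectedSpace M
  mulDom : IsConnected 𝒢.mulDom
  invDom : IsConnected 𝒢.invDom
  mulDom_fiber : ∀ x, IsConnected {p | p ∈ 𝒢.mulDom ∧ 𝒢.s p.1 = x ∧ 𝒢.t p.2 = x}
  s_connected : ∀ x, IsConnected (𝒢.s ⁻¹' {x})
  t_connected : ∀ x, IsConnected (𝒢.t ⁻¹' {x})
  biRegular : 𝒢.BiRegular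

/-! ### The associative completion -/

/-- Well-formed words `(w₁, …, wₖ)`, `k ≥ 1`: `s wᵢ = t wᵢ₊₁`. -/
@[ext]
structure Word where
  /-- the letters -/
  letters : List G
  ne_nil : letters ≠ []
  wellFormed : letters.IsChain (fun g h => 𝒢.s g = 𝒢.t h)

variable {𝒢}

namespace Word

/-- The source of a word is the source of its last letter. -/
def src (w : 𝒢.Word) : M := 𝒢.s (w.letters.getLast w.ne_nil)

/-- The target of a word is the target of its first letter. -/
def tgt (w : 𝒢.Word) : M := 𝒢.t (w.letters.head w.ne_nil)

/-- `w'` is obtained from `w` by contraction (and `w` from `w'` by expansion). -/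
def Contracts (w w' : 𝒢.Word) : Prop :=
  ∃ (a b : List G) (g h : G), (g, h) ∈ 𝒢.mulDom ∧
    w.letters = a ++ g :: h :: b ∧ w'.letters = a ++ 𝒢.mul (g, h) :: b

/-- The equivalence relation `∼` generated by contractions and expansions. -/
def Equiv (w w' : 𝒢.Word) : Prop := Relation.EqvGen Contracts w w'

/-- The one-letter word `(g)`. -/
def single (g : G) : 𝒢.Word := ⟨[g], by simp, by simp⟩

/-- Juxtaposition of words. -/
def append (w w' : 𝒢.Word) (h : w.src = w'.tgt) : 𝒢.Word where
  letters := w.letters ++ w'.letters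
  ne_nil := by simp [w.ne_nil]
  wellFormed := by
    refine List.isChain_append.2 ⟨w.wellFormed, w'.wellFormed, fun a ha b hb => ?_⟩
    rw [List.getLast?_eq_some_getLast w.ne_nil, Option.mem_some] at ha
    rw [List.head?_eq_some_head w'.ne_nil, Option.mem_some] at hb
    subst ha hb
    exact h

lemma Contracts.src_eq {w w' : 𝒢.Word} (h : w.Contracts w') : w.src = w'.src := by
  obtain ⟨a, b, g, k, hd, h₁, h₂⟩ := h
  rcases List.eq_nil_or_concat b with rfl | ⟨b', c, rfl⟩ <;>
    simp [src, h₁, h₂, 𝒢.s_mul _ hd]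

lemma Contracts.tgt_eq {w w' : 𝒢.Word} (h : w.Contracts w') : w.tgt = w'.tgt := by
  obtain ⟨a, b, g, k, hd, h₁, h₂⟩ := h
  cases a <;> simp [tgt, h₁, h₂, 𝒢.t_mul _ hd]

lemma Equiv.src_eq {w w' : 𝒢.Word} (h : w.Equiv w') : w.src = w'.src := by
  induction h with
  | rel _ _ h => exact h.src_eq
  | refl _ => rfl
  | symm _ _ _ ih => exact ih.symm
  | trans _ _ _ _ _ ih₁ ih₂ => exact ih₁.trans ih₂

lemma Equiv.tgt_eq {w w' : 𝒢.Word} (h : w.Equiv w') : w.tgt = w'.tgt := by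
  induction h with
  | rel _ _ h => exact h.tgt_eq
  | refl _ => rfl
  | symm _ _ _ ih => exact ih.symm
  | trans _ _ _ _ _ ih₁ ih₂ => exact ih₁.trans ih₂

@[simp] lemma src_append (w w' : 𝒢.Word) (h : w.src = w'.tgt) : (w.append w' h).src = w'.src := by
  simp [src, append, List.getLast_append_of_ne_nil _ w'.ne_nil]

@[simp] lemma tgt_append (w w' : 𝒢.Word) (h : w.src = w'.tgt) : (w.append w' h).tgt = w.tgt := by
  simp [tgt, append, List.head_append_of_ne_nil w.ne_nil]

lemma Equiv.append_right {w₁ w₂ : 𝒢.Word} (h : w₁.Equiv w₂) (v : 𝒢.Word) (h₁ : w₁.src = v.tgt)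
    (h₂ : w₂.src = v.tgt) : (w₁.append v h₁).Equiv (w₂.append v h₂) := by
  induction h with
  | rel _ _ h =>
    obtain ⟨a, b, g, k, hd, e₁, e₂⟩ := h
    exact .rel _ _ ⟨a, b ++ v.letters, g, k, hd, by simp [append, e₁], by simp [append, e₂]⟩
  | refl _ => exact .refl _
  | symm _ _ _ ih => exact .symm _ _ (ih h₂ h₁)
  | trans x y z hxy _ ih₁ ih₂ =>
    have hy : y.src = v.tgt := (Equiv.src_eq hxy).symm.trans h₁
    exact .trans _ _ _ (ih₁ h₁ hy) (ih₂ hy h₂)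

lemma Equiv.append_left {w₁ w₂ : 𝒢.Word} (h : w₁.Equiv w₂) (v : 𝒢.Word) (h₁ : v.src = w₁.tgt)
    (h₂ : v.src = w₂.tgt) : (v.append w₁ h₁).Equiv (v.append w₂ h₂) := by
  induction h with
  | rel _ _ h =>
    obtain ⟨a, b, g, k, hd, e₁, e₂⟩ := h
    exact .rel _ _ ⟨v.letters ++ a, b, g, k, hd, by simp [append, e₁], by simp [append, e₂]⟩
  | refl _ => exact .refl _
  | symm _ _ _ ih => exact .symm _ _ (ih h₂ h₁)
  | trans x y z hxy _ ih₁ ih₂ =>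
    have hy : v.src = y.tgt := h₁.trans (Equiv.tgt_eq hxy)
    exact .trans _ _ _ (ih₁ h₁ hy) (ih₂ hy h₂)

variable (𝒢) in
/-- The equivalence relation `∼` on `W(G)`, restricted to the words with source `x` and
target `y`. -/
def setoid (x y : M) : Setoid {w : 𝒢.Word // w.src = x ∧ w.tgt = y} where
  r w w' := w.1.Equiv w'.1
  iseqv := ⟨fun _ => .refl _, fun h => .symm _ _ h, fun h h' => .trans _ _ _ h h'⟩

end Word

/-- The associative completion `𝒜𝒞(G) = W(G)/∼`, as a category: its objects are the points of `M`,
its arrows from `x` to `y` are the classes of words with source `x` and target `y`, and the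
composite of `f : x ⟶ y` and `g : y ⟶ z` is the class `g · f` of the juxtaposition. -/
@[ext]
structure AssocCompletion (_𝒢 : LocalLieGroupoid d n M G) where
  /-- the underlying point -/
  pt : M

instance : Category.{u} (AssocCompletion 𝒢) where
  Hom x y := Quotient (Word.setoid 𝒢 x.pt y.pt)
  id x := Quotient.mk _ ⟨Word.single (𝒢.unit x.pt), 𝒢.s_unit _, 𝒢.t_unit _⟩
  comp {x y z} f g := Quotient.map₂ (sb := Word.setoid 𝒢 x.pt y.pt) (sa := Word.setoid 𝒢 y.pt z.pt)
    (sc := Word.setoid 𝒢 x.pt z.pt)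
    (fun w v => ⟨w.1.append v.1 (w.2.1.trans v.2.2.symm), by simp [v.2.1], by simp [w.2.2]⟩)
    (fun w w' hw v v' hv => .trans _ _ _
      (Word.Equiv.append_right hw v.1 (w.2.1.trans v.2.2.symm) (w'.2.1.trans v.2.2.symm))
      (Word.Equiv.append_left hv w'.1 (w'.2.1.trans v.2.2.symm) (w'.2.1.trans v'.2.2.symm))) g f
  id_comp {x y} f := by
    induction f using Quotient.inductionOn with | _ w => ?_
    refine Quotient.sound (.rel _ _ ?_)
    refine ⟨w.1.letters.dropLast, [], w.1.letters.getLast w.1.ne_nil, 𝒢.unit x.pt, ?_, ?_, ?_⟩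
    · have := 𝒢.mem_mulDom_unit (w.1.letters.getLast w.1.ne_nil)
      rwa [show 𝒢.s (w.1.letters.getLast w.1.ne_nil) = x.pt from w.2.1] at this
    · conv_lhs => simp only [Word.append, Word.single]
      conv_lhs => rw [← List.dropLast_append_getLast w.1.ne_nil]
      simp
    · have := 𝒢.mul_unit (w.1.letters.getLast w.1.ne_nil)
      rw [show 𝒢.s (w.1.letters.getLast w.1.ne_nil) = x.pt from w.2.1] at this
      rw [this, List.dropLast_append_getLast]
  comp_id {x y} f := by
    induction f using Quotient.inductionOn with | _ w => ?_
    refine Quotient.sound (.rel _ _ ?_)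
    refine ⟨[], w.1.letters.tail, 𝒢.unit y.pt, w.1.letters.head w.1.ne_nil, ?_, ?_, ?_⟩
    · have := 𝒢.unit_mem_mulDom (w.1.letters.head w.1.ne_nil)
      rwa [show 𝒢.t (w.1.letters.head w.1.ne_nil) = y.pt from w.2.2] at this
    · simp [Word.append, Word.single]
    · have := 𝒢.unit_mul (w.1.letters.head w.1.ne_nil)
      rw [show 𝒢.t (w.1.letters.head w.1.ne_nil) = y.pt from w.2.2] at this
      simp [this]
  assoc {x y z t} f g h := by
    induction f using Quotient.inductionOn
    induction g using Quotient.inductionOn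
    induction h using Quotient.inductionOn
    refine congrArg (Quotient.mk _) (Subtype.ext (Word.ext ?_))
    simp [Word.append]

/-! ### The nerve -/

section

open scoped Simplicial

variable (𝒢) in
/-- The `m`-simplices of the nerve.  An `m`-tuple `(g₁, …, gₘ)` all of whose `m`-fold products are
defined and agree is recorded together with all its partial products: `arr i j` is the product
`gᵢ₊₁ ⋯ gⱼ` (the unit at `obj i` if `i = j`), and `obj 0 = t g₁`, `obj i = s gᵢ`.
See `exists_nerveSimplex_iff` and `NerveSimplex.eq_of_tuple`. -/
@[ext]
structure NerveSimplex (m : ℕ) where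
  /-- vertices -/
  obj : Fin (m + 1) → M
  /-- partial products -/
  arr : ∀ i j : Fin (m + 1), i ≤ j → G
  t_arr : ∀ i j h, 𝒢.t (arr i j h) = obj i
  s_arr : ∀ i j h, 𝒢.s (arr i j h) = obj j
  arr_self : ∀ i, arr i i le_rfl = 𝒢.unit (obj i)
  mem_mulDom : ∀ i j k (h : i ≤ j) (h' : j ≤ k), (arr i j h, arr j k h') ∈ 𝒢.mulDom
  mul_arr : ∀ i j k (h : i ≤ j) (h' : j ≤ k),
    𝒢.mul (arr i j h, arr j k h') = arr i k (h.trans h')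

variable (𝒢) in
/-- The nerve of a local Lie groupoid.  The face `dᵢ` omits the `i`-th vertex (so it drops `g₁`,
drops `gₘ`, or multiplies `gᵢ` with `gᵢ₊₁`) and the degeneracy `sᵢ` repeats the `i`-th vertex
(so it inserts a unit). -/
def nerve : SSet.{u} where
  obj Δ := 𝒢.NerveSimplex Δ.unop.len
  map f := ↾fun σ =>
    { obj := fun i => σ.obj (f.unop.toOrderHom i)
      arr := fun _ _ h => σ.arr _ _ (f.unop.toOrderHom.monotone h)
      t_arr := fun _ _ _ => σ.t_arr _ _ _
      s_arr := fun _ _ _ => σ.s_arr _ _ _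
      arr_self := fun _ => σ.arr_self _
      mem_mulDom := fun _ _ _ _ _ => σ.mem_mulDom _ _ _ _ _
      mul_arr := fun _ _ _ _ _ => σ.mul_arr _ _ _ _ _ }
  map_id _ := rfl
  map_comp _ _ := rfl

variable (𝒢) in
/-- The `0`-simplex of the nerve given by a point of `M`. -/
def vertex (x : M) : 𝒢.nerve _⦋0⦌ := show 𝒢.NerveSimplex 0 from
  { obj := fun _ => x
    arr := fun _ _ _ => 𝒢.unit x
    t_arr := fun _ _ _ => 𝒢.t_unit x
    s_arr := fun _ _ _ => 𝒢.s_unit x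
    arr_self := fun _ => rfl
    mem_mulDom := fun _ _ _ _ _ => by
      simpa [𝒢.s_unit] using 𝒢.mem_mulDom_unit (𝒢.unit x)
    mul_arr := fun _ _ _ _ _ => by simpa [𝒢.s_unit] using 𝒢.mul_unit (𝒢.unit x) }

variable (𝒢) in
/-- The `1`-simplex of the nerve given by an element of `G`. -/
def edge (g : G) : 𝒢.nerve _⦋1⦌ := show 𝒢.NerveSimplex 1 from
  { obj := ![𝒢.t g, 𝒢.s g]
    arr := fun i j _ => if i = j then 𝒢.unit (![𝒢.t g, 𝒢.s g] i) else g
    t_arr := fun i j _ => by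
      fin_cases i <;> fin_cases j <;> simp_all [𝒢.t_unit]
    s_arr := fun i j _ => by
      fin_cases i <;> fin_cases j <;> simp_all [𝒢.s_unit]
    arr_self := fun i => by simp
    mem_mulDom := fun i j k _ _ => by
      have h₁ := 𝒢.mem_mulDom_unit (𝒢.unit (𝒢.t g))
      have h₂ := 𝒢.mem_mulDom_unit (𝒢.unit (𝒢.s g))
      have h₃ := 𝒢.mem_mulDom_unit g
      have h₄ := 𝒢.unit_mem_mulDom g
      rw [𝒢.s_unit] at h₁ h₂
      fin_cases i <;> fin_cases j <;> fin_cases k <;> simp_all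
    mul_arr := fun i j k _ _ => by
      have h₁ := 𝒢.mul_unit (𝒢.unit (𝒢.t g))
      have h₂ := 𝒢.mul_unit (𝒢.unit (𝒢.s g))
      have h₃ := 𝒢.mul_unit g
      have h₄ := 𝒢.unit_mul g
      rw [𝒢.s_unit] at h₁ h₂
      fin_cases i <;> fin_cases j <;> fin_cases k <;> simp_all }

lemma δ_zero_edge (g : G) : 𝒢.nerve.δ 0 (𝒢.edge g) = 𝒢.vertex (𝒢.s g) := by
  refine NerveSimplex.ext (funext fun i => ?_) ?_
  · fin_cases i; rfl
  · funext i j h; fin_cases i; fin_cases j; rfl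

lemma δ_one_edge (g : G) : 𝒢.nerve.δ 1 (𝒢.edge g) = 𝒢.vertex (𝒢.t g) := by
  refine NerveSimplex.ext (funext fun i => ?_) ?_
  · fin_cases i; rfl
  · funext i j h; fin_cases i; fin_cases j; rfl

end

/-! ### The fundamental groupoid of the realization, restricted to `M` -/

variable (𝒢) in
/-- The point of the geometric realization of the nerve given by a point of `M`. -/
noncomputable def realizationPoint (x : M) : SSet.toTop.obj 𝒢.nerve :=
  TopCat.toSSetObj₀Equiv
    ((sSetTopAdj.unit.app 𝒢.nerve).app (op (SimplexCategory.mk 0)) (𝒢.vertex x))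

variable (𝒢) in
/-- The restriction to `M` of the fundamental groupoid of the geometric realization of the nerve:
objects are the points of `M`, and arrows from `x` to `y` are the homotopy classes of paths from
`x` to `y` in the realization. -/
abbrev PiOne : Type u :=
  InducedCategory (FundamentalGroupoid (SSet.toTop.obj 𝒢.nerve))
    (fun x : M => FundamentalGroupoid.mk (𝒢.realizationPoint x))

end LocalLieGroupoid

/-! ### Comparison of the simplices of the nerve with tuples -/

/-- Bracketed products of elements of `G`. -/
inductive Bracketing (G : Type u) : Type u where
  | of (g : G) : Bracketing G
  | mul (a b : Bracketing G) : Bracketing G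

namespace Bracketing

variable {G : Type u}

/-- The tuple of factors of a bracketed product. -/
def factors : Bracketing G → List G
  | .of g => [g]
  | .mul a b => factors a ++ factors b

lemma factors_ne_nil (T : Bracketing G) : factors T ≠ [] := by
  induction T with
  | of g => simp [factors]
  | mul a b iha _ => simp [factors, iha]

lemma exists_factors {l : List G} (hl : l ≠ []) : ∃ T : Bracketing G, factors T = l := by
  induction l with
  | nil => exact absurd rfl hl
  | cons g l ih =>
    by_cases h : l = []
    · exact ⟨.of g, by simp [factors, h]⟩
    · obtain ⟨T, hT⟩ := ih h
      exact ⟨.mul (.of g) T, by simp [factors, hT]⟩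

end Bracketing

namespace LocalLieGroupoid

variable {d n : ℕ} {M G : Type u}
    [TopologicalSpace M] [ChartedSpace (EuclideanSpace ℝ (Fin d)) M] [IsManifold (𝓡 d) ∞ M]
    [T2Space M]
    [TopologicalSpace G] [ChartedSpace (EuclideanSpace ℝ (Fin n)) G] [IsManifold (𝓡 n) ∞ G]
    {𝒢 : LocalLieGroupoid d n M G}

open Bracketing

variable (𝒢) in
/-- `𝒢.Evaluates T g`: all multiplications in the bracketed product `T` are defined, and the value
of `T` is `g`. -/
def Evaluates : Bracketing G → G → Prop
  | .of g, x => x = g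
  | .mul a b, x => ∃ g h, Evaluates a g ∧ Evaluates b h ∧ (g, h) ∈ 𝒢.mulDom ∧ x = 𝒢.mul (g, h)

variable (𝒢) in
/-- All products of the tuple `l`, for all bracketings, are defined and equal. -/
def AllProductsDefinedAndEqual (l : List G) : Prop :=
  ∃ g, ∀ T : Bracketing G, factors T = l → 𝒢.Evaluates T g

lemma Evaluates.unique {T : Bracketing G} {g h : G} (hg : 𝒢.Evaluates T g)
    (hh : 𝒢.Evaluates T h) : g = h := by
  induction T generalizing g h with
  | of _ => exact hg.trans hh.symm
  | mul a b iha ihb =>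
    obtain ⟨p, q, hp, hq, -, rfl⟩ := hg
    obtain ⟨p', q', hp', hq', -, rfl⟩ := hh
    rw [iha hp hp', ihb hq hq']

variable (𝒢) in
/-- All products of `l` are defined. -/
def AllProductsDefined (l : List G) : Prop :=
  ∀ T : Bracketing G, factors T = l → ∃ g, 𝒢.Evaluates T g

lemma AllProductsDefined.left {a b : List G} (h : 𝒢.AllProductsDefined (a ++ b)) :
    𝒢.AllProductsDefined a := by
  intro T hT
  by_cases hb : b = []
  · subst hb
    exact h T (by simp [hT])
  · obtain ⟨S, hS⟩ := exists_factors hb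
    obtain ⟨_, g, -, hg, -⟩ := h (.mul T S) (by simp [factors, hT, hS])
    exact ⟨g, hg⟩

lemma AllProductsDefined.right {a b : List G} (h : 𝒢.AllProductsDefined (a ++ b)) :
    𝒢.AllProductsDefined b := by
  intro T hT
  by_cases ha : a = []
  · subst ha
    exact h T (by simp [hT])
  · obtain ⟨S, hS⟩ := exists_factors ha
    obtain ⟨_, -, g, -, hg, -⟩ := h (.mul S T) (by simp [factors, hT, hS])
    exact ⟨g, hg⟩

/-- Under 3-associativity, products of a tuple are equal as soon as all of them are defined. -/
lemma AllProductsDefined.eq (h3 : 𝒢.IsThreeAssociative) {l : List G}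
    (h : 𝒢.AllProductsDefined l) {T T' : Bracketing G} (hT : factors T = l) (hT' : factors T' = l)
    {g g' : G} (hg : 𝒢.Evaluates T g) (hg' : 𝒢.Evaluates T' g') : g = g' := by
  induction hk : l.length using Nat.strong_induction_on generalizing l T T' g g' with
  | _ k ih =>
  -- the case where the first tree splits the tuple no later than the second one
  have key : ∀ (A B A' B' : Bracketing G) (r : List G), factors A' = factors A ++ r →
      factors B = r ++ factors B' → factors A ++ factors B = l →
      ∀ x x', 𝒢.Evaluates (.mul A B) x → 𝒢.Evaluates (.mul A' B') x' → x = x' := by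
    intro A B A' B' r hA hB hAB x x' hx hx'
    have hl : factors A' ++ factors B' = l := by rw [hA, ← hAB, hB, List.append_assoc]
    have n1 := List.length_pos_iff.2 (factors_ne_nil A)
    have n2 := List.length_pos_iff.2 (factors_ne_nil B')
    have n3 := List.length_pos_iff.2 (factors_ne_nil B)
    have n4 := List.length_pos_iff.2 (factors_ne_nil A')
    have e1 := congrArg List.length hl
    have e2 := congrArg List.length hAB
    rw [List.length_append] at e1 e2
    have dA : 𝒢.AllProductsDefined (factors A) := (hAB ▸ h).left
    have dB : 𝒢.AllProductsDefined (factors B) := (hAB ▸ h).right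
    have dA' : 𝒢.AllProductsDefined (factors A') := (hl ▸ h).left
    have dB' : 𝒢.AllProductsDefined (factors B') := (hl ▸ h).right
    obtain ⟨p, q, hp, hq, hpq, rfl⟩ := hx
    obtain ⟨p', q', hp', hq', hpq', rfl⟩ := hx'
    by_cases hr : r = []
    · subst hr
      rw [ih _ (by omega) dA rfl (by simpa using hA) hp hp' rfl,
        ih _ (by omega) dB rfl (by simpa using hB.symm) hq hq' rfl]
    · obtain ⟨R, hR⟩ := exists_factors hr
      obtain ⟨y, hy⟩ := dA' (.mul A R) (by simp [factors, hA, hR])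
      obtain ⟨z, hz⟩ := dB (.mul R B') (by simp [factors, hB, hR])
      have hy' := ih _ (by omega) dA' (by simp [factors, hA, hR]) rfl hy hp' rfl
      have hz' := ih _ (by omega) dB (by simp [factors, hB, hR]) rfl hz hq rfl
      subst hy' hz'
      obtain ⟨p₁, r₁, hp₁, hr₁, d₁, rfl⟩ := hy
      obtain ⟨r₂, q₂, hr₂, hq₂, d₂, rfl⟩ := hz
      obtain rfl := hp₁.unique hp
      obtain rfl := hr₁.unique hr₂
      obtain rfl := hq₂.unique hq'
      exact (h3 _ _ _ d₁ hpq' d₂ hpq).symm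
  cases T with
  | of a =>
    cases T' with
    | of b =>
      simp only [factors] at hT hT'
      have : a = b := by simpa using hT.trans hT'.symm
      rw [show g = a from hg, show g' = b from hg', this]
    | mul A' B' =>
      exfalso
      have n2 := List.length_pos_iff.2 (factors_ne_nil B')
      have n4 := List.length_pos_iff.2 (factors_ne_nil A')
      have := congrArg List.length (hT.trans hT'.symm)
      simp [factors] at this
      omega
  | mul A B =>
    cases T' with
    | of b =>
      exfalso
      have n2 := List.length_pos_iff.2 (factors_ne_nil B)
      have n4 := List.length_pos_iff.2 (factors_ne_nil A)
      have := congrArg List.length (hT.trans hT'.symm)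
      simp [factors] at this
      omega
    | mul A' B' =>
      have e : factors A ++ factors B = factors A' ++ factors B' := hT.trans hT'.symm
      rcases List.append_eq_append_iff.1 e with ⟨r, h₁, h₂⟩ | ⟨r, h₁, h₂⟩
      · exact key A B A' B' r h₁ h₂ hT _ _ hg hg'
      · exact (key A' B' A B r h₁ h₂ hT' _ _ hg' hg).symm

/-- The tuple `(arr 0 1, …, arr (m-1) m)` of a simplex of the nerve. -/
def NerveSimplex.tuple {m : ℕ} (σ : 𝒢.NerveSimplex m) (i : Fin m) : G :=
  σ.arr i.castSucc i.succ i.castSucc_lt_succ.le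

lemma NerveSimplex.evaluates {m : ℕ} (σ : 𝒢.NerveSimplex m) (T : Bracketing G) :
    ∀ (i j : ℕ) (hij : i ≤ j) (hj : j < m + 1),
      factors T = (List.ofFn σ.tuple).extract i j → 
      𝒢.Evaluates T (σ.arr ⟨i, by omega⟩ ⟨j, hj⟩ hij) := by
  induction T with
  | of g =>
    intro i j hij hj h
    have hl := congrArg List.length h
    simp [factors] at hl
    obtain rfl : j = i + 1 := by omega
    have := congrArg List.head? h
    simp [factors, List.extract, List.head?_take, List.head?_drop] at this
    obtain ⟨_, rfl⟩ := this
    rfl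
  | mul a b iha ihb =>
    intro i j hij hj h
    have hl := congrArg List.length h
    simp [factors] at hl
    have na := List.length_pos_iff.2 (factors_ne_nil a)
    have nb := List.length_pos_iff.2 (factors_ne_nil b)
    set k := i + (factors a).length with hk
    have hs : (List.ofFn σ.tuple).extract i j =
        (List.ofFn σ.tuple).extract i k ++ (List.ofFn σ.tuple).extract k j := by
      simp only [List.extract_eq_take_drop]
      rw [show j - i = (k - i) + (j - k) by omega, List.take_add, List.drop_drop,
        show i + (k - i) = k by omega]
    rw [hs] at h
    obtain ⟨h₁, h₂⟩ := List.append_inj h (by simp; omega)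
    refine ⟨_, _, iha i k (by omega) (by omega) h₁, ihb k j (by omega) hj h₂, ?_, ?_⟩
    · exact σ.mem_mulDom _ _ _ _ _
    · exact (σ.mul_arr _ _ _ _ _).symm

lemma NerveSimplex.eq_of_tuple {m : ℕ} (hm : 0 < m) {σ τ : 𝒢.NerveSimplex m}
    (h : σ.tuple = τ.tuple) : σ = τ := by
  have hobj : σ.obj = τ.obj := by
    funext i
    by_cases hi : (i : ℕ) < m
    · obtain ⟨k, rfl⟩ : ∃ k : Fin m, i = k.castSucc := ⟨⟨i, hi⟩, rfl⟩
      rw [← σ.t_arr k.castSucc k.succ Fin.castSucc_lt_succ.le,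
        ← τ.t_arr k.castSucc k.succ Fin.castSucc_lt_succ.le]
      exact congrArg 𝒢.t (congrFun h k)
    · obtain ⟨k, rfl⟩ : ∃ k, m = k + 1 := ⟨m - 1, by omega⟩
      obtain rfl : i = Fin.succ (Fin.last k) := Fin.ext (by simp; omega)
      rw [← σ.s_arr (Fin.castSucc (Fin.last k)) (Fin.succ (Fin.last k)) (Fin.castSucc_lt_succ).le,
        ← τ.s_arr (Fin.castSucc (Fin.last k)) (Fin.succ (Fin.last k)) (Fin.castSucc_lt_succ).le]
      exact congrArg 𝒢.s (congrFun h (Fin.last k))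
  refine NerveSimplex.ext hobj (funext fun i => funext fun j => funext fun hij => ?_)
  rcases hij.eq_or_lt with rfl | hlt
  · rw [σ.arr_self, τ.arr_self, hobj]
  · have hne : (List.ofFn σ.tuple).extract i j ≠ [] := by
      intro h0
      have := congrArg List.length h0
      simp at this
      omega
    obtain ⟨T, hT⟩ := exists_factors hne
    exact (σ.evaluates T i j hij j.2 hT).unique (τ.evaluates T i j hij j.2 (h ▸ hT))

lemma Evaluates.t_eq {T : Bracketing G} {g : G} (h : 𝒢.Evaluates T g) :
    (factors T).head?.map 𝒢.t = some (𝒢.t g) := by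
  induction T generalizing g with
  | of a => obtain rfl : g = a := h; rfl
  | mul a b iha _ =>
    obtain ⟨p, q, hp, -, hpq, rfl⟩ := h
    rw [𝒢.t_mul _ hpq, ← iha hp, factors, List.head?_append_of_ne_nil _ (factors_ne_nil a)]

lemma Evaluates.s_eq {T : Bracketing G} {g : G} (h : 𝒢.Evaluates T g) :
    (factors T).getLast?.map 𝒢.s = some (𝒢.s g) := by
  induction T generalizing g with
  | of a => obtain rfl : g = a := h; rfl
  | mul a b _ ihb =>
    obtain ⟨p, q, -, hq, hpq, rfl⟩ := h
    rw [𝒢.s_mul _ hpq, ← ihb hq, factors, List.getLast?_append_of_ne_nil _ (factors_ne_nil b)]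

/-- For `m ≥ 1` and a 3-associative local groupoid, the `m`-simplices of the nerve are exactly the
`m`-tuples of composable elements all of whose `m`-fold products are defined and equal
(uniqueness is `NerveSimplex.eq_of_tuple`). -/
theorem exists_nerveSimplex_iff (h3 : 𝒢.IsThreeAssociative) {m : ℕ} (hm : 0 < m) (l : Fin m → G) :
    (∃ σ : 𝒢.NerveSimplex m, σ.tuple = l) ↔
      (List.ofFn l).IsChain (fun g h => 𝒢.s g = 𝒢.t h) ∧
        𝒢.AllProductsDefinedAndEqual (List.ofFn l) := by
  constructor
  · rintro ⟨σ, rfl⟩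
    refine ⟨?_, _, fun T hT => σ.evaluates T 0 m (Nat.zero_le _) (Nat.lt_succ_self m) ?_⟩
    · rw [List.isChain_iff_getElem]
      intro i hi
      simp only [List.length_ofFn] at hi
      simp only [List.getElem_ofFn, NerveSimplex.tuple, σ.s_arr, σ.t_arr]
      rfl
    · rw [hT]
      simp [List.extract_eq_take_drop]
  · rintro ⟨hc, x, hx⟩
    have hd : ∀ i j, 𝒢.AllProductsDefined ((List.ofFn l).extract i j) := by
      intro i j
      have h0 : 𝒢.AllProductsDefined (List.ofFn l) := fun T hT => ⟨x, hx T hT⟩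
      rw [List.extract_eq_take_drop]
      refine AllProductsDefined.left (b := ((List.ofFn l).drop i).drop (j - i)) ?_
      rw [List.take_append_drop]
      refine AllProductsDefined.right (a := (List.ofFn l).take i) ?_
      rwa [List.take_append_drop]
    have hne : ∀ i j : Fin (m + 1), i < j → (List.ofFn l).extract i j ≠ [] := by
      intro i j hlt h0
      have := congrArg List.length h0
      simp at this
      omega
    have hv : ∀ i j : Fin (m + 1), ∃ v, i < j → ∀ T : Bracketing G,
        factors T = (List.ofFn l).extract i j → 𝒢.Evaluates T v := by
      intro i j
      by_cases hlt : i < j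
      · obtain ⟨T, hT⟩ := exists_factors (hne i j hlt)
        obtain ⟨v, hv⟩ := hd i j T hT
        refine ⟨v, fun _ T' hT' => ?_⟩
        obtain ⟨v', hv'⟩ := hd i j T' hT'
        obtain rfl := (hd i j).eq h3 hT hT' hv hv'
        exact hv'
      · exact ⟨x, fun h => absurd h hlt⟩
    choose v hv using hv
    let o : Fin (m + 1) → M := fun i =>
      if h : (i : ℕ) < m then 𝒢.t (l ⟨i, h⟩) else 𝒢.s (l ⟨m - 1, by omega⟩)
    have ht : ∀ i j, i < j → 𝒢.t (v i j) = o i := by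
      intro i j hlt
      obtain ⟨T, hT⟩ := exists_factors (hne i j hlt)
      have h1 := (hv i j hlt T hT).t_eq
      have hi : (i : ℕ) < m := by omega
      rw [hT, List.extract_eq_take_drop, List.head?_take, if_neg (by omega), List.head?_drop] at h1
      simp [hi] at h1
      simp [o, hi, ← h1]
    have hs : ∀ i j, i < j → 𝒢.s (v i j) = o j := by
      intro i j hlt
      obtain ⟨T, hT⟩ := exists_factors (hne i j hlt)
      have h1 := (hv i j hlt T hT).s_eq
      have hj : (j : ℕ) - 1 < m := by omega
      have e1 : (i : ℕ) + (min ((j : ℕ) - i) (m - (i : ℕ)) - 1) = j - 1 := by omega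
      rw [hT, List.extract_eq_take_drop, List.getLast?_eq_getElem?] at h1
      simp [List.getElem?_take, e1] at h1
      obtain ⟨_, _, h1⟩ := h1
      rw [← h1]
      by_cases hj' : (j : ℕ) < m
      · rw [List.isChain_iff_getElem] at hc
        have h2 := hc (j - 1) (by simp; omega)
        simp only [List.getElem_ofFn] at h2
        simp only [o, hj', dif_pos, h2]
        congr 2
        exact Fin.ext (by simp; omega)
      · have : (j : ℕ) = m := by omega
        simp [o, this]
    have hmul : ∀ i j k, i < j → j < k →
        (v i j, v j k) ∈ 𝒢.mulDom ∧ 𝒢.mul (v i j, v j k) = v i k := by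
      intro i j k hij hjk
      obtain ⟨A, hA⟩ := exists_factors (hne i j hij)
      obtain ⟨B, hB⟩ := exists_factors (hne j k hjk)
      obtain ⟨p, q, hp, hq, hpq, e⟩ := hv i k (hij.trans hjk) (.mul A B) (by
        rw [factors, hA, hB]
        simp only [List.extract_eq_take_drop]
        rw [show (k : ℕ) - i = (j - i) + (k - j) by omega, List.take_add, List.drop_drop,
          show (i : ℕ) + (j - i) = j by omega])
      obtain rfl := hp.unique (hv i j hij A hA)
      obtain rfl := hq.unique (hv j k hjk B hB)
      exact ⟨hpq, e.symm⟩
    let a : Fin (m + 1) → Fin (m + 1) → G := fun i j => if i = j then 𝒢.unit (o i) else v i j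
    have a_self : ∀ i, a i i = 𝒢.unit (o i) := fun i => if_pos rfl
    have a_lt : ∀ i j, i < j → a i j = v i j := fun i j h => if_neg h.ne
    have a_t : ∀ i j, i ≤ j → 𝒢.t (a i j) = o i := by
      intro i j h
      rcases h.eq_or_lt with rfl | h
      · rw [a_self, 𝒢.t_unit]
      · rw [a_lt i j h, ht i j h]
    have a_s : ∀ i j, i ≤ j → 𝒢.s (a i j) = o j := by
      intro i j h
      rcases h.eq_or_lt with rfl | h
      · rw [a_self, 𝒢.s_unit]
      · rw [a_lt i j h, hs i j h]
    have a_mul : ∀ i j k, i ≤ j → j ≤ k →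
        (a i j, a j k) ∈ 𝒢.mulDom ∧ 𝒢.mul (a i j, a j k) = a i k := by
      intro i j k hij hjk
      rcases hij.eq_or_lt with rfl | hij'
      · rw [a_self, ← a_t i k hjk]
        exact ⟨𝒢.unit_mem_mulDom _, 𝒢.unit_mul _⟩
      rcases hjk.eq_or_lt with rfl | hjk'
      · rw [a_self, ← a_s i j hij]
        exact ⟨𝒢.mem_mulDom_unit _, 𝒢.mul_unit _⟩
      rw [a_lt _ _ hij', a_lt _ _ hjk', a_lt _ _ (hij'.trans hjk')]
      exact hmul i j k hij' hjk'
    refine ⟨⟨o, fun i j _ => a i j, a_t, a_s, a_self, fun i j k h h' => (a_mul i j k h h').1,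
      fun i j k h h' => (a_mul i j k h h').2⟩, funext fun i => ?_⟩
    have hlt : i.castSucc < i.succ := Fin.castSucc_lt_succ
    change a i.castSucc i.succ = l i
    rw [a_lt _ _ hlt]
    refine hv _ _ hlt (.of (l i)) ?_ |>.unique (T := .of (l i)) (show l i = l i from rfl)
    refine List.ext_getElem (by simp [factors]; omega) fun k h₁ h₂ => ?_
    simp only [factors, List.length_singleton, Nat.lt_one_iff] at h₁
    subst h₁
    simp [factors]

end LocalLieGroupoid

/-! ### The Moore–Smith description of the fundamental groupoid of a simplicial set -/

namespace MooreSmith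

open scoped Simplicial

/-- The quiver `X¹ ⇉ X⁰` of a simplicial set: vertices are the `0`-simplices, arrows are the
`1`-simplices `e`, with source `d₀ e` and target `d₁ e`. -/
@[ext]
structure Vertex (X : SSet.{u}) where
  /-- the underlying `0`-simplex -/
  pt : X _⦋0⦌

instance (X : SSet.{u}) : Quiver.{u} (Vertex X) where
  Hom a b := {e : X _⦋1⦌ // X.δ 0 e = a.pt ∧ X.δ 1 e = b.pt}

/-- The free groupoid `F(X¹)` on the quiver `X¹ ⇉ X⁰`.  The product `w₁ • w₂` of the text-book
notation (defined when `s w₁ = t w₂`) is the composite `w₂ ≫ w₁`. -/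
abbrev FreeGpd (X : SSet.{u}) : Type u := Quiver.FreeGroupoid (Vertex X)

variable {X : SSet.{u}}

/-- The object of the free groupoid given by a `0`-simplex. -/
def obj (a : X _⦋0⦌) : FreeGpd X := (Quiver.FreeGroupoid.of (Vertex X)).obj ⟨a⟩

/-- The arrow of the free groupoid given by a `1`-simplex with source `a` and target `b`. -/
def arrow (e : X _⦋1⦌) {a b : X _⦋0⦌} (ha : X.δ 0 e = a) (hb : X.δ 1 e = b) : obj a ⟶ obj b :=
  (Quiver.FreeGroupoid.of (Vertex X)).map (X := ⟨a⟩) (Y := ⟨b⟩) ⟨e, ha, hb⟩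

/-- The base point `d₁ d₁ σ` (the initial vertex) of a `2`-simplex. -/
def base (σ : X _⦋2⦌) : FreeGpd X := obj (X.δ 1 (X.δ 1 σ))

/-- The boundary `∂σ = d₂σ • d₀σ • (d₁σ)⁻¹` of a `2`-simplex, a loop at `base σ`. -/
def boundary (σ : X _⦋2⦌) : base σ ⟶ base σ :=
  Groupoid.inv (arrow (X.δ 1 σ) rfl rfl) ≫
    arrow (X.δ 0 σ)
      (ConcreteCategory.congr_hom (X.δ_comp_δ (n := 0) (i := 0) (j := 0) le_rfl) σ).symm rfl ≫
    arrow (X.δ 2 σ)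
      (ConcreteCategory.congr_hom (X.δ_comp_δ (n := 0) (i := 0) (j := 1) (by decide)) σ)
      (ConcreteCategory.congr_hom (X.δ_comp_δ (n := 0) (i := 1) (j := 1) le_rfl) σ)

/-- The generators `(w, σ)` of `Γ₂(x)`: a `2`-simplex `σ` and an arrow `w` of `F(X¹)` with target
`x` and source the base point of `σ`. -/
structure Gen (x : FreeGpd X) where
  /-- the `2`-simplex -/
  σ : X _⦋2⦌
  /-- the arrow to the base point -/
  w : base σ ⟶ x

/-- The relations `(w₁, σ₁)(w₁w₂, σ₂) = (w₁ ∂σ₁ w₂, σ₂)(w₁, σ₁)`. -/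
def rels (x : FreeGpd X) : Set (FreeGroup (Gen x)) :=
  {r | ∃ (σ₁ σ₂ : X _⦋2⦌) (w₁ : base σ₁ ⟶ x) (w₂ : base σ₂ ⟶ base σ₁),
    r = FreeGroup.of ⟨σ₁, w₁⟩ * FreeGroup.of ⟨σ₂, w₂ ≫ w₁⟩ *
      (FreeGroup.of ⟨σ₂, w₂ ≫ boundary σ₁ ≫ w₁⟩ * FreeGroup.of ⟨σ₁, w₁⟩)⁻¹}

/-- The group `Γ₂(x)`. -/
abbrev Gamma₂ (x : FreeGpd X) : Type u := PresentedGroup (rels x)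

/-- The group `Γ₁(x)`, the isotropy group of `F(X¹)` at `x`; its product is `•`. -/
abbrev Gamma₁ (x : FreeGpd X) : Type u := End x

/-- The value `w • ∂σ • w⁻¹` of `δ : Γ₂(x) → Γ₁(x)` on a generator. -/
def genBoundary {x : FreeGpd X} (y : Gen x) : Gamma₁ x :=
  Groupoid.inv y.w ≫ boundary y.σ ≫ y.w

lemma genBoundary_rels {x : FreeGpd X} : ∀ r ∈ rels x, FreeGroup.lift genBoundary r = 1 := by
  rintro _ ⟨σ₁, σ₂, w₁, w₂, rfl⟩
  rw [map_mul, map_inv, mul_inv_eq_one]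
  simp only [map_mul, FreeGroup.lift_apply_of, genBoundary, End.mul_def, Groupoid.inv_eq_inv,
    IsIso.inv_comp, Category.assoc, IsIso.hom_inv_id_assoc]

/-- The homomorphism `δ : Γ₂(x) → Γ₁(x)`. -/
def delta (x : FreeGpd X) : Gamma₂ x →* Gamma₁ x := PresentedGroup.toGroup genBoundary_rels

variable (X) in
/-- Arrows of the free groupoid with arbitrary source and target. -/
abbrev Arr : Type u := Σ a b : FreeGpd X, (a ⟶ b)

/-- The equivalence `w₁ ≈ w₂` on `F(X¹)`: same source, same target, and `w₂ = w₁ • δ η` for some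
`η ∈ Γ₂(s(w₁))`. -/
def Equiv (p q : Arr X) : Prop :=
  ∃ (a b : FreeGpd X) (w₁ w₂ : a ⟶ b), p = ⟨a, b, w₁⟩ ∧ q = ⟨a, b, w₂⟩ ∧
    ∃ η : Gamma₂ a, w₂ = delta a η ≫ w₁

end MooreSmith

namespace LocalLieGroupoid

variable {d n : ℕ} {M G : Type u}
    [TopologicalSpace M] [ChartedSpace (EuclideanSpace ℝ (Fin d)) M] [IsManifold (𝓡 d) ∞ M]
    [T2Space M]
    [TopologicalSpace G] [ChartedSpace (EuclideanSpace ℝ (Fin n)) G] [IsManifold (𝓡 n) ∞ G]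
    {𝒢 : LocalLieGroupoid d n M G}

variable (𝒢) in
/-- The arrow of `F(G⁽¹⁾)` given by `g ∈ G`. -/
def freeArrow (g : G) :
    MooreSmith.obj (𝒢.vertex (𝒢.s g)) ⟶ MooreSmith.obj (𝒢.vertex (𝒢.t g)) :=
  MooreSmith.arrow (𝒢.edge g) (𝒢.δ_zero_edge g) (𝒢.δ_one_edge g)

variable (𝒢) in
/-- The product `g • g₁ • ⋯ • gₖ` in `F(G⁽¹⁾)` of a well-formed word `(g, g₁, …, gₖ)`. -/
def freeProd : (g : G) → (l : List G) → (g :: l).IsChain (fun g h => 𝒢.s g = 𝒢.t h) →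
    (MooreSmith.obj (𝒢.vertex (𝒢.s ((g :: l).getLast (List.cons_ne_nil g l)))) ⟶
      MooreSmith.obj (𝒢.vertex (𝒢.t g)))
  | g, [], _ => 𝒢.freeArrow g
  | g, h :: l, hl =>
      freeProd h l hl.tail ≫
        eqToHom (by rw [(List.isChain_cons_cons.1 hl).1]) ≫ 𝒢.freeArrow g

/-- The element `w̄` of `F(G⁽¹⁾)` given by a word `w`. -/
def Word.bar : 𝒢.Word → MooreSmith.Arr 𝒢.nerve
  | ⟨g :: l, _, hl⟩ => ⟨_, _, 𝒢.freeProd g l hl⟩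

end LocalLieGroupoid

/-!
The associative completion maps to the fundamental groupoid of the realization `|𝐆|` of the nerve:
a word goes to the corresponding path of edges, and the contraction `(g, h) → (gh)` is realized by
a homotopy through the 2-simplex `(g, h)`. The theorem is deduced from the invertibility of all
arrows of the completion, together with faithfulness and fullness of this functor.

*Invertibility* (`isIso_of_sourceConnected`). Classes of elements of the domain of the inversion
are invertible. By regularity of right multiplication and the inverse function theorem in
coordinates of the source fibres (`eventually_exists_mul_eq`), the products `k h` with `k` near the
unit at `t h` fill a neighbourhood of `h` in its source fibre. Hence invertibility of the class of
`h` is a locally constant condition on the source fibres, which are connected and contain a unit.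

*Faithfulness* (`toFundamentalGroupoid_injective`). In a groupoid, two distinct parallel arrows are
separated by a functor `ρ` to a group `Γ`, so a `Γ`-valued monodromy on `|𝐆|` which restricts to `ρ`
on the edges is needed. A point `p` of a simplex is a monotone step function on `(0, 1]`, which
takes the value `i` on an interval of length `pᵢ`. Labelling the vertices of a simplex by the values
of `ρ` on the partial products from the first vertex on turns it into a step function with values in
`Γ`. A change of the simplex translates the labels, so that there is a well-defined continuous map
from `|𝐆|` to the orbit space, under `Γ`, of the space of functions `(0, 1] → Γ` with the
pseudometric "measure of the set where two functions differ" (`exists_stepMap`). The translates of a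
function by distinct elements of `Γ` have distance `1`, so the projection to the orbit space is a
covering (`FunctionSpace.isQuotientCoveringMap`), and its monodromy is the required one.

*Fullness* (`toFundamentalGroupoid_surjective`). No CW structure of `|𝐆|` is used. In the step
function picture, `|𝐆|` is covered by open sets on which most of the mass in a fixed interval
`(a, b]` belongs to one cluster of vertices that are mutually joined by the unit at some `v ∈ M`;
shifting all the mass to this cluster contracts the open set to the point `v` by a homotopy of `|𝐆|`
that moves all points within their simplices (`exists_contraction`). By subdivision, every path is
homotopic to a composite of paths contained in simplices (`fundamentalGroupoid_induction`). For such
paths it can be checked that, after joining the end points to the initial vertices of simplices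
containing them, one obtains paths of edges; this is independent of the simplices by invertibility.

*The relation `≈`*. It is a congruence on the free groupoid on `G ⇉ M` whose quotient turns the
letters of words into a multiplicative assignment, which gives one implication
(`Word.Equiv.bar`). Conversely, as the completion is a groupoid, the free groupoid maps to it; this
functor kills the boundaries of 2-simplices, hence the image of `δ`, and it maps `w̄` to the class
of `w` (`Word.Equiv.of_bar`).
-/


/-! ### Maps out of the realization of a simplicial set -/

namespace Realization

open scoped Simplicial

variable {X : SSet.{u}}

/-- The characteristic map `Δᵐ → |X|` of an `m`-simplex of a simplicial set. -/
noncomputable def realMap {m : ℕ} (σ : X _⦋m⦌) :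
    C(stdSimplex ℝ (Fin (m + 1)), SSet.toTop.obj X) :=
  TopCat.toSSetObjEquiv _ _ ((sSetTopAdj.unit.app X).app (op ⦋m⦌) σ)

lemma toSSetObjEquiv_map {Y : TopCat.{u}} {m k : SimplexCategory} (f : m ⟶ k)
    (τ : (TopCat.toSSet.obj Y).obj (op k)) (p : stdSimplex ℝ (Fin (m.len + 1))) :
    Y.toSSetObjEquiv _ ((TopCat.toSSet.obj Y).map f.op τ) p =
      Y.toSSetObjEquiv _ τ (stdSimplex.map f p) := rfl

lemma realMap_map {m k : ℕ} (f : (⦋m⦌ : SimplexCategory) ⟶ ⦋k⦌) (σ : X _⦋k⦌)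
    (p : stdSimplex ℝ (Fin (m + 1))) :
    realMap (X.map f.op σ) p = realMap σ (stdSimplex.map f p) := by
  have := ConcreteCategory.congr_hom ((sSetTopAdj.unit.app X).naturality f.op) σ
  have h2 := toSSetObjEquiv_map f ((sSetTopAdj.unit.app X).app (op ⦋k⦌) σ) p
  rw [realMap, realMap]
  refine Eq.trans ?_ h2
  exact congrArg (fun τ => (TopCat.toSSetObjEquiv _ _ τ) p) this

/-- Continuous maps out of `|X|` are the same as natural families of continuous maps on
the simplices. -/
lemma exists_continuousMap_realization {Z : Type u} [TopologicalSpace Z]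
    (F : ∀ {m : ℕ}, X _⦋m⦌ → C(stdSimplex ℝ (Fin (m + 1)), Z))
    (hF : ∀ {m k : ℕ} (f : (⦋m⦌ : SimplexCategory) ⟶ ⦋k⦌) (σ : X _⦋k⦌)
      (p : stdSimplex ℝ (Fin (m + 1))), F (X.map f.op σ) p = F σ (stdSimplex.map f p)) :
    ∃ g : C(SSet.toTop.obj X, Z), ∀ {m : ℕ} (σ : X _⦋m⦌) (p : stdSimplex ℝ (Fin (m + 1))),
      g (realMap σ p) = F σ p := by
  let φ : X ⟶ TopCat.toSSet.obj (TopCat.of Z) :=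
    { app := fun Δ => ↾fun σ =>
        ((TopCat.of Z).toSSetObjEquiv Δ).symm (F (m := Δ.unop.len) σ)
      naturality := by
        intro Δ Δ' f
        ext σ
        apply ((TopCat.of Z).toSSetObjEquiv Δ').injective
        ext p
        exact hF f.unop σ p }
  refine ⟨((sSetTopAdj.homEquiv _ _).symm φ).hom, fun {m} σ p => ?_⟩
  have h1 : sSetTopAdj.unit.app X ≫ TopCat.toSSet.map ((sSetTopAdj.homEquiv _ _).symm φ) = φ :=
    (sSetTopAdj.homEquiv X (TopCat.of Z)).apply_symm_apply φ
  have h2 := congrArg (fun ψ : X ⟶ TopCat.toSSet.obj (TopCat.of Z) =>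
    (TopCat.of Z).toSSetObjEquiv _ (ψ.app (op ⦋m⦌) σ) p) h1
  refine Eq.trans ?_ (h2.trans ?_)
  · rfl
  · exact congrArg (fun c : C(stdSimplex ℝ (Fin (m + 1)), Z) => c p)
      (Equiv.apply_symm_apply ((TopCat.of Z).toSSetObjEquiv (op ⦋m⦌)) (F σ))

/-- Continuous maps out of `|X|` are determined by their values on the simplices. -/
lemma continuousMap_realization_ext {Z : Type u} [TopologicalSpace Z]
    {g g' : C(SSet.toTop.obj X, Z)}
    (h : ∀ {m : ℕ} (σ : X _⦋m⦌) (p : stdSimplex ℝ (Fin (m + 1))),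
      g (realMap σ p) = g' (realMap σ p)) : g = g' := by
  have : (TopCat.ofHom g : SSet.toTop.obj X ⟶ TopCat.of Z) = TopCat.ofHom g' := by
    apply (sSetTopAdj.homEquiv X (TopCat.of Z)).injective
    ext Δ σ
    apply ((TopCat.of Z).toSSetObjEquiv Δ).injective
    ext p
    exact h (m := Δ.unop.len) σ p
  exact congrArg TopCat.Hom.hom this

/-- Functions out of `|X|`, without continuity: give the target the indiscrete topology. -/
lemma exists_function_realization {Z : Type u}
    (F : ∀ {m : ℕ}, X _⦋m⦌ → stdSimplex ℝ (Fin (m + 1)) → Z)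
    (hF : ∀ {m k : ℕ} (f : (⦋m⦌ : SimplexCategory) ⟶ ⦋k⦌) (σ : X _⦋k⦌)
      (p : stdSimplex ℝ (Fin (m + 1))), F (X.map f.op σ) p = F σ (stdSimplex.map f p)) :
    ∃ g : SSet.toTop.obj X → Z, ∀ {m : ℕ} (σ : X _⦋m⦌) (p : stdSimplex ℝ (Fin (m + 1))),
      g (realMap σ p) = F σ p := by
  let _ : TopologicalSpace Z := ⊤
  obtain ⟨g, hg⟩ := exists_continuousMap_realization (X := X) (Z := Z)
    (fun σ => ⟨F σ, continuous_top⟩) hF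
  exact ⟨g, hg⟩

/-- Every point of `|X|` lies in a simplex: the predicate of lying in a simplex and the constant
predicate `True`, as continuous maps to an indiscrete space, agree on all simplices. -/
lemma exists_realMap_eq (e : SSet.toTop.obj X) :
    ∃ (m : ℕ) (σ : X _⦋m⦌) (p : stdSimplex ℝ (Fin (m + 1))), realMap σ p = e := by
  let _ : TopologicalSpace (ULift.{u} Prop) := ⊤
  let g : C(SSet.toTop.obj X, ULift.{u} Prop) :=
    ⟨fun e => ⟨∃ (m : ℕ) (σ : X _⦋m⦌) (p : stdSimplex ℝ (Fin (m + 1))), realMap σ p = e⟩,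
      continuous_top⟩
  let g' : C(SSet.toTop.obj X, ULift.{u} Prop) := ⟨fun _ => ⟨True⟩, continuous_top⟩
  have : g = g' := continuousMap_realization_ext fun σ p => by
    simp only [g, g', ContinuousMap.coe_mk, ULift.up_inj, eq_iff_iff, iff_true]
    exact ⟨_, σ, p, rfl⟩
  have h := congrArg (fun c => (c e).down) this
  exact of_eq_true (h.trans (by simp [g']))

/-- Open subsets of `|X|` may be given simplexwise, as continuous maps to the Sierpiński space. -/
lemma exists_isOpen_realization
    (U : ∀ {m : ℕ}, X _⦋m⦌ → Set (stdSimplex ℝ (Fin (m + 1))))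
    (hU : ∀ {m : ℕ} (σ : X _⦋m⦌), IsOpen (U σ))
    (hF : ∀ {m k : ℕ} (f : (⦋m⦌ : SimplexCategory) ⟶ ⦋k⦌) (σ : X _⦋k⦌)
      (p : stdSimplex ℝ (Fin (m + 1))), p ∈ U (X.map f.op σ) ↔ stdSimplex.map f p ∈ U σ) :
    ∃ V : Set (SSet.toTop.obj X), IsOpen V ∧
      ∀ {m : ℕ} (σ : X _⦋m⦌) (p : stdSimplex ℝ (Fin (m + 1))), realMap σ p ∈ V ↔ p ∈ U σ := by
  obtain ⟨g, hg⟩ := exists_continuousMap_realization (X := X) (Z := ULift.{u} Prop)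
    (fun σ => ⟨fun p => ⟨p ∈ U σ⟩, continuous_uliftUp.comp (isOpen_iff_continuous_mem.1 (hU σ))⟩)
    (fun f σ p => ULift.ext _ _ (propext (hF f σ p)))
  refine ⟨{e | (g e).down}, ?_, fun σ p => ?_⟩
  · exact isOpen_iff_continuous_mem.2 (continuous_uliftDown.comp g.continuous)
  · change (g _).down ↔ _
    rw [hg]; rfl

end Realization

/-! ### Points of simplices as step functions -/

namespace StepFunction

open MeasureTheory

/-- The partial sums `p₀ + ⋯ + pⱼ` of the barycentric coordinates of a point of a simplex. -/
noncomputable def partialSum {m : ℕ} (p : stdSimplex ℝ (Fin (m + 1))) (j : Fin (m + 1)) : ℝ :=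
  ∑ i ∈ Finset.Iic j, p i

/-- A point `p` of the simplex with vertices `0, …, m` is encoded by the monotone step function on
`(0, 1]` taking the value `i` on an interval of length `pᵢ`. Its values outside of `(0, 1]` are
irrelevant. -/
noncomputable def stepFn {m : ℕ} (p : stdSimplex ℝ (Fin (m + 1))) (u : ℝ) : Fin (m + 1) :=
  if h : (Finset.univ.filter fun j => u ≤ partialSum p j).Nonempty then Finset.min' _ h else 0

variable {m k : ℕ}

lemma partialSum_last (p : stdSimplex ℝ (Fin (m + 1))) : partialSum p (Fin.last m) = 1 := by
  rw [partialSum, show Finset.Iic (Fin.last m) = Finset.univ by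
    ext i; simp [Fin.le_last]]
  exact stdSimplex.sum_eq_one p

lemma partialSum_mono (p : stdSimplex ℝ (Fin (m + 1))) : Monotone (partialSum p) := fun _ _ h =>
  Finset.sum_le_sum_of_subset_of_nonneg (Finset.Iic_subset_Iic.2 h)
    fun _ _ _ => stdSimplex.zero_le p _

lemma continuous_partialSum (j : Fin (m + 1)) :
    Continuous fun p : stdSimplex ℝ (Fin (m + 1)) => partialSum p j := by
  refine continuous_finsetSum _ fun i _ => ?_
  exact (continuous_apply i).comp continuous_subtype_val

lemma stepFn_le_iff (p : stdSimplex ℝ (Fin (m + 1))) {u : ℝ} (hu : u ≤ 1) (j : Fin (m + 1)) :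
    stepFn p u ≤ j ↔ u ≤ partialSum p j := by
  have hne : (Finset.univ.filter fun j => u ≤ partialSum p j).Nonempty :=
    ⟨Fin.last m, by simpa [partialSum_last] using hu⟩
  rw [stepFn, dif_pos hne]
  constructor
  · intro h
    have := Finset.min'_mem _ hne
    rw [Finset.mem_filter] at this
    exact this.2.trans (partialSum_mono p h)
  · intro h
    exact Finset.min'_le _ _ (by simpa using h)

lemma partialSum_map (θ : Fin (m + 1) →o Fin (k + 1)) (p : stdSimplex ℝ (Fin (m + 1)))
    (j : Fin (k + 1)) :
    partialSum (stdSimplex.map θ p) j = ∑ i with θ i ≤ j, p i := by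
  simp only [partialSum, stdSimplex.map_coe, FunOnFinite.linearMap_apply_apply]
  rw [← Finset.sum_fiberwise_of_maps_to (s := Finset.univ.filter fun i => θ i ≤ j)
    (t := Finset.Iic j) (g := θ) (by simp)]
  refine Finset.sum_congr rfl fun l hl => Finset.sum_congr ?_ fun _ _ => rfl
  ext i
  simp only [Finset.mem_filter, Finset.mem_univ, true_and, Finset.mem_Iic] at hl ⊢
  exact ⟨fun h => ⟨h ▸ hl, h⟩, fun h => h.2⟩

/-- A simplicial operator acts on step functions by composition. -/
lemma stepFn_map (θ : Fin (m + 1) →o Fin (k + 1)) (p : stdSimplex ℝ (Fin (m + 1))) {u : ℝ}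
    (hu : u ∈ Ioc (0 : ℝ) 1) : stepFn (stdSimplex.map θ p) u = θ (stepFn p u) := by
  refine eq_of_forall_ge_iff fun j => ?_
  rw [stepFn_le_iff _ hu.2, partialSum_map]
  by_cases hne : (Finset.univ.filter fun i => θ i ≤ j).Nonempty
  · set i₀ := Finset.max' _ hne
    have h₀ : θ i₀ ≤ j := by
      have := Finset.max'_mem _ hne
      rw [Finset.mem_filter] at this
      exact this.2
    have h₁ : ∀ i, θ i ≤ j ↔ i ≤ i₀ := fun i =>
      ⟨fun h => Finset.le_max' _ _ (by simpa using h), fun h => (θ.monotone h).trans h₀⟩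
    rw [h₁, stepFn_le_iff _ hu.2, partialSum]
    simp only [h₁]
    rw [show Finset.univ.filter (fun i => i ≤ i₀) = Finset.Iic i₀ by ext; simp]
  · rw [Finset.not_nonempty_iff_eq_empty] at hne
    rw [hne, Finset.sum_empty]
    refine iff_of_false (not_le.2 hu.1) fun h => ?_
    have : stepFn p u ∈ (Finset.univ.filter fun i => θ i ≤ j) := by simpa using h
    rw [hne] at this
    simp at this

/-- An upper bound for the measure of the set where the step functions of two points differ. -/
noncomputable def gap (p q : stdSimplex ℝ (Fin (m + 1))) : ℝ :=
  ∑ j, |partialSum q j - partialSum p j|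

lemma gap_nonneg (p q : stdSimplex ℝ (Fin (m + 1))) : 0 ≤ gap p q :=
  Finset.sum_nonneg fun _ _ => abs_nonneg _

lemma tendsto_gap (p : stdSimplex ℝ (Fin (m + 1))) :
    Filter.Tendsto (gap p) (nhds p) (nhds 0) := by
  have : Continuous (gap p) :=
    continuous_finsetSum _ fun j _ => ((continuous_partialSum j).sub continuous_const).abs
  simpa [gap] using this.tendsto p

lemma volume_stepFn_ne_le (p q : stdSimplex ℝ (Fin (m + 1))) :
    volume {u ∈ Ioc (0 : ℝ) 1 | stepFn p u ≠ stepFn q u} ≤ ENNReal.ofReal (gap p q) := by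
  have hsub : {u ∈ Ioc (0 : ℝ) 1 | stepFn p u ≠ stepFn q u} ⊆
      ⋃ j ∈ (Finset.univ : Finset (Fin (m + 1))), uIoc (partialSum p j) (partialSum q j) := by
    rintro u ⟨hu, hne⟩
    simp only [Finset.mem_univ, iUnion_true, mem_iUnion, mem_uIoc]
    rcases lt_or_gt_of_ne hne with h | h
    · refine ⟨stepFn p u, Or.inr ⟨?_, ?_⟩⟩
      · rw [← not_le, ← stepFn_le_iff _ hu.2, not_le]; exact h
      · rw [← stepFn_le_iff _ hu.2]
    · refine ⟨stepFn q u, Or.inl ⟨?_, ?_⟩⟩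
      · rw [← not_le, ← stepFn_le_iff _ hu.2, not_le]; exact h
      · rw [← stepFn_le_iff _ hu.2]
  refine (measure_mono hsub).trans ((measure_biUnion_finset_le _ _).trans ?_)
  rw [gap, ENNReal.ofReal_sum_of_nonneg fun _ _ => abs_nonneg _]
  exact Finset.sum_le_sum fun j _ => by rw [Real.volume_uIoc]

/-! ### The pseudometric space of functions on the unit interval with discrete values -/

/-- Functions on `(0, 1]` with values in a set `Γ`, with the pseudometric for which the distance
of two functions is the (outer) measure of the set where they differ. -/
structure FunctionSpace (Γ : Type u) : Type u where
  /-- the underlying function -/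
  toFun : ℝ → Γ

namespace FunctionSpace

variable {Γ : Type u}

noncomputable instance : PseudoEMetricSpace (FunctionSpace Γ) where
  edist f g := volume {u ∈ Ioc (0 : ℝ) 1 | f.toFun u ≠ g.toFun u}
  edist_self f := by simp
  edist_comm f g := by simp only [ne_comm]
  edist_triangle f g h := by
    refine (measure_mono ?_).trans (measure_union_le _ _)
    rintro u ⟨hu, hne⟩
    by_cases h' : f.toFun u = g.toFun u
    · exact Or.inr ⟨hu, h' ▸ hne⟩
    · exact Or.inl ⟨hu, h'⟩

lemma edist_def (f g : FunctionSpace Γ) :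
    edist f g = volume {u ∈ Ioc (0 : ℝ) 1 | f.toFun u ≠ g.toFun u} := rfl

open scoped Classical in
/-- The step function of a point of a simplex whose vertices are labelled by elements of `Γ`.
Outside of `(0, 1]` it takes its value at `1`, so that `stepFn_map` applies everywhere. -/
noncomputable def ofLabels (φ : Fin (m + 1) → Γ) (p : stdSimplex ℝ (Fin (m + 1))) :
    FunctionSpace Γ := ⟨fun u => φ (stepFn p (if u ∈ Ioc (0 : ℝ) 1 then u else 1))⟩

lemma ofLabels_map (θ : Fin (m + 1) →o Fin (k + 1)) (φ : Fin (k + 1) → Γ)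
    (p : stdSimplex ℝ (Fin (m + 1))) :
    ofLabels φ (stdSimplex.map θ p) = ofLabels (φ ∘ θ) p := by
  rw [ofLabels, ofLabels, FunctionSpace.mk.injEq]
  funext u
  rw [stepFn_map, Function.comp_apply]
  split_ifs with h
  exacts [h, ⟨one_pos, le_rfl⟩]

lemma ofLabels_vertex (φ : Fin (m + 1) → Γ) (i : Fin (m + 1)) :
    ofLabels φ (stdSimplex.vertex i) = ⟨fun _ => φ i⟩ := by
  let θ : Fin 1 →o Fin (m + 1) := ⟨fun _ => i, fun _ _ _ => le_rfl⟩
  have h := ofLabels_map θ φ (stdSimplex.vertex 0)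
  rw [stdSimplex.map_vertex] at h
  refine h.trans ?_
  rfl

lemma continuous_ofLabels (φ : Fin (m + 1) → Γ) : Continuous (ofLabels φ) := by
  rw [continuous_iff_continuousAt]
  intro p
  rw [ContinuousAt, tendsto_iff_edist_tendsto_0]
  have h := ENNReal.tendsto_ofReal (tendsto_gap p)
  rw [ENNReal.ofReal_zero] at h
  refine tendsto_of_tendsto_of_tendsto_of_le_of_le tendsto_const_nhds h (fun _ => zero_le) ?_
  intro q
  beta_reduce
  rw [edist_comm, edist_def]
  refine (measure_mono ?_).trans (volume_stepFn_ne_le p q)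
  refine fun u hu => ⟨hu.1, fun h => hu.2 ?_⟩
  simp only [ofLabels, if_pos hu.1, h]

variable [Group Γ]

noncomputable instance : MulAction Γ (FunctionSpace Γ) where
  smul γ f := ⟨fun u => γ * f.toFun u⟩
  one_smul f := by cases f; simp [HSMul.hSMul]
  mul_smul γ γ' f := by simp [HSMul.hSMul, mul_assoc]

lemma smul_toFun (γ : Γ) (f : FunctionSpace Γ) (u : ℝ) : (γ • f).toFun u = γ * f.toFun u := rfl

lemma edist_smul (γ : Γ) (f g : FunctionSpace Γ) : edist (γ • f) (γ • g) = edist f g := by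
  simp [edist_def, smul_toFun]

lemma smul_ofLabels (γ : Γ) (φ : Fin (m + 1) → Γ) (p : stdSimplex ℝ (Fin (m + 1))) :
    γ • ofLabels φ p = ofLabels (fun i => γ * φ i) p := rfl

instance : ContinuousConstSMul Γ (FunctionSpace Γ) where
  continuous_const_smul γ := by
    have : Isometry fun f : FunctionSpace Γ => γ • f := fun f g => edist_smul γ f g
    exact this.continuous

lemma edist_smul_self {γ : Γ} (hγ : γ ≠ 1) (f : FunctionSpace Γ) : edist (γ • f) f = 1 := by
  rw [edist_def]
  have : {u ∈ Ioc (0 : ℝ) 1 | (γ • f).toFun u ≠ f.toFun u} = Ioc 0 1 := by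
    ext u
    simp [smul_toFun, hγ]
  rw [this]
  simp

variable (Γ) in
/-- The quotient of the function space by the translation action of `Γ`. -/
abbrev Orbits : Type u := MulAction.orbitRel.Quotient Γ (FunctionSpace Γ)

variable (Γ) in
/-- The translates of a function by distinct elements of `Γ` have distance `1`, so that a ball of
radius `1 / 2` is disjoint from its translates. -/
lemma isQuotientCoveringMap :
    IsQuotientCoveringMap (Quotient.mk _ : FunctionSpace Γ → Orbits Γ) Γ where
  toIsQuotientMap := isQuotientMap_quotient_mk'
  toContinuousConstSMul := inferInstance
  apply_eq_iff_mem_orbit := Quotient.eq''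
  disjoint f := by
    refine ⟨Metric.eball f (1 / 2), Metric.eball_mem_nhds f (by simp), ?_⟩
    rintro γ ⟨_, ⟨g, hg, rfl⟩, hg'⟩
    by_contra hγ
    have h₁ : edist (γ • g) (γ • f) < 1 / 2 := by rw [edist_smul]; exact hg
    have h₂ : edist (γ • g) f < 1 / 2 := hg'
    have h₃ := edist_triangle_left (γ • f) f (γ • g)
    rw [edist_smul_self hγ] at h₃
    have h₄ := ENNReal.add_lt_add h₁ h₂
    rw [ENNReal.add_halves] at h₄
    exact absurd (h₃.trans_lt h₄) (lt_irrefl _)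

end FunctionSpace

end StepFunction

/-! ### Functors out of the associative completion -/

namespace LocalLieGroupoid

variable {d n : ℕ} {M G : Type u}
    [TopologicalSpace M] [ChartedSpace (EuclideanSpace ℝ (Fin d)) M] [IsManifold (𝓡 d) ∞ M]
    [T2Space M]
    [TopologicalSpace G] [ChartedSpace (EuclideanSpace ℝ (Fin n)) G] [IsManifold (𝓡 n) ∞ G]
    {𝒢 : LocalLieGroupoid d n M G}

variable (𝒢) in
/-- `𝒢.IsPath l x y`: the list `l` is composable, with source `x` and target `y`.  In contrast to
words, the list may be empty (and then `x = y`). -/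
def IsPath : List G → M → M → Prop
  | [], x, y => x = y
  | g :: l, x, y => 𝒢.t g = y ∧ IsPath l x (𝒢.s g)

lemma isPath_append {l l' : List G} {x z : M} :
    𝒢.IsPath (l ++ l') x z ↔ ∃ y, 𝒢.IsPath l' x y ∧ 𝒢.IsPath l y z := by
  induction l generalizing z with
  | nil => simp [IsPath]
  | cons g l ih => simp only [List.cons_append, IsPath, ih]; grind

lemma isPath_cons (g : G) (l : List G) (hl : (g :: l).IsChain (fun g h => 𝒢.s g = 𝒢.t h)) :
    𝒢.IsPath (g :: l) (𝒢.s ((g :: l).getLast (List.cons_ne_nil g l))) (𝒢.t g) := by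
  induction l generalizing g with
  | nil => simp [IsPath]
  | cons h l ih =>
    refine ⟨rfl, ?_⟩
    rw [(List.isChain_cons_cons.1 hl).1]
    exact ih h hl.tail

lemma Word.isPath (w : 𝒢.Word) : 𝒢.IsPath w.letters w.src w.tgt := by
  obtain ⟨l, h, hl⟩ := w
  match l, h, hl with
  | g :: l, _, hl => exact isPath_cons g l hl

lemma IsPath.unique {l : List G} (hl : l ≠ []) {x y x' y' : M} (h : 𝒢.IsPath l x y)
    (h' : 𝒢.IsPath l x' y') : x = x' ∧ y = y' := by
  induction l generalizing y y' with
  | nil => exact absurd rfl hl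
  | cons g l ih =>
    refine ⟨?_, h.1.symm.trans h'.1⟩
    cases l with
    | nil => exact Eq.trans h.2 h'.2.symm
    | cons k l => exact (ih (by simp) h.2 h'.2).1

lemma Word.isPath_iff (w : 𝒢.Word) {x y : M} :
    𝒢.IsPath w.letters x y ↔ w.src = x ∧ w.tgt = y := by
  refine ⟨fun h => w.isPath.unique w.ne_nil h, ?_⟩
  rintro ⟨rfl, rfl⟩
  exact w.isPath

variable (𝒢) in
/-- An assignment of arrows of a category to the elements of `G` is multiplicative if it respects
the products which are defined in `G`. -/
def Multiplicative {C : Type*} [Category* C] {o : M → C}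
    (E : ∀ (g : G) {x y : M}, 𝒢.s g = x → 𝒢.t g = y → (o x ⟶ o y)) : Prop :=
  ∀ g h, (g, h) ∈ 𝒢.mulDom → ∀ x y z (h₁ : 𝒢.s h = x) (h₂ : 𝒢.t h = y) (h₃ : 𝒢.s g = y)
    (h₄ : 𝒢.t g = z) (h₅ : 𝒢.s (𝒢.mul (g, h)) = x) (h₆ : 𝒢.t (𝒢.mul (g, h)) = z),
    E h h₁ h₂ ≫ E g h₃ h₄ = E (𝒢.mul (g, h)) h₅ h₆

section Eval

variable {C : Type*} [Category* C] {o : M → C}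
  (E : ∀ (g : G) {x y : M}, 𝒢.s g = x → 𝒢.t g = y → (o x ⟶ o y))

/-- The value of a composable list of elements of `G` in a category, given values `E` of the
elements of `G`. Since the product `g h` means `h` followed by `g`, the value of the head of the
list is the last factor of the composite. -/
def evalList : (l : List G) → (x y : M) → 𝒢.IsPath l x y → (o x ⟶ o y)
  | [], _, _, h => eqToHom (congrArg o h)
  | g :: l, x, _, h => evalList l x (𝒢.s g) h.2 ≫ E g rfl h.1

lemma evalList_cons (g : G) (l : List G) {x y z : M} (h : 𝒢.IsPath (g :: l) x y)
    (hz : 𝒢.s g = z) (h' : 𝒢.IsPath l x z) :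
    evalList E (g :: l) x y h = evalList E l x z h' ≫ E g hz h.1 := by
  subst hz; rfl

lemma evalList_singleton (g : G) {x y : M} (h : 𝒢.IsPath [g] x y) :
    evalList E [g] x y h = E g h.2.symm h.1 := by
  obtain ⟨rfl, h⟩ := h
  obtain rfl : x = 𝒢.s g := h
  simp [evalList]

lemma evalList_append (l l' : List G) {x y z : M} (h : 𝒢.IsPath (l ++ l') x z)
    (h₁ : 𝒢.IsPath l' x y) (h₂ : 𝒢.IsPath l y z) :
    evalList E (l ++ l') x z h = evalList E l' x y h₁ ≫ evalList E l y z h₂ := by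
  induction l generalizing z with
  | nil =>
    obtain rfl : y = z := h₂
    simp [evalList]
  | cons g l ih =>
    simp only [List.cons_append, evalList]
    rw [ih h.2 h₂.2, Category.assoc]

lemma map_evalList {D : Type*} [Category* D] (F : C ⥤ D) (l : List G) {x y : M}
    (h : 𝒢.IsPath l x y) :
    F.map (evalList E l x y h) =
      evalList (o := fun x => F.obj (o x)) (fun g _ _ hs ht => F.map (E g hs ht)) l x y h := by
  induction l generalizing y with
  | nil =>
    obtain rfl : x = y := h
    simp [evalList]
  | cons g l ih => simp [evalList, ih]

variable {E}

lemma evalList_eq_of_contracts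
    (hE : 𝒢.Multiplicative E)
    {w w' : 𝒢.Word} (hw : w.Contracts w') {x y : M} (h : 𝒢.IsPath w.letters x y)
    (h' : 𝒢.IsPath w'.letters x y) :
    evalList E w.letters x y h = evalList E w'.letters x y h' := by
  obtain ⟨⟨_, _, _⟩, _, _⟩ := w, w'
  obtain ⟨a, b, g, k, hd, e₁, e₂⟩ := hw
  dsimp only at e₁ e₂ h h' ⊢
  subst e₁ e₂
  obtain ⟨z, hz, hz'⟩ := isPath_append.1 h
  obtain ⟨ht, hs, hb⟩ := hz
  have hs' := 𝒢.s_mul _ hd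
  have hc : 𝒢.IsPath (𝒢.mul (g, k) :: b) x z := ⟨(𝒢.t_mul _ hd).trans ht, hs'.symm ▸ hb⟩
  have hb' : 𝒢.IsPath (k :: b) x (𝒢.s g) := ⟨hs, hb⟩
  have hab : 𝒢.IsPath (g :: k :: b) x z := ⟨ht, hb'⟩
  rw [evalList_append E a (g :: k :: b) h hab hz', evalList_append E a _ h' hc hz',
    evalList_cons E _ b hc hs' hb, evalList_cons E g _ hab rfl hb', evalList_cons E k b hb' rfl hb,
    Category.assoc (evalList E b _ _ hb)]
  rw [hE g k hd _ _ _ rfl hs rfl ht hs' hc.1]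

lemma evalList_eq_of_equiv
    (hE : 𝒢.Multiplicative E)
    {w w' : 𝒢.Word} (hw : w.Equiv w') {x y : M} (h : 𝒢.IsPath w.letters x y)
    (h' : 𝒢.IsPath w'.letters x y) :
    evalList E w.letters x y h = evalList E w'.letters x y h' := by
  induction hw generalizing x y with
  | rel _ _ hw => exact evalList_eq_of_contracts hE hw h h'
  | refl _ => rfl
  | symm _ _ _ ih => exact (ih h' h).symm
  | trans u v w huv _ ih₁ ih₂ =>
    have huv : u.Equiv v := huv
    have hv : 𝒢.IsPath v.letters x y := by
      rw [Word.isPath_iff] at h ⊢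
      rwa [← huv.src_eq, ← huv.tgt_eq]
    exact (ih₁ h hv).trans (ih₂ hv h')

end Eval

namespace AssocCompletion

/-- The functor from the associative completion to a groupoid given by a multiplicative assignment
of arrows to the elements of `G`. -/
def lift {C : Type*} [Groupoid C] {o : M → C}
    (E : ∀ (g : G) {x y : M}, 𝒢.s g = x → 𝒢.t g = y → (o x ⟶ o y)) (hE : 𝒢.Multiplicative E) :
    AssocCompletion 𝒢 ⥤ C where
  obj x := o x.pt
  map {x y} f := Quotient.lift (fun w : {w : 𝒢.Word // w.src = x.pt ∧ w.tgt = y.pt} =>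
    evalList E w.1.letters x.pt y.pt (w.1.isPath_iff.2 w.2))
    (fun _ _ h => evalList_eq_of_equiv hE h _ _) f
  map_id x := by
    have hu := 𝒢.mem_mulDom_unit (𝒢.unit x.pt)
    have hu' := 𝒢.mul_unit (𝒢.unit x.pt)
    rw [𝒢.s_unit] at hu hu'
    -- the value at a unit is idempotent, hence an identity
    have h := hE _ _ hu x.pt x.pt x.pt (𝒢.s_unit _) (𝒢.t_unit _) (𝒢.s_unit _) (𝒢.t_unit _)
      (by rw [hu', 𝒢.s_unit]) (by rw [hu', 𝒢.t_unit])
    simp only [hu'] at h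
    have h' : E (𝒢.unit x.pt) (𝒢.s_unit _) (𝒢.t_unit _) = 𝟙 _ := by
      rwa [← cancel_epi (E (𝒢.unit x.pt) (𝒢.s_unit _) (𝒢.t_unit _)), Category.comp_id]
    exact (evalList_singleton E _ _).trans h'
  map_comp {x y z} f g := by
    induction f using Quotient.inductionOn with | _ w => ?_
    induction g using Quotient.inductionOn with | _ v => ?_
    exact evalList_append E v.1.letters w.1.letters _ (w.1.isPath_iff.2 w.2) (v.1.isPath_iff.2 v.2)

/-- The class of the one-letter word `(g)`. -/
def cls (g : G) {x y : M} (hs : 𝒢.s g = x) (ht : 𝒢.t g = y) :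
    (⟨x⟩ : AssocCompletion 𝒢) ⟶ ⟨y⟩ :=
  Quotient.mk (Word.setoid 𝒢 x y) ⟨Word.single g, hs, ht⟩

/-- The class of a word. -/
def wordCls (w : 𝒢.Word) {x y : M} (hs : w.src = x) (ht : w.tgt = y) :
    (⟨x⟩ : AssocCompletion 𝒢) ⟶ ⟨y⟩ :=
  Quotient.mk (Word.setoid 𝒢 x y) ⟨w, hs, ht⟩

lemma wordCls_eq_iff {w w' : 𝒢.Word} {x y : M} (hs : w.src = x) (ht : w.tgt = y)
    (hs' : w'.src = x) (ht' : w'.tgt = y) :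
    wordCls w hs ht = wordCls w' hs' ht' ↔ w.Equiv w' :=
  Quotient.eq (r := Word.setoid 𝒢 x y)

lemma exists_wordCls_eq {x y : AssocCompletion 𝒢} (f : x ⟶ y) :
    ∃ (w : 𝒢.Word) (hs : w.src = x.pt) (ht : w.tgt = y.pt), wordCls w hs ht = f := by
  induction f using Quotient.inductionOn with | _ w => ?_
  exact ⟨w.1, w.2.1, w.2.2, rfl⟩

/-- The universal multiplicative assignment. -/
lemma multiplicative_cls : 𝒢.Multiplicative (o := AssocCompletion.mk) cls := by
  intro g h hd x y z h₁ h₂ h₃ h₄ h₅ h₆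
  exact Quotient.sound (s := Word.setoid 𝒢 x z) (Relation.EqvGen.rel _ _
    ⟨[], [], g, h, hd, rfl, rfl⟩)

lemma wordCls_eq_evalList (w : 𝒢.Word) {x y : M} (hs : w.src = x) (ht : w.tgt = y) :
    wordCls w hs ht =
      evalList (o := AssocCompletion.mk) cls w.letters x y (w.isPath_iff.2 ⟨hs, ht⟩) := by
  obtain ⟨l, hne, hl⟩ := w
  induction l generalizing y with
  | nil => exact absurd rfl hne
  | cons g l ih =>
    cases l with
    | nil =>
      rw [evalList_singleton]
      rfl
    | cons k l =>
      have hgk : 𝒢.t k = 𝒢.s g := (List.isChain_cons_cons.1 hl).1.symm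
      have h := ih (List.cons_ne_nil k l) hl.tail (y := 𝒢.s g) hs hgk
      rw [evalList_cons _ g _ _ rfl
        ((Word.isPath_iff ⟨k :: l, List.cons_ne_nil k l, hl.tail⟩).2 ⟨hs, hgk⟩), ← h]
      rfl

end AssocCompletion

end LocalLieGroupoid

/-! ### The congruence `≈` on the free groupoid of a simplicial set -/

namespace MooreSmith

open scoped Simplicial

variable {X : SSet.{u}}

/-- The images of the homomorphisms `δ` are stable under conjugation with arrows of the free
groupoid, since the generators `(w, σ)` are. -/
lemma conj_mem_range_delta {a b : FreeGpd X} (k : b ⟶ a) (η : Gamma₂ a) :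
    ∃ η' : Gamma₂ b, delta b η' = k ≫ delta a η ≫ Groupoid.inv k := by
  let c : End a →* End b :=
    { toFun := fun f => k ≫ f ≫ Groupoid.inv k
      map_one' := by simp [End.one_def]
      map_mul' := fun f g => by simp [End.mul_def] }
  suffices h : ∀ f : FreeGroup (Gen a), c (delta a (PresentedGroup.mk _ f)) ∈ (delta b).range by
    obtain ⟨f, rfl⟩ := PresentedGroup.mk_surjective _ η
    exact h f
  intro f
  induction f using FreeGroup.induction_on with
  | C1 => simp only [map_one]; exact one_mem _
  | of y =>
    refine ⟨PresentedGroup.of ⟨y.σ, y.w ≫ Groupoid.inv k⟩, ?_⟩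
    have h₁ : delta a (PresentedGroup.of y) = genBoundary y :=
      PresentedGroup.toGroup.of genBoundary_rels
    have h₂ : delta b (PresentedGroup.of ⟨y.σ, y.w ≫ Groupoid.inv k⟩) =
        genBoundary ⟨y.σ, y.w ≫ Groupoid.inv k⟩ :=
      PresentedGroup.toGroup.of genBoundary_rels
    rw [h₂]
    change _ = c (delta a (PresentedGroup.of y))
    rw [h₁]
    simp [c, genBoundary]
  | inv_of y ih => simp only [map_inv]; exact inv_mem ih
  | mul f g hf hg => simp only [map_mul]; exact mul_mem hf hg

variable (X) in
/-- The relation `≈` on parallel arrows of the free groupoid `F(X¹)`. -/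
def homRel : HomRel (FreeGpd X) := fun a _ w₁ w₂ => ∃ η : Gamma₂ a, w₂ = delta a η ≫ w₁

instance : Congruence (homRel X) where
  comp_left {a b c} f {g g'} := by
    rintro ⟨η, rfl⟩
    obtain ⟨η', h⟩ := conj_mem_range_delta f η
    exact ⟨η', by simp [h]⟩
  comp_right {a b c} f f' g := by
    rintro ⟨η, rfl⟩
    exact ⟨η, by simp⟩
  equivalence {a b} :=
    { refl := fun f => ⟨1, by simp [End.one_def]⟩
      symm := by
        rintro f _ ⟨η, rfl⟩
        refine ⟨η⁻¹, ?_⟩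
        have h : delta a η * delta a η⁻¹ = 1 := by rw [map_inv, mul_inv_cancel]
        rw [← Category.assoc, ← End.mul_def, h, End.one_def, Category.id_comp]
      trans := by
        rintro f _ _ ⟨η, rfl⟩ ⟨η', rfl⟩
        refine ⟨η * η', ?_⟩
        rw [map_mul, End.mul_def, Category.assoc] }

lemma equiv_iff_homRel {a b : FreeGpd X} (w w' : a ⟶ b) :
    MooreSmith.Equiv ⟨a, b, w⟩ ⟨a, b, w'⟩ ↔ homRel X w w' := by
  constructor
  · rintro ⟨a', b', w₁, w₂, h₁, h₂, h⟩
    cases h₁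
    cases h₂
    exact h
  · exact fun h => ⟨a, b, w, w', rfl, rfl, h⟩

/-- The boundary of a `2`-simplex is trivial modulo `≈`, that is, the middle face is equivalent to
the product of the other two faces. -/
lemma homRel_of_simplex (σ : X _⦋2⦌) {a b c : X _⦋0⦌} {e₀ e₁ e₂ : X _⦋1⦌} (h₀ : X.δ 0 σ = e₀)
    (h₁ : X.δ 1 σ = e₁) (h₂ : X.δ 2 σ = e₂) (h₀s : X.δ 0 e₀ = a) (h₀t : X.δ 1 e₀ = b)
    (h₂s : X.δ 0 e₂ = b) (h₂t : X.δ 1 e₂ = c) (h₁s : X.δ 0 e₁ = a) (h₁t : X.δ 1 e₁ = c) :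
    homRel X (arrow e₁ h₁s h₁t) (arrow e₀ h₀s h₀t ≫ arrow e₂ h₂s h₂t) := by
  subst h₀ h₁ h₂ h₁t h₀t h₁s
  refine ⟨PresentedGroup.of ⟨σ, Groupoid.inv (arrow (X.δ 1 σ) rfl rfl)⟩, ?_⟩
  have h : delta _ (PresentedGroup.of ⟨σ, Groupoid.inv (arrow (X.δ 1 σ) rfl rfl)⟩) =
      genBoundary ⟨σ, Groupoid.inv (arrow (X.δ 1 σ) rfl rfl)⟩ :=
    PresentedGroup.toGroup.of genBoundary_rels
  rw [h]
  have key : ∀ {a b c : FreeGpd X} (f : a ⟶ c) (g : a ⟶ b) (k : b ⟶ c),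
      g ≫ k = (Groupoid.inv (Groupoid.inv f) ≫ (Groupoid.inv f ≫ g ≫ k) ≫ Groupoid.inv f) ≫ f := by
    intros; simp
  exact key _ _ _

end MooreSmith

namespace LocalLieGroupoid

open scoped Simplicial

variable {d n : ℕ} {M G : Type u}
    [TopologicalSpace M] [ChartedSpace (EuclideanSpace ℝ (Fin d)) M] [IsManifold (𝓡 d) ∞ M]
    [T2Space M]
    [TopologicalSpace G] [ChartedSpace (EuclideanSpace ℝ (Fin n)) G] [IsManifold (𝓡 n) ∞ G]
    {𝒢 : LocalLieGroupoid d n M G}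

/-! ### The `2`-simplices of the nerve -/

section Triangle

variable {g h : G} (hd : (g, h) ∈ 𝒢.mulDom)

lemma composable_of_mem_mulDom {p : G × G} (hp : p ∈ 𝒢.mulDom) : 𝒢.s p.1 = 𝒢.t p.2 := by
  obtain ⟨O, -, hO⟩ := 𝒢.mulDom_open
  rw [hO] at hp
  exact hp.2

/-- The `2`-simplex of the nerve given by a pair of elements whose product is defined. The entries
of the matrix below the diagonal are irrelevant. -/
def triangle : 𝒢.nerve _⦋2⦌ := show 𝒢.NerveSimplex 2 from
  { obj := ![𝒢.t g, 𝒢.s g, 𝒢.s h]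
    arr := fun i j _ => ![![𝒢.unit (𝒢.t g), g, 𝒢.mul (g, h)], ![g, 𝒢.unit (𝒢.s g), h],
      ![g, g, 𝒢.unit (𝒢.s h)]] i j
    t_arr := fun i j _ => by
      have h₁ := 𝒢.t_mul _ hd
      have h₂ := composable_of_mem_mulDom hd
      fin_cases i <;> fin_cases j <;> simp_all [𝒢.t_unit]
    s_arr := fun i j _ => by
      have h₁ := 𝒢.s_mul _ hd
      have h₂ := composable_of_mem_mulDom hd
      fin_cases i <;> fin_cases j <;> simp_all [𝒢.s_unit]
    arr_self := fun i => by
      fin_cases i <;> simp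
    mem_mulDom := fun i j k _ _ => by
      have h₁ : ∀ x, (𝒢.unit x, 𝒢.unit x) ∈ 𝒢.mulDom := fun x => by
        simpa [𝒢.s_unit] using 𝒢.mem_mulDom_unit (𝒢.unit x)
      have h₂ := 𝒢.mem_mulDom_unit g
      have h₃ := 𝒢.unit_mem_mulDom g
      have h₄ := 𝒢.mem_mulDom_unit h
      have h₅ := 𝒢.unit_mem_mulDom h
      have h₆ := 𝒢.mem_mulDom_unit (𝒢.mul (g, h))
      have h₇ := 𝒢.unit_mem_mulDom (𝒢.mul (g, h))
      have h₈ := 𝒢.t_mul _ hd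
      have h₉ := 𝒢.s_mul _ hd
      have h₀ := composable_of_mem_mulDom hd
      fin_cases i <;> fin_cases j <;> fin_cases k <;> simp_all
    mul_arr := fun i j k _ _ => by
      have h₁ : ∀ x, 𝒢.mul (𝒢.unit x, 𝒢.unit x) = 𝒢.unit x := fun x => by
        simpa [𝒢.s_unit] using 𝒢.mul_unit (𝒢.unit x)
      have h₂ := 𝒢.mul_unit g
      have h₃ := 𝒢.unit_mul g
      have h₄ := 𝒢.mul_unit h
      have h₅ := 𝒢.unit_mul h
      have h₆ := 𝒢.mul_unit (𝒢.mul (g, h))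
      have h₇ := 𝒢.unit_mul (𝒢.mul (g, h))
      have h₈ := 𝒢.t_mul _ hd
      have h₉ := 𝒢.s_mul _ hd
      have h₀ := composable_of_mem_mulDom hd
      fin_cases i <;> fin_cases j <;> fin_cases k <;> simp_all }

/-- A `1`-simplex of the nerve is determined by its underlying element of `G`. -/
lemma eq_edge (e : 𝒢.nerve _⦋1⦌) : e = 𝒢.edge (NerveSimplex.arr e 0 1 (Fin.zero_le _)) := by
  refine NerveSimplex.eq_of_tuple (m := 1) one_pos (funext fun i => ?_)
  fin_cases i
  rfl

lemma δ_zero_triangle : 𝒢.nerve.δ 0 (triangle hd) = 𝒢.edge h := eq_edge _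

lemma δ_one_triangle : 𝒢.nerve.δ 1 (triangle hd) = 𝒢.edge (𝒢.mul (g, h)) := eq_edge _

lemma δ_two_triangle : 𝒢.nerve.δ 2 (triangle hd) = 𝒢.edge g := eq_edge _

end Triangle

/-! ### Comparison of the equivalence relations on words -/

variable (𝒢) in
/-- The arrow `freeArrow` of `F(G⁽¹⁾)` given by `g ∈ G`, with specified source and target. -/
def freeArrow' (g : G) {x y : M} (hs : 𝒢.s g = x) (ht : 𝒢.t g = y) :
    MooreSmith.obj (𝒢.vertex x) ⟶ MooreSmith.obj (𝒢.vertex y) :=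
  MooreSmith.arrow (𝒢.edge g) (by rw [δ_zero_edge, hs]) (by rw [δ_one_edge, ht])

lemma freeProd_eq_evalList (g : G) (l : List G)
    (hl : (g :: l).IsChain (fun g h => 𝒢.s g = 𝒢.t h)) :
    𝒢.freeProd g l hl =
      evalList (o := fun x => MooreSmith.obj (𝒢.vertex x)) 𝒢.freeArrow' (g :: l) _ _
        (isPath_cons g l hl) := by
  induction l generalizing g with
  | nil =>
    exact (evalList_singleton (o := fun x => MooreSmith.obj (𝒢.vertex x)) 𝒢.freeArrow' g _).symm
  | cons k l ih =>
    have hk := (List.isChain_cons_cons.1 hl).1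
    refine Eq.trans ?_ (evalList_cons (o := fun x => MooreSmith.obj (𝒢.vertex x)) 𝒢.freeArrow' g
      (k :: l) (isPath_cons g (k :: l) hl) hk (isPath_cons k l hl.tail)).symm
    have h : ∀ (x : M) (hx : 𝒢.s g = x), eqToHom (by rw [hx]) ≫ 𝒢.freeArrow g =
        𝒢.freeArrow' g hx rfl := by
      rintro _ rfl
      simp [freeArrow, freeArrow']
    refine Eq.trans ?_ (congrArg (· ≫ 𝒢.freeArrow' g hk rfl) (ih k hl.tail))
    exact congrArg (𝒢.freeProd k l hl.tail ≫ ·) (h _ hk)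

lemma Word.bar_eq (w : 𝒢.Word) {x y : M} (h : 𝒢.IsPath w.letters x y) :
    w.bar = ⟨_, _, evalList (o := fun x => MooreSmith.obj (𝒢.vertex x)) 𝒢.freeArrow' w.letters
      x y h⟩ := by
  obtain ⟨rfl, rfl⟩ := w.isPath_iff.1 h
  obtain ⟨l, hne, hl⟩ := w
  match l, hne, hl with
  | g :: l, hne, hl =>
    rw [Word.bar, freeProd_eq_evalList]
    rfl

variable (𝒢) in
lemma multiplicative_freeArrow' :
    𝒢.Multiplicative
      (o := fun x => (CategoryTheory.Quotient.functor (MooreSmith.homRel 𝒢.nerve)).obj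
        (MooreSmith.obj (𝒢.vertex x)))
      (fun g _ _ hs ht => (CategoryTheory.Quotient.functor (MooreSmith.homRel 𝒢.nerve)).map
        (𝒢.freeArrow' g hs ht)) := by
  intro g h hd x y z h₁ h₂ h₃ h₄ h₅ h₆
  rw [← Functor.map_comp]
  exact (CategoryTheory.Quotient.sound _ (MooreSmith.homRel_of_simplex (triangle hd)
    (δ_zero_triangle hd) (δ_one_triangle hd) (δ_two_triangle hd) _ _ _ _ _ _)).symm

/-- The letters of a word form a multiplicative assignment modulo `≈`, by the triangle `(g, h)`. -/
lemma Word.Equiv.bar {w w' : 𝒢.Word} (h : w.Equiv w') : MooreSmith.Equiv w.bar w'.bar := by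
  have h' : 𝒢.IsPath w'.letters w.src w.tgt := w'.isPath_iff.2 ⟨h.src_eq.symm, h.tgt_eq.symm⟩
  rw [w.bar_eq w.isPath, w'.bar_eq h', MooreSmith.equiv_iff_homRel,
    ← CategoryTheory.Quotient.functor_map_eq_iff (MooreSmith.homRel 𝒢.nerve), map_evalList,
    map_evalList]
  exact evalList_eq_of_equiv 𝒢.multiplicative_freeArrow' h _ _

section Groupoid

variable (𝒢) in
/-- The prefunctor from the quiver `G⁽¹⁾ ⇉ M` to the associative completion. -/
def toCompletion : MooreSmith.Vertex 𝒢.nerve ⥤q AssocCompletion 𝒢 where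
  obj a := ⟨NerveSimplex.obj a.pt 0⟩
  map e := AssocCompletion.cls (NerveSimplex.arr e.1 0 1 (Fin.zero_le _))
    ((NerveSimplex.s_arr e.1 0 1 _).trans
      (congrArg (fun v : 𝒢.nerve _⦋0⦌ => NerveSimplex.obj v 0) e.2.1))
    ((NerveSimplex.t_arr e.1 0 1 _).trans
      (congrArg (fun v : 𝒢.nerve _⦋0⦌ => NerveSimplex.obj v 0) e.2.2))

/-- A groupoid structure on the associative completion. -/
@[reducible]
noncomputable def completionGroupoid (hiso : ∀ (x y : AssocCompletion 𝒢) (f : x ⟶ y), IsIso f) :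
    Groupoid (AssocCompletion 𝒢) :=
  { (inferInstance : Category (AssocCompletion 𝒢)) with
    inv := fun {x y} f => (hiso x y f).out.choose
    inv_comp := fun {x y} f => (hiso x y f).out.choose_spec.2
    comp_inv := fun {x y} f => (hiso x y f).out.choose_spec.1 }

variable (hiso : ∀ (x y : AssocCompletion 𝒢) (f : x ⟶ y), IsIso f)

/-- The functor from the free groupoid on `G⁽¹⁾ ⇉ M` to the associative completion. -/
noncomputable def freeToCompletion : MooreSmith.FreeGpd 𝒢.nerve ⥤ AssocCompletion 𝒢 :=
  letI := completionGroupoid hiso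
  Quiver.FreeGroupoid.lift 𝒢.toCompletion

lemma freeToCompletion_arrow (e : 𝒢.nerve _⦋1⦌) {a b : 𝒢.nerve _⦋0⦌} (ha : 𝒢.nerve.δ 0 e = a)
    (hb : 𝒢.nerve.δ 1 e = b) :
    (freeToCompletion hiso).map (MooreSmith.arrow e ha hb) =
      𝒢.toCompletion.map (X := ⟨a⟩) (Y := ⟨b⟩) ⟨e, ha, hb⟩ := by
  exact Category.id_comp (𝒢.toCompletion.map (X := ⟨a⟩) (Y := ⟨b⟩) ⟨e, ha, hb⟩)

lemma freeToCompletion_boundary (σ : 𝒢.nerve _⦋2⦌) :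
    (freeToCompletion hiso).map (MooreSmith.boundary σ) = 𝟙 _ := by
  have key : ∀ {a b c : MooreSmith.FreeGpd 𝒢.nerve} (f : a ⟶ c) (g : a ⟶ b) (k : b ⟶ c),
      (freeToCompletion hiso).map g ≫ (freeToCompletion hiso).map k =
        (freeToCompletion hiso).map f →
      (freeToCompletion hiso).map (Groupoid.inv f ≫ g ≫ k) = 𝟙 _ := by
    intro a b c f g k h
    rw [Functor.map_comp, Functor.map_comp, h, ← Functor.map_comp, Groupoid.inv_comp,
      CategoryTheory.Functor.map_id]
  refine key _ _ _ ?_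
  -- the end points of the three arrows agree only up to unfolding of the boundary identities
  erw [freeToCompletion_arrow, freeToCompletion_arrow, freeToCompletion_arrow]
  have hm : ∀ (g h k : G), (g, h) ∈ 𝒢.mulDom → 𝒢.mul (g, h) = k → ∀ (x y z : M)
      (h₁ : 𝒢.s h = x) (h₂ : 𝒢.t h = y) (h₃ : 𝒢.s g = y) (h₄ : 𝒢.t g = z) (h₅ : 𝒢.s k = x)
      (h₆ : 𝒢.t k = z), AssocCompletion.cls h h₁ h₂ ≫ AssocCompletion.cls g h₃ h₄ =
        AssocCompletion.cls k h₅ h₆ := by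
    rintro g h _ hd rfl x y z h₁ h₂ h₃ h₄ h₅ h₆
    exact AssocCompletion.multiplicative_cls g h hd x y z h₁ h₂ h₃ h₄ h₅ h₆
  refine hm _ _ _ (NerveSimplex.mem_mulDom (m := 2) σ 0 1 2 (by decide) (by decide))
    (NerveSimplex.mul_arr (m := 2) σ 0 1 2 (by decide) (by decide)) _ _ _
    (NerveSimplex.s_arr (m := 2) σ 1 2 _) (NerveSimplex.t_arr (m := 2) σ 1 2 _)
    (NerveSimplex.s_arr (m := 2) σ 0 1 _) (NerveSimplex.t_arr (m := 2) σ 0 1 _)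
    (NerveSimplex.s_arr (m := 2) σ 0 2 _) (NerveSimplex.t_arr (m := 2) σ 0 2 _)

lemma freeToCompletion_delta {a : MooreSmith.FreeGpd 𝒢.nerve} (η : MooreSmith.Gamma₂ a) :
    (freeToCompletion hiso).map (MooreSmith.delta a η) = 𝟙 _ := by
  have hmul : ∀ f g : End a, (freeToCompletion hiso).map (f * g) =
      (freeToCompletion hiso).map g ≫ (freeToCompletion hiso).map f :=
    fun f g => Functor.map_comp _ g f
  have hone : (freeToCompletion hiso).map (1 : End a) = 𝟙 _ := CategoryTheory.Functor.map_id _ _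
  obtain ⟨f, rfl⟩ := PresentedGroup.mk_surjective _ η
  induction f using FreeGroup.induction_on with
  | C1 => rw [map_one, map_one, hone]
  | of y =>
    have h₁ : MooreSmith.delta a (PresentedGroup.of y) = MooreSmith.genBoundary y :=
      PresentedGroup.toGroup.of MooreSmith.genBoundary_rels
    change (freeToCompletion hiso).map (MooreSmith.delta a (PresentedGroup.of y)) = _
    rw [h₁, MooreSmith.genBoundary, Functor.map_comp, Functor.map_comp,
      freeToCompletion_boundary, Category.id_comp, ← Functor.map_comp, Groupoid.inv_comp,
      CategoryTheory.Functor.map_id]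
  | inv_of y ih =>
    let q : MooreSmith.Gamma₂ a := PresentedGroup.mk _ (FreeGroup.of y)
    have h0 : MooreSmith.delta a q * MooreSmith.delta a q⁻¹ = 1 := by
      rw [← map_mul, mul_inv_cancel, map_one]
    have h := hmul (MooreSmith.delta a q) (MooreSmith.delta a q⁻¹)
    rw [h0, hone, ih, Category.comp_id] at h
    rw [map_inv (PresentedGroup.mk _)]
    exact h.symm
  | mul f g hf hg => rw [map_mul, map_mul, hmul, hf, hg, Category.comp_id]

include hiso in
/-- The functor from the free groupoid to the completion maps `w̄` to the class of `w`, and it is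
constant on the classes of `≈`. -/
lemma Word.Equiv.of_bar {w w' : 𝒢.Word} (h : MooreSmith.Equiv w.bar w'.bar) : w.Equiv w' := by
  let T : MooreSmith.Arr 𝒢.nerve → Σ a b : AssocCompletion 𝒢, (a ⟶ b) := fun p =>
    ⟨_, _, (freeToCompletion hiso).map p.2.2⟩
  have hT : ∀ w : 𝒢.Word, T w.bar = ⟨⟨w.src⟩, ⟨w.tgt⟩, AssocCompletion.wordCls w rfl rfl⟩ := by
    intro w
    rw [w.bar_eq w.isPath, AssocCompletion.wordCls_eq_evalList]
    dsimp only [T]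
    rw [map_evalList]
    have : ∀ (l : List G) (x y : M) (hl : 𝒢.IsPath l x y),
        evalList (o := fun x => (freeToCompletion hiso).obj (MooreSmith.obj (𝒢.vertex x)))
          (fun g _ _ hs ht => (freeToCompletion hiso).map (𝒢.freeArrow' g hs ht)) l x y hl =
        evalList (o := AssocCompletion.mk) AssocCompletion.cls l x y hl := by
      intro l x y hl
      congr 1
      funext g x y hs ht
      exact freeToCompletion_arrow hiso _ _ _
    rw [this]
    rfl
  have e : T w.bar = T w'.bar := by
    obtain ⟨a, b, w₁, w₂, h₁, h₂, η, rfl⟩ := h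
    rw [h₁, h₂]
    simp only [T, Functor.map_comp]
    rw [freeToCompletion_delta]
    simp
  rw [hT, hT] at e
  have key : ∀ {x y x' y' : M} {w w' : 𝒢.Word} (hs : w.src = x) (ht : w.tgt = y)
      (hs' : w'.src = x') (ht' : w'.tgt = y'),
      (⟨⟨x⟩, ⟨y⟩, AssocCompletion.wordCls w hs ht⟩ : Σ a b : AssocCompletion 𝒢, (a ⟶ b)) =
        ⟨⟨x'⟩, ⟨y'⟩, AssocCompletion.wordCls w' hs' ht'⟩ → w.Equiv w' := by
    intro x y x' y' w w' hs ht hs' ht' h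
    obtain ⟨h₁, h₂⟩ := Sigma.mk.inj h
    obtain rfl : x = x' := congrArg AssocCompletion.pt h₁
    obtain ⟨h₃, h₄⟩ := Sigma.mk.inj (eq_of_heq h₂)
    obtain rfl : y = y' := congrArg AssocCompletion.pt h₃
    exact (AssocCompletion.wordCls_eq_iff _ _ _ _).1 (eq_of_heq h₄)
  exact key _ _ _ _ e

end Groupoid

end LocalLieGroupoid

/-! ### Paths in the realization which are contained in a simplex -/

namespace Realization

open scoped Simplicial

variable {X : SSet.{u}}

instance (m : ℕ) : ContractibleSpace (stdSimplex ℝ (Fin (m + 1))) :=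
  (convex_stdSimplex ℝ _).contractibleSpace ⟨_, (stdSimplex.vertex 0).2⟩

/-- The homotopy class of paths from `e` to `e'` in `|X|` given by the paths from `p` to `q` in a
simplex `σ`, where `p` and `q` are points of `σ` representing `e` and `e'`. -/
noncomputable def simplexHom {m : ℕ} (σ : X _⦋m⦌) (p q : stdSimplex ℝ (Fin (m + 1)))
    {e e' : SSet.toTop.obj X} (h : realMap σ p = e) (h' : realMap σ q = e') :
    FundamentalGroupoid.mk e ⟶ FundamentalGroupoid.mk e' :=
  FundamentalGroupoid.fromPath (Path.Homotopic.Quotient.mk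
    (((PathConnectedSpace.somePath p q).map (realMap σ).continuous).cast h.symm h'.symm))

/-- As simplices are simply connected, `simplexHom` may be computed with any path `γ`. -/
lemma simplexHom_eq {m : ℕ} (σ : X _⦋m⦌) {p q : stdSimplex ℝ (Fin (m + 1))} (γ : Path p q)
    {e e' : SSet.toTop.obj X} (h : realMap σ p = e) (h' : realMap σ q = e') (δ : Path e e')
    (hδ : ∀ t, δ t = realMap σ (γ t)) :
    simplexHom σ p q h h' =
      FundamentalGroupoid.fromPath (Path.Homotopic.Quotient.mk δ) := by
  subst h h'
  obtain rfl : δ = γ.map (realMap σ).continuous := Path.ext (funext hδ)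
  refine Quotient.sound ?_
  exact (SimplyConnectedSpace.paths_homotopic _ γ).map (realMap σ)

lemma simplexHom_comp {m : ℕ} (σ : X _⦋m⦌) (p q r : stdSimplex ℝ (Fin (m + 1)))
    {e e' e'' : SSet.toTop.obj X} (h : realMap σ p = e) (h' : realMap σ q = e')
    (h'' : realMap σ r = e'') :
    simplexHom σ p q h h' ≫ simplexHom σ q r h' h'' = simplexHom σ p r h h'' := by
  subst h h' h''
  refine Eq.symm ((simplexHom_eq σ ((PathConnectedSpace.somePath p q).trans
    (PathConnectedSpace.somePath q r)) rfl rfl (Path.trans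
    ((PathConnectedSpace.somePath p q).map (realMap σ).continuous)
    ((PathConnectedSpace.somePath q r).map (realMap σ).continuous)) fun t => ?_).trans ?_)
  · rw [← Path.map_trans]; rfl
  · rfl

lemma simplexHom_self {m : ℕ} (σ : X _⦋m⦌) (p : stdSimplex ℝ (Fin (m + 1)))
    {e : SSet.toTop.obj X} (h : realMap σ p = e) : simplexHom σ p p h h = 𝟙 _ :=
  simplexHom_eq σ (Path.refl p) h h (Path.refl e) fun _ => h.symm

lemma simplexHom_map {m k : ℕ} (f : (⦋m⦌ : SimplexCategory) ⟶ ⦋k⦌) (σ : X _⦋k⦌)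
    (p q : stdSimplex ℝ (Fin (m + 1))) {e e' : SSet.toTop.obj X}
    (h : realMap (X.map f.op σ) p = e) (h' : realMap (X.map f.op σ) q = e') :
    simplexHom (X.map f.op σ) p q h h' = simplexHom σ (stdSimplex.map f p) (stdSimplex.map f q)
      ((realMap_map f σ p).symm.trans h) ((realMap_map f σ q).symm.trans h') := by
  refine (simplexHom_eq σ ((PathConnectedSpace.somePath p q).map
    (stdSimplex.continuous_map f)) _ _ _ fun t => ?_).symm
  exact realMap_map f σ _

end Realization

/-! ### The functor from the associative completion to the fundamental groupoid -/

namespace LocalLieGroupoid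

open Realization
open scoped Simplicial

variable {d n : ℕ} {M G : Type u}
    [TopologicalSpace M] [ChartedSpace (EuclideanSpace ℝ (Fin d)) M] [IsManifold (𝓡 d) ∞ M]
    [T2Space M]
    [TopologicalSpace G] [ChartedSpace (EuclideanSpace ℝ (Fin n)) G] [IsManifold (𝓡 n) ∞ G]
    {𝒢 : LocalLieGroupoid d n M G}

lemma realizationPoint_eq (x : M) :
    𝒢.realizationPoint x = realMap (𝒢.vertex x) (stdSimplex.vertex 0) := by
  have : stdSimplex.vertex (0 : Fin 1) = (default : stdSimplex ℝ (Fin 1)) :=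
    Subsingleton.elim _ _
  rw [this]
  rfl

lemma map_const_eq_vertex {m : ℕ} (σ : 𝒢.nerve _⦋m⦌) (i : Fin (m + 1)) :
    𝒢.nerve.map (SimplexCategory.const ⦋0⦌ ⦋m⦌ i).op σ = 𝒢.vertex (NerveSimplex.obj σ i) := by
  refine NerveSimplex.ext rfl ?_
  funext j k h
  exact NerveSimplex.arr_self σ i

lemma realMap_vertex {m : ℕ} (σ : 𝒢.nerve _⦋m⦌) (i : Fin (m + 1)) {x : M}
    (h : NerveSimplex.obj σ i = x) :
    realMap σ (stdSimplex.vertex i) = 𝒢.realizationPoint x := by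
  subst h
  rw [realizationPoint_eq, ← map_const_eq_vertex, realMap_map, stdSimplex.map_vertex]
  rfl

lemma map_mkOfLe_eq_edge {m : ℕ} (σ : 𝒢.nerve _⦋m⦌) (i j : Fin (m + 1)) (h : i ≤ j) :
    𝒢.nerve.map (SimplexCategory.mkOfLe i j h).op σ = 𝒢.edge (NerveSimplex.arr σ i j h) := by
  exact eq_edge _

variable (𝒢) in
/-- The class of the paths in the realization which run through the edge given by `g ∈ G`, from
the source to the target. -/
noncomputable def edgeHom (g : G) {x y : M} (hs : 𝒢.s g = x) (ht : 𝒢.t g = y) :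
    FundamentalGroupoid.mk (𝒢.realizationPoint x) ⟶
      FundamentalGroupoid.mk (𝒢.realizationPoint y) :=
  simplexHom (𝒢.edge g) (stdSimplex.vertex 1) (stdSimplex.vertex 0)
    (realMap_vertex _ 1 hs) (realMap_vertex _ 0 ht)

/-- The paths in a simplex between two of its vertices are homotopic to the edge between them, which
runs from the later to the earlier vertex. -/
lemma simplexHom_vertex {m : ℕ} (σ : 𝒢.nerve _⦋m⦌) (i j : Fin (m + 1)) (h : i ≤ j) {x y : M}
    (hx : NerveSimplex.obj σ j = x) (hy : NerveSimplex.obj σ i = y) :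
    simplexHom σ (stdSimplex.vertex j) (stdSimplex.vertex i) (realMap_vertex σ j hx)
      (realMap_vertex σ i hy) =
    𝒢.edgeHom (NerveSimplex.arr σ i j h) ((NerveSimplex.s_arr σ i j h).trans hx)
      ((NerveSimplex.t_arr σ i j h).trans hy) := by
  have key : ∀ (τ : 𝒢.nerve _⦋1⦌) (h₁ : 𝒢.nerve.map (SimplexCategory.mkOfLe i j h).op σ = τ)
      (h₂ : NerveSimplex.obj τ 1 = x) (h₃ : NerveSimplex.obj τ 0 = y),
      simplexHom σ (stdSimplex.vertex j) (stdSimplex.vertex i) (realMap_vertex σ j hx)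
      (realMap_vertex σ i hy) = simplexHom τ (stdSimplex.vertex 1) (stdSimplex.vertex 0)
        (realMap_vertex τ 1 h₂) (realMap_vertex τ 0 h₃) := by
    rintro _ rfl h₂ h₃
    rw [simplexHom_map]
    have e₁ := stdSimplex.map_vertex (S := ℝ) (SimplexCategory.mkOfLe i j h) 1
    have e₀ := stdSimplex.map_vertex (S := ℝ) (SimplexCategory.mkOfLe i j h) 0
    have key' : ∀ (p q : stdSimplex ℝ (Fin (m + 1)))
      (hp : stdSimplex.map (SimplexCategory.mkOfLe i j h) (stdSimplex.vertex 1) = p)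
      (hq : stdSimplex.map (SimplexCategory.mkOfLe i j h) (stdSimplex.vertex 0) = q)
      {e e' : SSet.toTop.obj 𝒢.nerve} (hp' : realMap σ p = e) (hq' : realMap σ q = e'),
      simplexHom σ p q hp' hq' = simplexHom σ _ _ (hp ▸ hp') (hq ▸ hq') := by
      rintro _ _ rfl rfl _ _ _ _; rfl
    exact key' _ _ e₁ e₀ _ _
  exact key _ (map_mkOfLe_eq_edge σ i j h) ((NerveSimplex.s_arr σ i j h).trans hx)
    ((NerveSimplex.t_arr σ i j h).trans hy)

/-- The two edges `h` and `g` of the triangle `(g, h)` compose to its edge `gh`. -/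
lemma multiplicative_edgeHom : 𝒢.Multiplicative 𝒢.edgeHom := by
  intro g h hd x y z h₁ h₂ h₃ h₄ h₅ h₆
  have e₁ := simplexHom_vertex (triangle hd) 1 2 (by decide) (y := y) h₁ h₃
  have e₂ := simplexHom_vertex (triangle hd) 0 1 (by decide) (y := z) h₃ h₄
  have e₃ := simplexHom_vertex (triangle hd) 0 2 (by decide) h₁ h₄
  rw [← simplexHom_comp (q := stdSimplex.vertex 1) (h' := realMap_vertex (triangle hd) 1 h₃),
    e₁, e₂] at e₃
  exact e₃

variable (𝒢) in
/-- The functor from the associative completion to the fundamental groupoid of the realization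
of the nerve. -/
noncomputable def toFundamentalGroupoid :
    AssocCompletion 𝒢 ⥤ FundamentalGroupoid (SSet.toTop.obj 𝒢.nerve) :=
  AssocCompletion.lift 𝒢.edgeHom 𝒢.multiplicative_edgeHom

lemma toFundamentalGroupoid_cls (g : G) {x y : M} (hs : 𝒢.s g = x) (ht : 𝒢.t g = y) :
    𝒢.toFundamentalGroupoid.map (AssocCompletion.cls g hs ht) = 𝒢.edgeHom g hs ht :=
  evalList_singleton (𝒢 := 𝒢) 𝒢.edgeHom g ⟨ht, hs.symm⟩

variable (𝒢) in
/-- The functor from the associative completion to the restriction of the fundamental groupoid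
to `M`. -/
noncomputable def toPiOne : AssocCompletion 𝒢 ⥤ 𝒢.PiOne where
  obj x := x.pt
  map f := InducedCategory.homMk (𝒢.toFundamentalGroupoid.map f)
  map_id x := InducedCategory.hom_ext (CategoryTheory.Functor.map_id 𝒢.toFundamentalGroupoid x)
  map_comp f g := InducedCategory.hom_ext (𝒢.toFundamentalGroupoid.map_comp f g)

/-- If `toFundamentalGroupoid` is bijective on arrows, then `toPiOne` is an isomorphism of
categories. -/
lemma exists_inverse_toPiOne
    (h : ∀ x y : AssocCompletion 𝒢, Function.Bijective
      (𝒢.toFundamentalGroupoid.map : (x ⟶ y) → _)) :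
    ∃ Ψ : 𝒢.PiOne ⥤ AssocCompletion 𝒢, 𝒢.toPiOne ⋙ Ψ = 𝟭 _ ∧ Ψ ⋙ 𝒢.toPiOne = 𝟭 _ := by
  choose ψ hψ hψ' using fun x y => Function.bijective_iff_has_inverse.1 (h x y)
  let Ψ : 𝒢.PiOne ⥤ AssocCompletion 𝒢 :=
    { obj := fun x => ⟨x⟩
      map := fun {x y} f => ψ ⟨x⟩ ⟨y⟩ f.hom
      map_id := fun x => (h _ _).1 ((hψ' ⟨x⟩ ⟨x⟩ _).trans
        (CategoryTheory.Functor.map_id 𝒢.toFundamentalGroupoid ⟨x⟩).symm)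
      map_comp := fun {x y z} f g => (h _ _).1 ((hψ' ⟨x⟩ ⟨z⟩ _).trans
        ((congrArg₂ (CategoryStruct.comp (obj := FundamentalGroupoid (SSet.toTop.obj 𝒢.nerve)))
          (hψ' ⟨x⟩ ⟨y⟩ f.hom) (hψ' ⟨y⟩ ⟨z⟩ g.hom)).symm.trans
          (𝒢.toFundamentalGroupoid.map_comp _ _).symm)) }
  exact ⟨Ψ, Functor.hext (fun _ => rfl) fun x y f => heq_of_eq (hψ x y f),
    Functor.hext (fun _ => rfl) fun x y f =>
      heq_of_eq (InducedCategory.hom_ext (hψ' ⟨x⟩ ⟨y⟩ f.hom))⟩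

end LocalLieGroupoid

namespace LocalLieGroupoid

open Realization StepFunction
open scoped Simplicial

variable {d n : ℕ} {M G : Type u}
    [TopologicalSpace M] [ChartedSpace (EuclideanSpace ℝ (Fin d)) M] [IsManifold (𝓡 d) ∞ M]
    [T2Space M]
    [TopologicalSpace G] [ChartedSpace (EuclideanSpace ℝ (Fin n)) G] [IsManifold (𝓡 n) ∞ G]
    {𝒢 : LocalLieGroupoid d n M G}

/-! ### Arrows of the associative completion are detected by monodromy -/

/-- The associative completion is generated by the classes of one-letter words. -/
lemma AssocCompletion.hom_induction {P : ∀ {x y : AssocCompletion 𝒢}, (x ⟶ y) → Prop}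
    (cls : ∀ (g : G) {x y : M} (hs : 𝒢.s g = x) (ht : 𝒢.t g = y), P (cls g hs ht))
    (comp : ∀ {x y z : AssocCompletion 𝒢} (f : x ⟶ y) (g : y ⟶ z), P f → P g → P (f ≫ g))
    {x y : AssocCompletion 𝒢} (f : x ⟶ y) : P f := by
  obtain ⟨w, hs, ht, rfl⟩ := exists_wordCls_eq f
  have key : ∀ (l : List G) (x y : M) (h : 𝒢.IsPath l x y),
      P (evalList (o := AssocCompletion.mk) AssocCompletion.cls l x y h) := by
    intro l x y h
    induction l generalizing y with
    | nil =>
      obtain rfl : x = y := h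
      exact cls (𝒢.unit x) (𝒢.s_unit x) (𝒢.t_unit x)
    | cons g l ih => exact comp _ _ (ih _ _) (cls g _ _)
  have := key w.letters x.pt y.pt (w.isPath_iff.2 ⟨hs, ht⟩)
  rwa [← wordCls_eq_evalList] at this

section Monodromy

variable {Γ : Type u} [Group Γ] (ρ : AssocCompletion 𝒢 ⥤ SingleObj Γ)

/-- The element of `Γ` assigned to `g ∈ G` by a functor to the group `Γ`. -/
def label (g : G) : Γ := ρ.map (AssocCompletion.cls g rfl rfl)

lemma map_cls_eq_label (g : G) {x y : M} (hs : 𝒢.s g = x) (ht : 𝒢.t g = y) :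
    ρ.map (AssocCompletion.cls g hs ht) = label ρ g := by
  subst hs ht; rfl

lemma label_mul {g h : G} (hd : (g, h) ∈ 𝒢.mulDom) :
    label ρ (𝒢.mul (g, h)) = label ρ g * label ρ h := by
  have := AssocCompletion.multiplicative_cls g h hd _ _ _ rfl rfl (composable_of_mem_mulDom hd) rfl
    (𝒢.s_mul _ hd) (𝒢.t_mul _ hd)
  have h2 := congrArg ρ.map this
  rw [Functor.map_comp] at h2
  rw [map_cls_eq_label, map_cls_eq_label, map_cls_eq_label] at h2
  exact h2.symm

lemma label_unit (x : M) : label ρ (𝒢.unit x) = 1 := by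
  have h := 𝒢.mem_mulDom_unit (𝒢.unit x)
  have h' := label_mul ρ h
  rwa [𝒢.mul_unit, 𝒢.s_unit, left_eq_mul] at h'

/-- The labels of the vertices of a simplex given by the partial products from the first vertex
on. -/
def labels {m : ℕ} (σ : 𝒢.nerve _⦋m⦌) (i : Fin (m + 1)) : Γ :=
  label ρ (NerveSimplex.arr σ 0 i (Fin.zero_le _))

/-- A simplicial operator changes the labels by a translation: it may change the first vertex, from
which the partial products are taken. -/
lemma labels_map {m k : ℕ} (f : (⦋m⦌ : SimplexCategory) ⟶ ⦋k⦌) (σ : 𝒢.nerve _⦋k⦌)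
    (i : Fin (m + 1)) : labels ρ σ (f i) = labels ρ σ (f 0) * labels ρ (𝒢.nerve.map f.op σ) i := by
  have hle : f 0 ≤ f i := f.toOrderHom.monotone (Fin.zero_le i)
  have h := NerveSimplex.mul_arr (𝒢 := 𝒢) σ 0 (f 0) (f i) (Fin.zero_le _) hle
  rw [labels, ← h,
    label_mul ρ (NerveSimplex.mem_mulDom (𝒢 := 𝒢) σ 0 (f 0) (f i) (Fin.zero_le _) hle)]
  rfl

/-- The step functions of the labelled simplices define a map from the realization of the nerve
to the space of orbits of step functions. -/
lemma exists_stepMap : ∃ J : C(SSet.toTop.obj 𝒢.nerve, FunctionSpace.Orbits Γ),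
    ∀ {m : ℕ} (σ : 𝒢.nerve _⦋m⦌) (p : stdSimplex ℝ (Fin (m + 1))),
      J (realMap σ p) = Quotient.mk _ (FunctionSpace.ofLabels (labels ρ σ) p) := by
  refine exists_continuousMap_realization (fun σ => ⟨fun p => Quotient.mk _
    (FunctionSpace.ofLabels (labels ρ σ) p),
    continuous_quotient_mk'.comp (FunctionSpace.continuous_ofLabels _)⟩) ?_
  intro m k f σ p
  refine Eq.symm (Quotient.sound ⟨labels ρ σ (f 0), ?_⟩)
  have h := FunctionSpace.ofLabels_map f.toOrderHom (labels ρ σ) p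
  refine (FunctionSpace.smul_ofLabels _ _ _).trans (Eq.trans ?_ h.symm)
  congr 1
  funext i
  exact (labels_map ρ f σ i).symm

open FunctionSpace in
/-- The functor `toFundamentalGroupoid` does not identify arrows which are distinguished by a
functor to a group. -/
lemma map_eq_of_toFundamentalGroupoid_map_eq {x y : AssocCompletion 𝒢} {f f' : x ⟶ y}
    (hf : 𝒢.toFundamentalGroupoid.map f = 𝒢.toFundamentalGroupoid.map f') :
    ρ.map f = ρ.map f' := by
  obtain ⟨J, hJ⟩ := exists_stepMap ρ
  let π : FunctionSpace Γ → Orbits Γ := Quotient.mk _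
  have cov : IsCoveringMap π := (isQuotientCoveringMap Γ).isCoveringMap
  -- a path within a simplex lifts to the path of the labelled step functions
  have hsimplex : ∀ {m : ℕ} (σ : 𝒢.nerve _⦋m⦌) (p q : stdSimplex ℝ (Fin (m + 1)))
      {e e' : SSet.toTop.obj 𝒢.nerve} (h : realMap σ p = e) (h' : realMap σ q = e') (γ : Γ)
      (a b : FunctionSpace Γ) (ha : π a = J e) (hb : π b = J e')
      (ha' : γ • ofLabels (labels ρ σ) p = a) (hb' : γ • ofLabels (labels ρ σ) q = b),
      cov.monodromy (Path.Homotopic.Quotient.map (simplexHom σ p q h h') J) ⟨a, ha⟩ =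
        ⟨b, hb⟩ := by
    rintro m σ p q _ _ rfl rfl γ _ _ ha hb rfl rfl
    refine cov.monodromy_eq_of_map_eq (Path.Homotopic.Quotient.mk
      ((PathConnectedSpace.somePath p q).map
        ((continuous_ofLabels (labels ρ σ)).const_smul γ))) ?_
    refine congrArg Path.Homotopic.Quotient.mk (Path.ext (funext fun t => ?_))
    refine Eq.trans ?_ (hJ σ _).symm
    exact Quotient.sound ⟨γ, rfl⟩
  have hconst : ∀ (x : M) (γ : Γ), π ⟨fun _ => γ⟩ = J (𝒢.realizationPoint x) := by
    intro x γ
    rw [realizationPoint_eq, hJ, ofLabels_vertex]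
    exact Quotient.sound ⟨γ * (labels ρ (𝒢.vertex x) 0)⁻¹, by
      change (⟨fun _ => _⟩ : FunctionSpace Γ) = _
      simp⟩
  -- the lift of the edge path of `f` from a constant function ends at its translate by `ρ(f)⁻¹`
  have key : ∀ {x y : AssocCompletion 𝒢} (f : x ⟶ y) (γ : Γ),
      cov.monodromy (Path.Homotopic.Quotient.map (𝒢.toFundamentalGroupoid.map f) J)
        ⟨⟨fun _ => γ⟩, hconst x.pt γ⟩ =
        ⟨⟨fun _ => γ * (show Γ from ρ.map f)⁻¹⟩, hconst y.pt _⟩ := by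
    intro x y f
    induction f using AssocCompletion.hom_induction with
    | cls g hs ht =>
      intro γ
      rw [map_cls_eq_label, toFundamentalGroupoid_cls]
      refine hsimplex (𝒢.edge g) _ _ _ _ (γ * (label ρ g)⁻¹) _ _ _ _ ?_ ?_
      · rw [ofLabels_vertex]
        change (⟨fun _ => γ * (label ρ g)⁻¹ * label ρ g⟩ : FunctionSpace Γ) = _
        simp
      · rw [ofLabels_vertex]
        change (⟨fun _ => γ * (label ρ g)⁻¹ * label ρ (𝒢.unit (𝒢.t g))⟩ : FunctionSpace Γ) = _
        rw [label_unit, mul_one]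
    | comp f g hf hg =>
      intro γ
      have h := cov.monodromy_trans_apply
        (Path.Homotopic.Quotient.map (𝒢.toFundamentalGroupoid.map f) J)
        (Path.Homotopic.Quotient.map (𝒢.toFundamentalGroupoid.map g) J)
        ⟨⟨fun _ => γ⟩, hconst _ γ⟩
      rw [hf, hg] at h
      rw [Functor.map_comp, Functor.map_comp]
      have h₂ := (FundamentalGroupoid.map J).map_comp (𝒢.toFundamentalGroupoid.map f)
        (𝒢.toFundamentalGroupoid.map g)
      refine (congrArg (fun c => cov.monodromy c ⟨⟨fun _ => γ⟩, hconst _ γ⟩) h₂).trans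
        (h.trans ?_)
      refine Subtype.ext ?_
      change (⟨fun _ => γ * (show Γ from ρ.map f)⁻¹ * (show Γ from ρ.map g)⁻¹⟩ : FunctionSpace Γ) =
        ⟨fun _ => γ * ((show Γ from ρ.map g) * (show Γ from ρ.map f))⁻¹⟩
      rw [mul_inv_rev, mul_assoc]
  have h₁ := key f 1
  rw [hf, key f' 1] at h₁
  have h₂ := congrArg (fun a : FunctionSpace Γ => a.toFun 0) (congrArg Subtype.val h₁)
  exact (inv_injective (mul_left_cancel h₂)).symm

end Monodromy

/-- If all arrows are invertible, then distinct parallel arrows with source `x` are distinguished by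
a functor to the isotropy group at `x`. -/
lemma toFundamentalGroupoid_injective (hiso : ∀ (x y : AssocCompletion 𝒢) (f : x ⟶ y), IsIso f)
    (x y : AssocCompletion 𝒢) :
    Function.Injective (𝒢.toFundamentalGroupoid.map : (x ⟶ y) → _) := by
  intro f f' hf
  classical
  let c : ∀ z : AssocCompletion 𝒢, Nonempty (x ≅ z) → (x ≅ z) := fun z h => h.some
  have hz : ∀ {z w : AssocCompletion 𝒢}, (z ⟶ w) → Nonempty (x ≅ z) → Nonempty (x ≅ w) :=
    fun {z w} g h => ⟨h.some ≪≫ @asIso _ _ _ _ g (hiso _ _ g)⟩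
  -- conjugation with the isomorphisms `c` retracts the component of `x` onto the isotropy group
  let r : ∀ {z w : AssocCompletion 𝒢}, (z ⟶ w) → Aut x := fun {z w} g =>
    if h : Nonempty (x ≅ z) then
      (c z h ≪≫ @asIso _ _ _ _ g (hiso _ _ g) ≪≫ (c w (hz g h)).symm : x ≅ x) else 1
  have r_pos : ∀ {z w : AssocCompletion 𝒢} (g : z ⟶ w) (h : Nonempty (x ≅ z))
      (h' : Nonempty (x ≅ w)), Iso.hom (r g) = (c z h).hom ≫ g ≫ (c w h').inv := by
    intro z w g h h'
    exact congrArg (Iso.hom : (x ≅ x) → (x ⟶ x)) (dif_pos h)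
  have r_neg : ∀ {z w : AssocCompletion 𝒢} (g : z ⟶ w) (_ : ¬ Nonempty (x ≅ z)), r g = 1 :=
    fun g h => dif_neg h
  let ρ : AssocCompletion 𝒢 ⥤ SingleObj (Aut x) :=
    { obj := fun _ => SingleObj.star _
      map := fun g => r g
      map_id := fun z => by
        change r (𝟙 z) = 1
        by_cases h : Nonempty (x ≅ z)
        · refine Aut.ext ((r_pos _ h h).trans ?_)
          rw [Category.id_comp, Iso.hom_inv_id]
          rfl
        · exact r_neg _ h
      map_comp := fun {z w v} g g' => by
        change r (g ≫ g') = r g' * r g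
        by_cases h : Nonempty (x ≅ z)
        · refine Aut.ext ?_
          have h₁ := hz g h
          have h₂ := hz g' h₁
          refine (r_pos _ h h₂).trans (Eq.trans ?_
            (congrArg₂ (CategoryStruct.comp (obj := AssocCompletion 𝒢)) (r_pos g h h₁)
              (r_pos g' h₁ h₂)).symm)
          simp
        · have h' : ¬ Nonempty (x ≅ w) := fun ⟨e⟩ => h ⟨e ≪≫ (@asIso _ _ _ _ g (hiso _ _ g)).symm⟩
          rw [r_neg _ h, r_neg _ h, r_neg _ h', mul_one] }
  have h := map_eq_of_toFundamentalGroupoid_map_eq ρ hf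
  have hx : Nonempty (x ≅ x) := ⟨Iso.refl x⟩
  have h' := (r_pos f hx (hz f hx)).symm.trans ((congrArg Iso.hom h).trans (r_pos f' hx (hz f hx)))
  simpa using h'

end LocalLieGroupoid

/-! ### Coordinates on the fibres of a submersion -/

open Filter Topology in
/-- A submersion `f` has local coordinates `β` on its fibre through a point `g`, with inverse `α`.
Their derivatives `β'` and `α'` are mutually inverse isomorphisms between the kernel of the
derivative of `f` at `g` and the complement `F`. -/
lemma Manifold.IsSubmersionAtOfComplement.exists_fiber_coordinates {d n : ℕ} {M G : Type*}
    {F : Type*} [NormedAddCommGroup F] [NormedSpace ℝ F]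
    [TopologicalSpace M] [ChartedSpace (EuclideanSpace ℝ (Fin d)) M]
    [TopologicalSpace G] [ChartedSpace (EuclideanSpace ℝ (Fin n)) G]
    {f : G → M} {g : G} (hf : IsSubmersionAtOfComplement F (𝓡 n) (𝓡 d) ∞ f g) :
    ∃ (α : F → G) (β : G → F) (α' : F →L[ℝ] TangentSpace (𝓡 n) g)
      (β' : TangentSpace (𝓡 n) g →L[ℝ] F),
      α (β g) = g ∧ ContMDiffAt 𝓘(ℝ, F) (𝓡 n) ∞ α (β g) ∧ ContMDiffAt (𝓡 n) 𝓘(ℝ, F) ∞ β g ∧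
      HasMFDerivAt 𝓘(ℝ, F) (𝓡 n) α (β g) α' ∧ HasMFDerivAt (𝓡 n) 𝓘(ℝ, F) β g β' ∧
      (∀ᶠ c in 𝓝 (β g), f (α c) = f g) ∧
      (∀ᶠ h in 𝓝 g, f h = f g → α (β h) = h) ∧
      (∀ a, mfderiv (𝓡 n) (𝓡 d) f g a = 0 → α' (β' a) = a) ∧
      (∀ c, mfderiv (𝓡 n) (𝓡 d) f g (α' c) = 0) ∧ (∀ c, β' (α' c) = c) := by
  -- `Θ` are the coordinates near `g` in which `f` is the first projection, and `A` is its inverse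
  let φ := hf.domChart.extend (𝓡 n)
  let ψ := hf.codChart.extend (𝓡 d)
  let Θ : G → EuclideanSpace ℝ (Fin d) × F := fun h => hf.equiv (φ h)
  let A : EuclideanSpace ℝ (Fin d) × F → G := fun q => φ.symm (hf.equiv.symm q)
  have hgs : g ∈ φ.source := by
    rw [OpenPartialHomeomorph.extend_source]; exact hf.mem_domChart_source
  have hsrc : ∀ᶠ h in 𝓝 g, h ∈ φ.source := by
    rw [OpenPartialHomeomorph.extend_source]
    exact hf.domChart.open_source.mem_nhds hf.mem_domChart_source
  have htgt : IsOpen φ.target := by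
    exact OpenPartialHomeomorph.isOpen_extend_target hf.domChart
  have hleft : ∀ᶠ h in 𝓝 g, A (Θ h) = h := hsrc.mono fun h hh => by
    simp only [A, Θ, ContinuousLinearEquiv.symm_apply_apply]
    exact φ.left_inv hh
  have hΘg : hf.equiv.symm (Θ g) = φ g := ContinuousLinearEquiv.symm_apply_apply _ _
  have hA0 : A (Θ g) = g := hleft.self_of_nhds
  have htg : ∀ᶠ q in 𝓝 (Θ g), hf.equiv.symm q ∈ φ.target := by
    refine hf.equiv.symm.continuous.continuousAt.eventually (htgt.mem_nhds ?_)
    rw [hΘg]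
    exact φ.map_source hgs
  have hright : ∀ᶠ q in 𝓝 (Θ g), Θ (A q) = q := htg.mono fun q hq => by
    simp only [A, Θ]
    rw [φ.right_inv hq, ContinuousLinearEquiv.apply_symm_apply]
  have hΘ : ContMDiffAt (𝓡 n) 𝓘(ℝ, EuclideanSpace ℝ (Fin d) × F) ∞ Θ g := by
    have h₁ : ContMDiffAt (𝓡 n) 𝓘(ℝ, EuclideanSpace ℝ (Fin n)) ∞ φ g :=
      OpenPartialHomeomorph.contMDiffAt_extend hf.domChart_mem_maximalAtlas hf.mem_domChart_source
    exact (hf.equiv.contDiff.contMDiff.contMDiffAt).comp g h₁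
  have hA : ContMDiffAt 𝓘(ℝ, EuclideanSpace ℝ (Fin d) × F) (𝓡 n) ∞ A (Θ g) := by
    have h₁ : ContMDiffAt 𝓘(ℝ, EuclideanSpace ℝ (Fin n)) (𝓡 n) ∞ φ.symm
        (hf.equiv.symm (Θ g)) := by
      refine (contMDiffOn_extend_symm hf.domChart_mem_maximalAtlas).contMDiffAt ?_
      rw [← OpenPartialHomeomorph.extend_target']
      exact htgt.mem_nhds htg.self_of_nhds
    exact h₁.comp (Θ g) hf.equiv.symm.contDiff.contMDiff.contMDiffAt
  -- the first coordinate is the value of `f` in the chart `ψ`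
  have hu : ∀ h ∈ φ.source, ψ (f h) = (Θ h).1 := by
    intro h hh
    have := hf.writtenInCharts (φ.map_source hh)
    simp only [Function.comp_apply] at this
    rwa [φ.left_inv hh] at this
  have hψ : ∀ h ∈ φ.source, f h ∈ ψ.source := by
    intro h hh
    rw [OpenPartialHomeomorph.extend_source] at hh ⊢
    exact hf.source_subset_preimage_source hh
  -- the coordinates of the fibre through `g`
  let ι : F → EuclideanSpace ℝ (Fin d) × F := fun c => ((Θ g).1, c)
  have hι0 : ι (Θ g).2 = Θ g := rfl
  have hι : ContMDiff 𝓘(ℝ, F) 𝓘(ℝ, EuclideanSpace ℝ (Fin d) × F) ∞ ι :=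
    (contDiff_const.prodMk contDiff_id).contMDiff
  have hιc : Tendsto ι (𝓝 (Θ g).2) (𝓝 (Θ g)) := hι.continuous.continuousAt
  have hι' : HasMFDerivAt 𝓘(ℝ, F) 𝓘(ℝ, EuclideanSpace ℝ (Fin d) × F) ι (Θ g).2
      (ContinuousLinearMap.inr ℝ (EuclideanSpace ℝ (Fin d)) F) :=
    ((hasFDerivAt_const _ _).prodMk (hasFDerivAt_id _)).hasMFDerivAt
  have hα : ContMDiffAt 𝓘(ℝ, F) (𝓡 n) ∞ (A ∘ ι) (Θ g).2 :=
    ContMDiffAt.comp (Θ g).2 (g := A) hA hι.contMDiffAt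
  have hsnd : ContMDiff 𝓘(ℝ, EuclideanSpace ℝ (Fin d) × F) 𝓘(ℝ, F) ∞
      (Prod.snd : EuclideanSpace ℝ (Fin d) × F → F) := contDiff_snd.contMDiff
  have hβ : ContMDiffAt (𝓡 n) 𝓘(ℝ, F) ∞ (Prod.snd ∘ Θ) g := hsnd.contMDiffAt.comp g hΘ
  have hΘd := (hΘ.mdifferentiableAt (by simp)).hasMFDerivAt
  have hAd := (hA.mdifferentiableAt (by simp)).hasMFDerivAt
  generalize mfderiv (𝓡 n) 𝓘(ℝ, EuclideanSpace ℝ (Fin d) × F) Θ g = Θ' at hΘd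
  generalize mfderiv 𝓘(ℝ, EuclideanSpace ℝ (Fin d) × F) (𝓡 n) A (Θ g) = A' at hAd
  have hfα : ∀ᶠ c in 𝓝 (Θ g).2, f ((A ∘ ι) c) = f g := by
    filter_upwards [hιc.eventually htg, hιc.eventually hright] with c h₁ h₂
    have h₃ : A (ι c) ∈ φ.source := φ.map_target h₁
    refine ψ.injOn (hψ _ h₃) (hψ _ hgs) ?_
    rw [hu _ h₃, hu _ hgs, h₂]
  refine ⟨A ∘ ι, Prod.snd ∘ Θ, A'.comp (ContinuousLinearMap.inr ℝ _ F),
    (ContinuousLinearMap.snd ℝ _ F).comp Θ', hA0, hα, hβ,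
    HasMFDerivAt.comp (Θ g).2 (g := A) hAd hι',
    (ContinuousLinearMap.snd ℝ (EuclideanSpace ℝ (Fin d)) F).hasMFDerivAt.comp _ hΘd, hfα,
    ?_, ?_, ?_, ?_⟩
  · filter_upwards [hsrc, hleft] with h hh hh' hfh
    have : ι (Θ h).2 = Θ h := by
      refine Prod.ext ?_ rfl
      change (Θ g).1 = (Θ h).1
      rw [← hu _ hgs, ← hu _ hh, hfh]
    change A (ι (Θ h).2) = h
    rw [this, hh']
  · intro a ha
    have h₁ : HasMFDerivAt (𝓡 n) (𝓡 n) (A ∘ Θ) g (A'.comp Θ') := hAd.comp g hΘd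
    have h₂ := hasMFDerivAt_unique h₁ ((hasMFDerivAt_id g).congr_of_eventuallyEq hleft)
    have h₃ : (Θ' a : EuclideanSpace ℝ (Fin d) × F).1 = 0 := by
      have hψd : MDifferentiableAt (𝓡 d) 𝓘(ℝ, EuclideanSpace ℝ (Fin d)) ψ (f g) :=
        (OpenPartialHomeomorph.contMDiffAt_extend hf.codChart_mem_maximalAtlas
          hf.mem_codChart_source).mdifferentiableAt (by simp)
      have h₄ := hψd.hasMFDerivAt.comp g (hf.contMDiffAt.mdifferentiableAt (by simp)).hasMFDerivAt
      have h₅ := (ContinuousLinearMap.fst ℝ (EuclideanSpace ℝ (Fin d)) F).hasMFDerivAt.comp g hΘd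
      have h₆ := hasMFDerivAt_unique (h₄.congr_of_eventuallyEq
        (hsrc.mono fun h hh => (hu h hh).symm)) h₅
      have h₇ := congrArg (fun T => T a) h₆
      refine h₇.symm.trans ?_
      change mfderiv (𝓡 d) 𝓘(ℝ, EuclideanSpace ℝ (Fin d)) ψ (f g) (mfderiv (𝓡 n) (𝓡 d) f g a) = 0
      rw [ha, map_zero]
    have h₈ : ((0 : EuclideanSpace ℝ (Fin d)), (Θ' a : EuclideanSpace ℝ (Fin d) × F).2) = Θ' a :=
      Prod.ext h₃.symm rfl
    change A' ((0 : EuclideanSpace ℝ (Fin d)), (Θ' a : EuclideanSpace ℝ (Fin d) × F).2) = a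
    rw [h₈]
    exact congrArg (fun T => T a) h₂
  · intro c
    have h₁ : HasMFDerivAt 𝓘(ℝ, F) (𝓡 n) (A ∘ ι) (Θ g).2
      (A'.comp (ContinuousLinearMap.inr ℝ _ F)) := HasMFDerivAt.comp (Θ g).2 (g := A) hAd hι'
    have hfd : HasMFDerivAt (𝓡 n) (𝓡 d) f ((A ∘ ι) (Θ g).2) (mfderiv (𝓡 n) (𝓡 d) f g) := by
      have key : ∀ h, h = g →
          HasMFDerivAt (𝓡 n) (𝓡 d) f h (mfderiv (𝓡 n) (𝓡 d) f g) := by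
        rintro _ rfl
        exact (hf.contMDiffAt.mdifferentiableAt (by simp)).hasMFDerivAt
      exact key _ hA0
    have h₂ := hasMFDerivAt_unique (hfd.comp _ h₁)
      ((hasMFDerivAt_const (f g) _).congr_of_eventuallyEq hfα)
    exact congrArg (fun T => T c) h₂
  · intro c
    have key : ∀ h, h = g →
        HasMFDerivAt (𝓡 n) 𝓘(ℝ, EuclideanSpace ℝ (Fin d) × F) Θ h Θ' := by
      rintro _ rfl
      exact hΘd
    have h₁ := hasMFDerivAt_unique (HasMFDerivAt.comp (Θ g) (key _ hA0) hAd)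
      ((hasMFDerivAt_id (Θ g)).congr_of_eventuallyEq hright)
    have h₂ := congrArg (fun T => T ((0 : EuclideanSpace ℝ (Fin d)), c)) h₁
    exact congrArg Prod.snd h₂

/-! ### Invertibility of the arrows of the associative completion -/

namespace LocalLieGroupoid

open Filter Topology

variable {d n : ℕ} {M G : Type u}
    [TopologicalSpace M] [ChartedSpace (EuclideanSpace ℝ (Fin d)) M] [IsManifold (𝓡 d) ∞ M]
    [T2Space M]
    [TopologicalSpace G] [ChartedSpace (EuclideanSpace ℝ (Fin n)) G] [IsManifold (𝓡 n) ∞ G]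
    {𝒢 : LocalLieGroupoid d n M G}

/-- By regularity and the inverse function theorem, the products `k h` with `k` near the unit at
`t h` fill a neighbourhood of `h` in its source fibre. -/
lemma eventually_exists_mul_eq {h₀ : G} (hreg : 𝒢.RightRegularAt h₀) {N : Set G}
    (hN : N ∈ 𝓝 (𝒢.unit (𝒢.t h₀))) :
    ∀ᶠ h in 𝓝 h₀, 𝒢.s h = 𝒢.s h₀ → ∃ k ∈ N, (k, h₀) ∈ 𝒢.mulDom ∧ 𝒢.mul (k, h₀) = h := by
  obtain ⟨C, _, _, hs⟩ := 𝒢.s_submersion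
  set e := 𝒢.unit (𝒢.t h₀) with he
  have hmul : 𝒢.mul (e, h₀) = h₀ := 𝒢.unit_mul h₀
  have hed : (e, h₀) ∈ 𝒢.mulDom := 𝒢.unit_mem_mulDom h₀
  obtain ⟨α, β, α', β', hαβ, hα, hβ, hα', hβ', hsα, hβα, hker, -, -⟩ :=
    (hs e).exists_fiber_coordinates
  obtain ⟨a, b, a', b', hab, ha, hb, ha', hb', hsa, hba, -, hker', hba'⟩ :=
    (hs h₀).exists_fiber_coordinates
  have : FiniteDimensional ℝ C := by
    refine FiniteDimensional.of_injective
      ((hs e).equiv.symm.toLinearEquiv.toLinearMap ∘ₗ LinearMap.inr ℝ _ C) ?_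
    exact (hs e).equiv.symm.injective.comp LinearMap.inr_injective
  have : CompleteSpace C := FiniteDimensional.complete ℝ C
  let D : Set G := {k | (k, h₀) ∈ 𝒢.mulDom}
  let R : G → G := fun k => 𝒢.mul (k, h₀)
  have hαc : Tendsto α (𝓝 (β e)) (𝓝 e) := by
    have := hα.continuousAt
    rwa [ContinuousAt, hαβ] at this
  have hD : ∀ᶠ c in 𝓝 (β e), α c ∈ D := by
    obtain ⟨O, hO, hO'⟩ := 𝒢.mulDom_open
    have hO₁ : ∀ᶠ k in 𝓝 e, (k, h₀) ∈ O := by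
      have : Continuous fun k : G => (k, h₀) := by fun_prop
      refine (hO.preimage this).mem_nhds ?_
      have := hed
      rw [hO'] at this
      exact this.1
    filter_upwards [hαc.eventually hO₁, hsα] with c h₁ h₂
    change (α c, h₀) ∈ 𝒢.mulDom
    rw [hO']
    refine ⟨h₁, ?_⟩
    change 𝒢.s (α c) = 𝒢.t h₀
    rw [h₂, he, 𝒢.s_unit]
  have hRd : ContMDiffWithinAt (𝓡 n) (𝓡 n) ∞ R D e :=
    (𝒢.mul_smooth _ hed).comp e
      (contMDiff_id.prodMk contMDiff_const).contMDiffAt.contMDiffWithinAt fun k hk => hk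
  have hRα : ContMDiffAt 𝓘(ℝ, C) (𝓡 n) ∞ (R ∘ α) (β e) := by
    have h₁ : ContMDiffWithinAt (𝓡 n) (𝓡 n) ∞ R D (α (β e)) := by rwa [hαβ]
    exact (h₁.comp (β e) hα.contMDiffWithinAt (fun c hc => hc)).contMDiffAt hD
  have hRα0 : (R ∘ α) (β e) = h₀ := by
    change R (α (β e)) = h₀
    rw [hαβ, ← hmul]
  have hRαc : Tendsto (R ∘ α) (𝓝 (β e)) (𝓝 h₀) := by
    have := hRα.continuousAt
    rwa [ContinuousAt, hRα0] at this
  -- right multiplication by `h₀` in coordinates of the source fibres through `e` and `h₀`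
  have hf : ContMDiffAt 𝓘(ℝ, C) 𝓘(ℝ, C) ∞ (b ∘ R ∘ α) (β e) := by
    have h₁ : ContMDiffAt (𝓡 n) 𝓘(ℝ, C) ∞ b ((R ∘ α) (β e)) := by rwa [hRα0]
    exact h₁.comp (β e) hRα
  have hf0 : (b ∘ R ∘ α) (β e) = b h₀ := congrArg b hRα0
  have hstrict := (contMDiffAt_iff_contDiffAt.1 hf).hasStrictFDerivAt (by simp)
  let T : EuclideanSpace ℝ (Fin n) →L[ℝ] EuclideanSpace ℝ (Fin n) :=
    mfderivWithin (𝓡 n) (𝓡 n) R D e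
  have hT : HasMFDerivWithinAt (𝓡 n) (𝓡 n) R D e T :=
    (hRd.mdifferentiableWithinAt (by simp)).hasMFDerivWithinAt
  have hderiv : fderiv ℝ (b ∘ R ∘ α) (β e) = (b'.comp T).comp α' := by
    have h₁ : HasMFDerivWithinAt (𝓡 n) (𝓡 n) R D (α (β e)) T := by
      have key : ∀ k, k = e → HasMFDerivWithinAt (𝓡 n) (𝓡 n) R D k T := by
        rintro _ rfl; exact hT
      exact key _ hαβ
    have h₂ : HasMFDerivAt 𝓘(ℝ, C) (𝓡 n) (R ∘ α) (β e) (T.comp α') :=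
      (HasMFDerivWithinAt.comp (β e) h₁ hα'.hasMFDerivWithinAt
        (Subset.refl (α ⁻¹' D))).hasMFDerivAt hD
    have h₃ : HasMFDerivAt (𝓡 n) 𝓘(ℝ, C) b ((R ∘ α) (β e)) b' := by
      have key : ∀ k, k = h₀ → HasMFDerivAt (𝓡 n) 𝓘(ℝ, C) b k b' := by
        rintro _ rfl; exact hb'
      exact key _ hRα0
    have h₄ : HasMFDerivAt 𝓘(ℝ, C) 𝓘(ℝ, C) (b ∘ R ∘ α) (β e) (b'.comp (T.comp α')) :=
      HasMFDerivAt.comp (g := b) (f := R ∘ α) (β e) h₃ h₂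
    have h₅ : HasFDerivAt (b ∘ R ∘ α) ((b'.comp T).comp α' : C →L[ℝ] C) (β e) :=
      hasMFDerivAt_iff_hasFDerivAt.1 h₄
    exact h₅.fderiv
  have hsurj : (fderiv ℝ (b ∘ R ∘ α) (β e) : C →ₗ[ℝ] C).range = ⊤ := by
    rw [LinearMap.range_eq_top]
    intro w
    have hv : a' w ∈ 𝒢.tangentS (𝒢.mul (e, h₀)) := by
      have key : ∀ k, k = h₀ → (a' w : EuclideanSpace ℝ (Fin n)) ∈ 𝒢.tangentS k := by
        rintro _ rfl; exact hker' w
      exact key _ hmul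
    obtain ⟨v, hv₁, hv₂⟩ := (hreg e hed).surjOn hv
    refine ⟨β' v, ?_⟩
    rw [hderiv]
    change b' (T (α' (β' v))) = w
    rw [hker v hv₁]
    exact (congrArg b' hv₂).trans (hba' w)
  -- a map with surjective strict derivative maps neighbourhoods onto neighbourhoods
  have hmap := hstrict.map_nhds_eq_of_surj hsurj
  rw [hf0] at hmap
  have hgood : ∀ᶠ c in 𝓝 (β e), α c ∈ N ∧ α c ∈ D ∧ a (b (R (α c))) = R (α c) := by
    filter_upwards [hαc.eventually hN, hD, hRαc.eventually hba] with c h₁ h₂ h₃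
    refine ⟨h₁, h₂, h₃ (𝒢.s_mul _ h₂)⟩
  have hev := image_mem_map (m := b ∘ R ∘ α) hgood
  rw [hmap] at hev
  filter_upwards [hb.continuousAt.eventually hev, hba] with h h₁ h₂ h₃
  obtain ⟨c, ⟨hc₁, hc₂, hc₃⟩, hc₄⟩ := h₁
  refine ⟨α c, hc₁, hc₂, ?_⟩
  rw [← h₂ h₃, ← hc₄]
  exact hc₃.symm

lemma isIso_cls_of_mem_invDom {k : G} (hk : k ∈ 𝒢.invDom) {x y : M} (hs : 𝒢.s k = x)
    (ht : 𝒢.t k = y) : IsIso (AssocCompletion.cls k hs ht) := by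
  subst hs ht
  have hk' := 𝒢.inv_mapsTo hk
  have h₁ := 𝒢.s_inv k hk
  have h₂ := 𝒢.t_inv k hk
  have key : ∀ {g h k : G}, (g, h) ∈ 𝒢.mulDom → 𝒢.mul (g, h) = k → ∀ {x y z : M}
      (h₁ : 𝒢.s h = x) (h₂ : 𝒢.t h = y) (h₃ : 𝒢.s g = y) (h₄ : 𝒢.t g = z) (h₅ : 𝒢.s k = x)
      (h₆ : 𝒢.t k = z), AssocCompletion.cls h h₁ h₂ ≫ AssocCompletion.cls g h₃ h₄ =
        AssocCompletion.cls k h₅ h₆ := by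
    rintro g h _ hd rfl x y z h₁ h₂ h₃ h₄ h₅ h₆
    exact AssocCompletion.multiplicative_cls g h hd x y z h₁ h₂ h₃ h₄ h₅ h₆
  exact ⟨AssocCompletion.cls (𝒢.inv k) h₁ h₂,
    key (𝒢.invDom_mulDom _ hk' _ hk h₁) (𝒢.inv_mul k hk) rfl rfl h₁ h₂ (𝒢.s_unit _) (𝒢.t_unit _),
    key (𝒢.invDom_mulDom _ hk _ hk' h₂.symm) (𝒢.mul_inv k hk) h₁ h₂ rfl rfl (𝒢.s_unit _)
      (𝒢.t_unit _)⟩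

/-- If the source fibres are connected and right multiplication is regular, then all arrows of the
associative completion are invertible: invertibility of the class of `h` is a locally constant
condition on the source fibre, since nearby elements are products `k h` with `k` near a unit. -/
lemma isIso_of_sourceConnected (hreg : ∀ g, 𝒢.RightRegularAt g)
    (hconn : ∀ x, IsConnected (𝒢.s ⁻¹' {x})) {x y : AssocCompletion 𝒢} (f : x ⟶ y) : IsIso f := by
  induction f using AssocCompletion.hom_induction with
  | comp f g hf hg => exact IsIso.comp_isIso
  | cls g hs ht =>
    subst hs ht
    let I : Set G := {h | IsIso (AssocCompletion.cls (𝒢 := 𝒢) h rfl rfl)}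
    have hloc : ∀ h₀ : G, ∀ᶠ h in 𝓝 h₀, 𝒢.s h = 𝒢.s h₀ → (h ∈ I ↔ h₀ ∈ I) := by
      intro h₀
      have hN : 𝒢.invDom ∈ 𝓝 (𝒢.unit (𝒢.t h₀)) := 𝒢.invDom_open.mem_nhds (𝒢.unit_mem_invDom _)
      filter_upwards [eventually_exists_mul_eq (hreg h₀) hN] with h hh hs
      obtain ⟨k, hk, hd, rfl⟩ := hh hs
      have hc := composable_of_mem_mulDom hd
      have h₁ := AssocCompletion.multiplicative_cls k h₀ hd _ _ _ rfl hc.symm rfl rfl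
        hs (𝒢.t_mul _ hd)
      have h₂ := isIso_cls_of_mem_invDom hk rfl rfl
      have key : ∀ (h : G) {x y : M} (hs : 𝒢.s h = x) (ht : 𝒢.t h = y),
          h ∈ I ↔ IsIso (AssocCompletion.cls h hs ht) := by
        rintro h _ _ rfl rfl; rfl
      rw [key _ hs (𝒢.t_mul _ hd), ← h₁, key h₀ rfl hc.symm]
      exact isIso_comp_right_iff _ _
    have hpre : IsPreconnected (𝒢.s ⁻¹' {𝒢.s g}) := (hconn _).isPreconnected
    have : ∀ h ∈ 𝒢.s ⁻¹' {𝒢.s g}, h ∈ I ↔ 𝒢.unit (𝒢.s g) ∈ I := by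
      intro h hh
      refine hpre.induction₂ (fun h k => h ∈ I ↔ k ∈ I) (fun h₀ hh₀ => ?_)
        (fun _ _ _ _ _ _ h₁ h₂ => h₁.trans h₂) (fun _ _ _ _ h₁ => h₁.symm) hh (𝒢.s_unit _)
      filter_upwards [mem_nhdsWithin_of_mem_nhds (hloc h₀), self_mem_nhdsWithin] with h h₁ h₂
      exact (h₁ (h₂.trans hh₀.symm)).symm
    refine (this g rfl).2 ?_
    exact isIso_cls_of_mem_invDom (𝒢.unit_mem_invDom _) rfl rfl

end LocalLieGroupoid

/-! ### The mass of sets of vertices in an interval -/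

namespace StepFunction

open MeasureTheory

variable {m k : ℕ}

/-- The measure of the set of all `u` in the interval `(a, b]` at which the value of the step
function of `p` satisfies `P`. -/
noncomputable def mass (a b : ℝ) (p : stdSimplex ℝ (Fin (m + 1))) (P : Fin (m + 1) → Prop) : ℝ :=
  volume.real {u ∈ Ioc a b | P (stepFn p u)}

variable {a b : ℝ}

lemma volume_ne_top_of_subset_Ioc (P : ℝ → Prop) : volume {u ∈ Ioc a b | P u} ≠ ⊤ :=
  measure_ne_top_of_subset (sep_subset _ _) (by simp)

lemma mass_nonneg (p : stdSimplex ℝ (Fin (m + 1))) (P : Fin (m + 1) → Prop) : 0 ≤ mass a b p P :=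
  measureReal_nonneg

lemma mass_mono (p : stdSimplex ℝ (Fin (m + 1))) {P Q : Fin (m + 1) → Prop} (h : ∀ i, P i → Q i) :
    mass a b p P ≤ mass a b p Q :=
  measureReal_mono (fun _ hu => ⟨hu.1, h _ hu.2⟩) (volume_ne_top_of_subset_Ioc _)

lemma mass_true (hab : a ≤ b) (p : stdSimplex ℝ (Fin (m + 1))) :
    mass a b p (fun _ => True) = b - a := by
  have : {u ∈ Ioc a b | True} = Ioc a b := by simp only [and_true]; rfl
  rw [mass, this]
  simp [hab]

lemma exists_of_mass_pos {p : stdSimplex ℝ (Fin (m + 1))} {P : Fin (m + 1) → Prop}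
    (h : 0 < mass a b p P) : ∃ i, P i := by
  by_contra! hP
  simp [mass, hP] at h

section

variable (ha : 0 ≤ a) (hb : b ≤ 1)
include ha hb

lemma mass_map (θ : Fin (m + 1) →o Fin (k + 1)) (p : stdSimplex ℝ (Fin (m + 1)))
    (P : Fin (k + 1) → Prop) :
    mass a b (stdSimplex.map θ p) P = mass a b p (P ∘ θ) := by
  have : {u ∈ Ioc a b | P (stepFn (stdSimplex.map θ p) u)} =
      {u ∈ Ioc a b | (P ∘ θ) (stepFn p u)} := by
    ext u
    refine and_congr_right fun hu => ?_
    rw [stepFn_map θ p ⟨ha.trans_lt hu.1, hu.2.trans hb⟩, Function.comp_apply]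
  rw [mass, mass, this]

lemma continuous_mass (P : Fin (m + 1) → Prop) :
    Continuous fun p : stdSimplex ℝ (Fin (m + 1)) => mass a b p P := by
  rw [continuous_iff_continuousAt]
  intro p
  rw [ContinuousAt, tendsto_iff_dist_tendsto_zero]
  refine squeeze_zero (fun _ => dist_nonneg) (fun q => ?_) (tendsto_gap p)
  have key : ∀ p q : stdSimplex ℝ (Fin (m + 1)),
      volume {u ∈ Ioc (0 : ℝ) 1 | stepFn p u ≠ stepFn q u} ≤ ENNReal.ofReal (gap p q) →
      mass a b p P ≤ mass a b q P + gap p q := by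
    intro p q h
    have h₁ : {u ∈ Ioc a b | P (stepFn p u)} ⊆ {u ∈ Ioc a b | P (stepFn q u)} ∪
        {u ∈ Ioc (0 : ℝ) 1 | stepFn p u ≠ stepFn q u} := by
      rintro u ⟨hu, hP⟩
      by_cases hpq : stepFn p u = stepFn q u
      · exact Or.inl ⟨hu, hpq ▸ hP⟩
      · exact Or.inr ⟨⟨ha.trans_lt hu.1, hu.2.trans hb⟩, hpq⟩
    refine (measureReal_mono h₁ ?_).trans ((measureReal_union_le _ _).trans ?_)
    · exact measure_union_ne_top (volume_ne_top_of_subset_Ioc _) (volume_ne_top_of_subset_Ioc _)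
    · refine add_le_add_right ?_ _
      exact ENNReal.toReal_le_of_le_ofReal (gap_nonneg p q) h
  have h₁ := key p q (volume_stepFn_ne_le p q)
  have h₂ := key q p (volume_stepFn_ne_le q p)
  have h₃ : gap q p = gap p q := Finset.sum_congr rfl fun j _ => abs_sub_comm _ _
  rw [h₃] at h₂
  rw [Real.dist_eq, abs_le]
  constructor <;> linarith

omit ha in
lemma measurableSet_stepFn_eq (p : stdSimplex ℝ (Fin (m + 1))) (i : Fin (m + 1)) :
    MeasurableSet {u ∈ Ioc a b | stepFn p u = i} := by
  have h : ∀ j, MeasurableSet {u ∈ Ioc a b | stepFn p u ≤ j} := by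
    intro j
    have : {u ∈ Ioc a b | stepFn p u ≤ j} = Ioc a b ∩ Iic (partialSum p j) := by
      ext u
      exact and_congr_right fun hu => stepFn_le_iff p (hu.2.trans hb) j
    rw [this]
    exact measurableSet_Ioc.inter measurableSet_Iic
  have : {u ∈ Ioc a b | stepFn p u = i} =
      {u ∈ Ioc a b | stepFn p u ≤ i} \ ⋃ j ∈ Iio i, {u ∈ Ioc a b | stepFn p u ≤ j} := by
    ext u
    simp only [mem_ofPred_eq, mem_sdiff, mem_iUnion, mem_Iio, not_exists, not_and]
    constructor
    · rintro ⟨hu, rfl⟩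
      exact ⟨⟨hu, le_rfl⟩, fun j hj _ => not_le.2 hj⟩
    · rintro ⟨⟨hu, hle⟩, h⟩
      refine ⟨hu, hle.eq_of_not_lt fun hlt => h _ hlt hu le_rfl⟩
  rw [this]
  exact (h i).diff (MeasurableSet.biUnion (to_countable _) fun j _ => h j)

omit ha in
lemma mass_eq_sum (p : stdSimplex ℝ (Fin (m + 1))) (P : Fin (m + 1) → Prop) [DecidablePred P] :
    mass a b p P = ∑ i with P i, mass a b p (· = i) := by
  have : {u ∈ Ioc a b | P (stepFn p u)} =
      ⋃ i ∈ Finset.univ.filter P, {u ∈ Ioc a b | stepFn p u = i} := by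
    ext u
    simp
  rw [mass, this, measureReal_biUnion_finset (h := fun i _ => volume_ne_top_of_subset_Ioc _)]
  · rfl
  · intro i _ j _ hij
    refine Set.disjoint_left.2 ?_
    rintro u ⟨_, rfl⟩ ⟨_, h⟩
    exact hij h
  · exact fun i _ => measurableSet_stepFn_eq hb p i

end

lemma partialSum_add_le (p : stdSimplex ℝ (Fin (m + 1))) {i j : Fin (m + 1)} (h : j < i) :
    partialSum p j + p i ≤ partialSum p i := by
  have hi : i ∉ Finset.Iic j := by simpa using h
  rw [partialSum, add_comm, ← Finset.sum_insert hi]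
  refine Finset.sum_le_sum_of_subset_of_nonneg (fun l hl => ?_)
    fun _ _ _ => stdSimplex.zero_le p _
  rcases Finset.mem_insert.1 hl with rfl | hl
  · simp
  · exact Finset.mem_Iic.2 ((Finset.mem_Iic.1 hl).trans h.le)

/-- The interval on which the step function of `p` takes the value `i`. -/
lemma mass_step_interval (p : stdSimplex ℝ (Fin (m + 1))) (i : Fin (m + 1)) :
    mass (partialSum p i - p i) (partialSum p i) p (· = i) = p i := by
  have : {u ∈ Ioc (partialSum p i - p i) (partialSum p i) | stepFn p u = i} =
      Ioc (partialSum p i - p i) (partialSum p i) := by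
    refine Set.sep_eq_self_iff_mem_true.2 fun u hu => ?_
    have hu₁ : u ≤ 1 :=
      hu.2.trans ((partialSum_mono p (Fin.le_last i)).trans_eq (partialSum_last p))
    refine ((stepFn_le_iff p hu₁ i).2 hu.2).eq_of_not_lt fun hlt => ?_
    have h₁ := (stepFn_le_iff p hu₁ _).1 (le_refl (stepFn p u))
    have h₂ := partialSum_add_le p hlt
    linarith [hu.1]
  rw [mass, this]
  simp [stdSimplex.zero_le p i]

end StepFunction

/-! ### Homotopies of the realization which move points within their simplices -/

lemma stdSimplex.map_apply_eq_sum {α β : Type*} [Fintype α] [Fintype β] [DecidableEq β] (f : α → β)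
    (p : stdSimplex ℝ α) (k : β) : stdSimplex.map f p k = ∑ i with f i = k, p i := by
  rw [stdSimplex.map_coe]
  simp [FunOnFinite.linearMap_apply_apply]

namespace Realization

open scoped Simplicial

variable {X : SSet.{u}}

section Push

variable {m : ℕ} {ρ : Fin (m + 1) → ℝ} (h₀ : ∀ i, 0 ≤ ρ i) (h₁ : ∑ i, ρ i ≤ 1)

/-- The point of a simplex obtained from `p` by moving the amount `t ∑ᵢ ρᵢ` of its total mass
to `t ρ`. -/
noncomputable def push (p : stdSimplex ℝ (Fin (m + 1))) (t : unitInterval) :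
    stdSimplex ℝ (Fin (m + 1)) :=
  ⟨fun i => (1 - t * ∑ j, ρ j) * p i + t * ρ i, fun i => by
    have h₂ : (t : ℝ) * ∑ j, ρ j ≤ 1 :=
      mul_le_one₀ t.2.2 (Finset.sum_nonneg fun i _ => h₀ i) h₁
    exact add_nonneg (mul_nonneg (by linarith) (stdSimplex.zero_le p i))
      (mul_nonneg t.2.1 (h₀ i)), by
    have h₂ : ∑ i, p i = 1 := stdSimplex.sum_eq_one p
    rw [Finset.sum_add_distrib, ← Finset.mul_sum, ← Finset.mul_sum]
    have h₃ : ∑ i, p.1 i = 1 := p.2.2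
    rw [show (∑ i, p i) = 1 from h₂]
    ring⟩

lemma push_apply (p : stdSimplex ℝ (Fin (m + 1))) (t : unitInterval) (i : Fin (m + 1)) :
    push h₀ h₁ p t i = (1 - t * ∑ j, ρ j) * p i + t * ρ i := rfl

end Push

/-- Weights `ρᵢ` on the vertices of all simplices, with sum at most `1` and depending naturally and
continuously on the points of the simplices, define a homotopy of the identity of `|X|`, which
moves all points within their simplices. -/
lemma exists_homotopy_of_weights
    (ρ : ∀ {m : ℕ}, X _⦋m⦌ → stdSimplex ℝ (Fin (m + 1)) → Fin (m + 1) → ℝ)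
    (h₀ : ∀ {m : ℕ} (σ : X _⦋m⦌) p i, 0 ≤ ρ σ p i)
    (h₁ : ∀ {m : ℕ} (σ : X _⦋m⦌) p, ∑ i, ρ σ p i ≤ 1)
    (hc : ∀ {m : ℕ} (σ : X _⦋m⦌) i, Continuous fun p => ρ σ p i)
    (hρ : ∀ {m k : ℕ} (f : (⦋m⦌ : SimplexCategory) ⟶ ⦋k⦌) (σ : X _⦋k⦌)
      (p : stdSimplex ℝ (Fin (m + 1))) (j : Fin (k + 1)),
      ρ σ (stdSimplex.map f p) j = ∑ i with f i = j, ρ (X.map f.op σ) p i) :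
    ∃ D : C(SSet.toTop.obj X, C(unitInterval, SSet.toTop.obj X)), ∀ {m : ℕ} (σ : X _⦋m⦌) p t,
      D (realMap σ p) t = realMap σ (push (h₀ σ p) (h₁ σ p) p t) := by
  have hsum : ∀ {m k : ℕ} (f : (⦋m⦌ : SimplexCategory) ⟶ ⦋k⦌) (σ : X _⦋k⦌)
      (p : stdSimplex ℝ (Fin (m + 1))),
      ∑ j, ρ σ (stdSimplex.map f p) j = ∑ i, ρ (X.map f.op σ) p i := by
    intro m k f σ p
    simp_rw [hρ]
    exact Finset.sum_fiberwise _ _ _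
  have hcont : ∀ {m : ℕ} (σ : X _⦋m⦌),
      Continuous fun q : stdSimplex ℝ (Fin (m + 1)) × unitInterval =>
        realMap σ (push (h₀ σ q.1) (h₁ σ q.1) q.1 q.2) := by
    intro m σ
    refine (realMap σ).continuous.comp (Continuous.subtype_mk (continuous_pi fun i => ?_) _)
    have h₂ : ∀ i, Continuous fun q : stdSimplex ℝ (Fin (m + 1)) × unitInterval => ρ σ q.1 i :=
      fun i => (hc σ i).comp continuous_fst
    have h₃ : Continuous fun q : stdSimplex ℝ (Fin (m + 1)) × unitInterval => q.1 i :=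
      (continuous_apply i).comp (continuous_subtype_val.comp continuous_fst)
    have h₄ : Continuous fun q : stdSimplex ℝ (Fin (m + 1)) × unitInterval => (q.2 : ℝ) :=
      continuous_subtype_val.comp continuous_snd
    exact ((continuous_const.sub (h₄.mul (continuous_finsetSum _ fun i _ => h₂ i))).mul h₃).add
      (h₄.mul (h₂ i))
  -- homotopies are maps to a path space, as products with `|X|` need not be colimits of simplices
  obtain ⟨D, hD⟩ := exists_continuousMap_realization (X := X)
    (Z := C(unitInterval, SSet.toTop.obj X))
    (fun σ => ContinuousMap.curry ⟨_, hcont σ⟩) (by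
      intro m k f σ p
      refine ContinuousMap.ext fun t => ?_
      change realMap (X.map f.op σ) _ = realMap σ _
      rw [realMap_map]
      congr 1
      refine stdSimplex.ext (funext fun j => ?_)
      rw [stdSimplex.map_apply_eq_sum, push_apply, hsum, hρ, stdSimplex.map_apply_eq_sum]
      simp only [push_apply, Finset.sum_add_distrib, ← Finset.mul_sum])
  exact ⟨D, fun σ p t => DFunLike.congr_fun (hD σ p) t⟩

end Realization

/-! ### Clusters of identified vertices -/

namespace LocalLieGroupoid

open Realization StepFunction
open scoped Simplicial

variable {d n : ℕ} {M G : Type u}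
    [TopologicalSpace M] [ChartedSpace (EuclideanSpace ℝ (Fin d)) M] [IsManifold (𝓡 d) ∞ M]
    [T2Space M]
    [TopologicalSpace G] [ChartedSpace (EuclideanSpace ℝ (Fin n)) G] [IsManifold (𝓡 n) ∞ G]
    {𝒢 : LocalLieGroupoid d n M G}

namespace NerveSimplex

variable {m k : ℕ} (v : M)

/-- Two vertices of a simplex are identified at `v` if the edge between them is the unit at `v`.
In particular, both are then mapped to `v`. -/
def Rel (σ : 𝒢.NerveSimplex m) (i j : Fin (m + 1)) : Prop :=
  (∃ h, σ.arr i j h = 𝒢.unit v) ∨ ∃ h, σ.arr j i h = 𝒢.unit v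

variable {v} {σ : 𝒢.NerveSimplex m} {i j l : Fin (m + 1)}

lemma Rel.symm (h : σ.Rel v i j) : σ.Rel v j i := Or.symm h

lemma Rel.arr_eq (h : σ.Rel v i j) (hle : i ≤ j) : σ.arr i j hle = 𝒢.unit v := by
  rcases h with ⟨_, h⟩ | ⟨hle', h⟩
  · exact h
  · obtain rfl := le_antisymm hle hle'
    exact h

lemma Rel.obj_eq (h : σ.Rel v i j) : σ.obj i = v := by
  rcases h with ⟨_, h⟩ | ⟨_, h⟩
  · rw [← σ.t_arr i j ‹_›, h, 𝒢.t_unit]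
  · rw [← σ.s_arr j i ‹_›, h, 𝒢.s_unit]

lemma rel_self (h : σ.obj i = v) : σ.Rel v i i := Or.inl ⟨le_rfl, h ▸ σ.arr_self i⟩

/-- If two of the three edges of a triangle with vertices at `v` are the unit at `v`, then so is
the third. -/
lemma Rel.trans (h : σ.Rel v i j) (h' : σ.Rel v j l) : σ.Rel v i l := by
  have key : ∀ a b c : Fin (m + 1), a ≤ b → b ≤ c → σ.obj a = v → σ.obj b = v → σ.obj c = v →
      ((σ.Rel v a b → σ.Rel v b c → σ.Rel v a c) ∧ (σ.Rel v a b → σ.Rel v a c → σ.Rel v b c) ∧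
        (σ.Rel v a c → σ.Rel v b c → σ.Rel v a b)) := by
    intro a b c hab hbc ha hb hc
    have h := σ.mul_arr a b c hab hbc
    refine ⟨fun h₁ h₂ => Or.inl ⟨hab.trans hbc, ?_⟩, fun h₁ h₂ => Or.inl ⟨hbc, ?_⟩,
      fun h₁ h₂ => Or.inl ⟨hab, ?_⟩⟩
    · rw [← h, h₁.arr_eq hab, h₂.arr_eq hbc]
      have := 𝒢.mul_unit (𝒢.unit v)
      rwa [𝒢.s_unit] at this
    · rw [← h₂.arr_eq (hab.trans hbc), ← h, h₁.arr_eq hab]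
      have := 𝒢.unit_mul (σ.arr b c hbc)
      rw [σ.t_arr, hb] at this
      exact this.symm
    · rw [← h₁.arr_eq (hab.trans hbc), ← h, h₂.arr_eq hbc]
      have := 𝒢.mul_unit (σ.arr a b hab)
      rw [σ.s_arr, hb] at this
      exact this.symm
  have hi := h.obj_eq
  have hj := h'.obj_eq
  have hl := h'.symm.obj_eq
  rcases le_total i j with h₁ | h₁ <;> rcases le_total j l with h₂ | h₂ <;>
    rcases le_total i l with h₃ | h₃
  · exact (key i j l h₁ h₂ hi hj hl).1 h h'
  · exact (key i j l h₁ h₂ hi hj hl).1 h h'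
  · exact (key i l j h₃ h₂ hi hl hj).2.2 h h'.symm
  · exact ((key l i j h₃ h₁ hl hi hj).2.2 h'.symm h).symm
  · exact (key j i l h₁ h₃ hj hi hl).2.1 h.symm h'
  · exact ((key j l i h₂ h₃ hj hl hi).2.1 h' h.symm).symm
  · exact ((key l j i h₂ h₁ hl hj hi).1 h'.symm h.symm).symm
  · exact ((key l j i h₂ h₁ hl hj hi).1 h'.symm h.symm).symm

lemma rel_map (f : (⦋m⦌ : SimplexCategory) ⟶ ⦋k⦌) (σ : 𝒢.nerve _⦋k⦌) (i j : Fin (m + 1)) :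
    Rel v (𝒢 := 𝒢) (m := m) (𝒢.nerve.map f.op σ) i j ↔ Rel v (𝒢 := 𝒢) (m := k) σ (f i) (f j) := by
  have key : ∀ i j, i ≤ j → (Rel v (𝒢 := 𝒢) (m := m) (𝒢.nerve.map f.op σ) i j ↔
      Rel v (𝒢 := 𝒢) (m := k) σ (f i) (f j)) := by
    intro i j h
    constructor
    · intro h'
      exact Or.inl ⟨f.toOrderHom.monotone h, h'.arr_eq h⟩
    · intro h'
      exact Or.inl ⟨h, h'.arr_eq (f.toOrderHom.monotone h)⟩
  rcases le_total i j with h | h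
  · exact key i j h
  · exact ⟨fun h' => ((key j i h).1 h'.symm).symm, fun h' => ((key j i h).2 h'.symm).symm⟩

end NerveSimplex

/-! ### Concentration of mass on a cluster of identified vertices -/

/-- A continuous function of `c` whose product with `c` is `0` for `c ≤ ℓ / 2`, is `1` for
`c ≥ 3 ℓ / 4`, and is in between elsewhere. -/
noncomputable def clusterFactor (ℓ c : ℝ) : ℝ :=
  max 0 (min 1 (4 * c / ℓ - 2)) / max c (ℓ / 2)

section ClusterFactor

variable {ℓ : ℝ} (hℓ : 0 < ℓ)
include hℓ

lemma clusterFactor_nonneg (c : ℝ) : 0 ≤ clusterFactor ℓ c :=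
  div_nonneg (le_max_left _ _) (le_max_of_le_right (by linarith))

lemma continuous_clusterFactor : Continuous (clusterFactor ℓ) := by
  refine Continuous.div (by fun_prop) (by fun_prop) fun c => ?_
  exact (lt_max_of_lt_right (by linarith)).ne'

lemma clusterFactor_eq_zero {c : ℝ} (hc : c ≤ ℓ / 2) : clusterFactor ℓ c = 0 := by
  have h : 4 * c / ℓ ≤ 2 := by rw [div_le_iff₀ hℓ]; linarith
  rw [clusterFactor, max_eq_left, zero_div]
  exact (min_le_right _ _).trans (by linarith)

lemma clusterFactor_mul_le_one {c : ℝ} (hc : 0 ≤ c) : clusterFactor ℓ c * c ≤ 1 := by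
  have h₀ : 0 < max c (ℓ / 2) := lt_max_of_lt_right (by linarith)
  rw [clusterFactor, div_mul_eq_mul_div, div_le_one h₀]
  refine (mul_le_mul (max_le zero_le_one (min_le_left _ _)) (le_max_left _ _) hc zero_le_one).trans
    (one_mul _).le

lemma clusterFactor_mul_eq_one {c : ℝ} (hc : 3 / 4 * ℓ ≤ c) : clusterFactor ℓ c * c = 1 := by
  have h : 3 ≤ 4 * c / ℓ := by rw [le_div_iff₀ hℓ]; linarith
  have hc' : ℓ / 2 ≤ c := by linarith
  rw [clusterFactor, max_eq_left hc', min_eq_left (by linarith), max_eq_right zero_le_one]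
  exact one_div_mul_cancel (by linarith)

end ClusterFactor

/-- The mass in the interval `(a, b]` of the cluster of vertices identified with `i` at `v`. -/
noncomputable def clusterMass (v : M) (a b : ℝ) {m : ℕ} (σ : 𝒢.nerve _⦋m⦌)
    (p : stdSimplex ℝ (Fin (m + 1))) (i : Fin (m + 1)) : ℝ :=
  mass a b p (NerveSimplex.Rel v (𝒢 := 𝒢) (m := m) σ i)

/-- The masses in the interval `(a, b]` of the vertices in the predominant cluster at `v`,
normalized such that their sum is `1` if the cluster is very predominant, and `0` if there is no
predominant cluster. -/
noncomputable def clusterWeight (v : M) (a b : ℝ) {m : ℕ} (σ : 𝒢.nerve _⦋m⦌)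
    (p : stdSimplex ℝ (Fin (m + 1))) (i : Fin (m + 1)) : ℝ :=
  clusterFactor (b - a) (clusterMass v a b σ p i) * mass a b p (· = i)

section Cluster

variable {v : M} {a b : ℝ} (ha : 0 ≤ a) (hab : a < b) (hb : b ≤ 1) {m k : ℕ}

lemma clusterMass_eq (σ : 𝒢.nerve _⦋m⦌) (p : stdSimplex ℝ (Fin (m + 1))) {i j : Fin (m + 1)}
    (h : NerveSimplex.Rel v (𝒢 := 𝒢) (m := m) σ i j) :
    clusterMass v a b σ p i = clusterMass v a b σ p j := by
  rw [clusterMass, clusterMass]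
  congr 1
  funext l
  exact propext ⟨fun h' => h.symm.trans h', fun h' => h.trans h'⟩

include hab in
/-- Distinct clusters are disjoint, so that at most one of them has more than half of the mass. -/
lemma clusterMass_add_le (σ : 𝒢.nerve _⦋m⦌) (p : stdSimplex ℝ (Fin (m + 1)))
    {i j : Fin (m + 1)} (h : ¬ NerveSimplex.Rel v (𝒢 := 𝒢) (m := m) σ i j) (hb : b ≤ 1) :
    clusterMass v a b σ p i + clusterMass v a b σ p j ≤ b - a := by
  classical
  rw [← mass_true hab.le p, clusterMass, clusterMass, mass_eq_sum hb p, mass_eq_sum hb p,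
    mass_eq_sum hb p, ← Finset.sum_union]
  · exact Finset.sum_le_sum_of_subset_of_nonneg (by simp) fun _ _ _ => mass_nonneg _ _
  · rw [Finset.disjoint_left]
    intro l hl hl'
    rw [Finset.mem_filter] at hl hl'
    exact h (hl.2.trans hl'.2.symm)

include ha hb in
lemma clusterMass_map (f : (⦋m⦌ : SimplexCategory) ⟶ ⦋k⦌) (σ : 𝒢.nerve _⦋k⦌)
    (p : stdSimplex ℝ (Fin (m + 1))) (i : Fin (m + 1)) :
    clusterMass v a b σ (stdSimplex.map f p) (f i) =
      clusterMass v a b (𝒢.nerve.map f.op σ) p i := by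
  refine (mass_map ha hb f.toOrderHom p _).trans ?_
  rw [clusterMass]
  congr 1
  funext j
  exact propext (NerveSimplex.rel_map f σ i j).symm

include hab in
lemma clusterWeight_nonneg (σ : 𝒢.nerve _⦋m⦌) (p : stdSimplex ℝ (Fin (m + 1)))
    (i : Fin (m + 1)) : 0 ≤ clusterWeight v a b σ p i :=
  mul_nonneg (clusterFactor_nonneg (sub_pos.2 hab) _) (mass_nonneg _ _)

include hab hb in
lemma clusterWeight_eq_zero (σ : 𝒢.nerve _⦋m⦌) (p : stdSimplex ℝ (Fin (m + 1)))
    {i j : Fin (m + 1)} (hi : (b - a) / 2 < clusterMass v a b σ p i)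
    (h : ¬ NerveSimplex.Rel v (𝒢 := 𝒢) (m := m) σ i j) : clusterWeight v a b σ p j = 0 := by
  have := clusterMass_add_le hab σ p h hb
  rw [clusterWeight, clusterFactor_eq_zero (sub_pos.2 hab) (by linarith), zero_mul]

include hab hb in
lemma sum_clusterWeight (σ : 𝒢.nerve _⦋m⦌) (p : stdSimplex ℝ (Fin (m + 1)))
    {i : Fin (m + 1)} (hi : (b - a) / 2 < clusterMass v a b σ p i) :
    ∑ j, clusterWeight v a b σ p j =
      clusterFactor (b - a) (clusterMass v a b σ p i) * clusterMass v a b σ p i := by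
  classical
  have hC : clusterMass v a b σ p i =
      ∑ j with NerveSimplex.Rel v (𝒢 := 𝒢) (m := m) σ i j, mass a b p (· = j) := mass_eq_sum hb p _
  refine Eq.trans ?_ (congrArg _ hC.symm)
  rw [Finset.mul_sum, Finset.sum_filter]
  refine Finset.sum_congr rfl fun j _ => ?_
  split_ifs with h
  · rw [clusterWeight, ← clusterMass_eq σ p h]
  · exact clusterWeight_eq_zero hab hb σ p hi h

include hab hb in
lemma sum_clusterWeight_le_one (σ : 𝒢.nerve _⦋m⦌) (p : stdSimplex ℝ (Fin (m + 1))) :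
    ∑ i, clusterWeight v a b σ p i ≤ 1 := by
  by_cases h : ∃ i, (b - a) / 2 < clusterMass v a b σ p i
  · obtain ⟨i, hi⟩ := h
    rw [sum_clusterWeight hab hb σ p hi]
    exact clusterFactor_mul_le_one (sub_pos.2 hab) (mass_nonneg _ _)
  · push Not at h
    rw [Finset.sum_eq_zero fun i _ => ?_]
    · exact zero_le_one
    · rw [clusterWeight, clusterFactor_eq_zero (sub_pos.2 hab) (h i), zero_mul]

include ha hab hb in
lemma continuous_clusterWeight (σ : 𝒢.nerve _⦋m⦌) (i : Fin (m + 1)) :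
    Continuous fun p => clusterWeight v a b σ p i :=
  ((continuous_clusterFactor (sub_pos.2 hab)).comp (continuous_mass ha hb _)).mul
    (continuous_mass ha hb _)

include ha hb in
lemma clusterWeight_map (f : (⦋m⦌ : SimplexCategory) ⟶ ⦋k⦌) (σ : 𝒢.nerve _⦋k⦌)
    (p : stdSimplex ℝ (Fin (m + 1))) (j : Fin (k + 1)) :
    clusterWeight v a b σ (stdSimplex.map f p) j =
      ∑ i with f i = j, clusterWeight v a b (𝒢.nerve.map f.op σ) p i := by
  have h : mass a b (stdSimplex.map f p) (· = j) = ∑ i with f i = j, mass a b p (· = i) :=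
    (mass_map ha hb f.toOrderHom p _).trans (mass_eq_sum hb p _)
  rw [clusterWeight, h, Finset.mul_sum]
  refine Finset.sum_congr rfl fun i hi => ?_
  obtain rfl := (Finset.mem_filter.1 hi).2
  rw [clusterMass_map ha hb]
  rfl

end Cluster

end LocalLieGroupoid

/-! ### Contractible open sets of the realization -/

/-- A nonempty finite subset `c` of a linear order is a retract: send `j` to the largest element of
`c` below `j`, or to the smallest element of `c` if there is none. -/
lemma exists_monotone_retraction {α : Type*} [LinearOrder α] {c : Finset α} (hne : c.Nonempty) :
    ∃ r : α →o α, (∀ j, r j ∈ c) ∧ ∀ j ∈ c, r j = j := by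
  let s : α → Finset α := fun j => insert (c.min' hne) (c.filter (· ≤ j))
  have hs : ∀ j, (s j).Nonempty := fun j => Finset.insert_nonempty _ _
  refine ⟨⟨fun j => (s j).max' (hs j), fun j l h => ?_⟩, fun j => ?_, fun j hj => ?_⟩
  · refine Finset.max'_subset _ (Finset.insert_subset_insert _ fun x hx => ?_)
    rw [Finset.mem_filter] at hx ⊢
    exact ⟨hx.1, hx.2.trans h⟩
  · change (s j).max' (hs j) ∈ c
    rcases Finset.mem_insert.1 (Finset.max'_mem (s j) (hs j)) with h | h
    · rw [h]
      exact Finset.min'_mem c hne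
    · exact (Finset.mem_filter.1 h).1
  · change (s j).max' (hs j) = j
    refine le_antisymm (Finset.max'_le _ _ _ fun l hl => ?_)
      (Finset.le_max' (s j) j (Finset.mem_insert_of_mem (Finset.mem_filter.2 ⟨hj, le_rfl⟩)))
    rcases Finset.mem_insert.1 hl with rfl | hl
    · exact Finset.min'_le _ _ hj
    · exact (Finset.mem_filter.1 hl).2

namespace LocalLieGroupoid

open Realization StepFunction
open scoped Simplicial

variable {d n : ℕ} {M G : Type u}
    [TopologicalSpace M] [ChartedSpace (EuclideanSpace ℝ (Fin d)) M] [IsManifold (𝓡 d) ∞ M]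
    [T2Space M]
    [TopologicalSpace G] [ChartedSpace (EuclideanSpace ℝ (Fin n)) G] [IsManifold (𝓡 n) ∞ G]
    {𝒢 : LocalLieGroupoid d n M G}

/-- A point of a simplex which is supported on a cluster of vertices identified at `v` represents
the point `v` of the realization: a monotone retraction onto the cluster does not change it, and
the corresponding simplicial operator makes the simplex degenerate to the vertex `v`. -/
lemma realMap_eq_realizationPoint {m : ℕ} (σ : 𝒢.nerve _⦋m⦌) (p : stdSimplex ℝ (Fin (m + 1)))
    {v : M} {i : Fin (m + 1)} (hi : NerveSimplex.obj σ i = v)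
    (hp : ∀ j, ¬ NerveSimplex.Rel v (𝒢 := 𝒢) (m := m) σ i j → p j = 0) :
    realMap σ p = 𝒢.realizationPoint v := by
  classical
  let c : Finset (Fin (m + 1)) := {j | NerveSimplex.Rel v (𝒢 := 𝒢) (m := m) σ i j}
  have hc : ∀ j, j ∈ c ↔ NerveSimplex.Rel v (𝒢 := 𝒢) (m := m) σ i j := fun j => by simp [c]
  have hne : c.Nonempty := ⟨i, (hc i).2 (NerveSimplex.rel_self hi)⟩
  obtain ⟨r, hrc, hrr⟩ := exists_monotone_retraction hne
  have hp' : ∀ j, j ∉ c → p j = 0 := fun j hj => hp j fun h => hj ((hc j).2 h)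
  let f : (⦋m⦌ : SimplexCategory) ⟶ ⦋m⦌ := SimplexCategory.mkHom r
  have hfr : ∀ j, f j = r j := fun _ => rfl
  have hmap : stdSimplex.map f p = p := by
    refine stdSimplex.ext (funext fun j => ?_)
    rw [stdSimplex.map_apply_eq_sum]
    by_cases hj : j ∈ c
    · refine Finset.sum_eq_single_of_mem j (by simp [hfr, hrr j hj]) fun l hl hlj =>
        hp' l fun h => ?_
      rw [Finset.mem_filter, hfr, hrr l h] at hl
      exact hlj hl.2
    · rw [hp' j hj]
      refine Finset.sum_eq_zero fun l hl => ?_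
      rw [Finset.mem_filter, hfr] at hl
      exact absurd (hl.2 ▸ hrc l) hj
  have hrel : ∀ j l, NerveSimplex.Rel v (𝒢 := 𝒢) (m := m) σ (r j) (r l) := fun j l =>
    ((hc _).1 (hrc j)).symm.trans ((hc _).1 (hrc l))
  have hconst : 𝒢.nerve.map f.op σ =
      𝒢.nerve.map (SimplexCategory.const ⦋m⦌ ⦋0⦌ 0).op (𝒢.vertex v) := by
    refine NerveSimplex.ext (funext fun j => (hrel j j).obj_eq) ?_
    funext j l h
    exact (hrel j l).arr_eq (r.monotone h)
  rw [← hmap, ← realMap_map, hconst, realMap_map, realizationPoint_eq]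
  congr 1
  exact Subsingleton.elim _ _

/-- The realization of the nerve is covered by open sets which contract to a point of `M` by a
homotopy that moves all points within their simplices. -/
lemma exists_contraction (e : SSet.toTop.obj 𝒢.nerve) :
    ∃ (v : M) (U : Set (SSet.toTop.obj 𝒢.nerve))
      (D : C(SSet.toTop.obj 𝒢.nerve, C(unitInterval, SSet.toTop.obj 𝒢.nerve))),
      IsOpen U ∧ e ∈ U ∧ (∀ e' ∈ U, D e' 1 = 𝒢.realizationPoint v) ∧
      ∀ {m : ℕ} (σ : 𝒢.nerve _⦋m⦌) (p : stdSimplex ℝ (Fin (m + 1))),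
        ∃ (q : stdSimplex ℝ (Fin (m + 1))) (γ : Path p q),
          ∀ t, D (realMap σ p) t = realMap σ (γ t) := by
  obtain ⟨m₀, σ₀, p₀, rfl⟩ := exists_realMap_eq e
  obtain ⟨i₀, hi₀⟩ : ∃ i, 0 < p₀ i := by
    by_contra! h
    have h₁ := stdSimplex.sum_eq_one p₀
    rw [Finset.sum_eq_zero fun i _ => le_antisymm (h i) (stdSimplex.zero_le p₀ i)] at h₁
    exact zero_ne_one h₁
  let v := NerveSimplex.obj (𝒢 := 𝒢) (m := m₀) σ₀ i₀
  -- on `(a, b]` the step function of `p₀` takes the value `i₀`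
  let b := partialSum p₀ i₀
  let a := b - p₀ i₀
  have ha : 0 ≤ a := by
    refine sub_nonneg.2 ?_
    exact Finset.single_le_sum (f := fun i => p₀ i) (fun i _ => stdSimplex.zero_le p₀ i)
      (Finset.mem_Iic.2 le_rfl)
  have hab : a < b := by simp only [a]; linarith
  have hb : b ≤ 1 := (partialSum_mono p₀ (Fin.le_last i₀)).trans_eq (partialSum_last p₀)
  obtain ⟨D, hD⟩ := exists_homotopy_of_weights (X := 𝒢.nerve) (clusterWeight v a b)
    (clusterWeight_nonneg hab) (sum_clusterWeight_le_one hab hb)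
    (continuous_clusterWeight ha hab hb) (clusterWeight_map ha hb)
  -- `U` is the set of points with a very predominant cluster at `v`
  obtain ⟨U, hU, hU'⟩ := exists_isOpen_realization (X := 𝒢.nerve)
    (fun σ => {p | ∃ i, 3 / 4 * (b - a) < clusterMass v a b σ p i})
    (fun σ => by
      have : {p | ∃ i, 3 / 4 * (b - a) < clusterMass v a b σ p i} =
          ⋃ i, {p | 3 / 4 * (b - a) < clusterMass v a b σ p i} := by ext; simp
      rw [this]
      exact isOpen_iUnion fun i => isOpen_lt continuous_const (continuous_mass ha hb _))
    (fun {m k} f σ p => by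
      constructor
      · rintro ⟨i, hi⟩
        exact ⟨f i, by rwa [clusterMass_map ha hb]⟩
      · rintro ⟨i, hi⟩
        have hpos : 0 < mass a b p (NerveSimplex.Rel v (𝒢 := 𝒢) (m := k) σ i ∘ f) := by
          have h₁ := mass_map ha hb f.toOrderHom p (NerveSimplex.Rel v (𝒢 := 𝒢) (m := k) σ i)
          refine lt_of_lt_of_eq ?_ h₁
          refine lt_trans ?_ hi
          linarith
        obtain ⟨j, hj⟩ := exists_of_mass_pos hpos
        refine ⟨j, ?_⟩
        rwa [← clusterMass_map ha hb, ← clusterMass_eq σ _ hj])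
  refine ⟨v, U, D, hU, (hU' σ₀ p₀).2 ⟨i₀, ?_⟩, ?_, ?_⟩
  · have h₁ := mass_step_interval p₀ i₀
    have h₂ : mass a b p₀ (· = i₀) ≤ clusterMass v a b σ₀ p₀ i₀ :=
      mass_mono p₀ fun j hj => by
        subst hj
        exact NerveSimplex.rel_self rfl
    have h₃ : mass a b p₀ (· = i₀) = b - a := by rw [h₁]; simp [a]
    linarith
  · intro e' he'
    obtain ⟨m, σ, p, rfl⟩ := exists_realMap_eq e'
    obtain ⟨i, hi⟩ := (hU' σ p).1 he'
    have hi' : (b - a) / 2 < clusterMass v a b σ p i := by linarith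
    have hsum : ∑ j, clusterWeight v a b σ p j = 1 := by
      rw [sum_clusterWeight hab hb σ p hi', clusterFactor_mul_eq_one (sub_pos.2 hab) hi.le]
    rw [hD]
    have hpos : 0 < clusterMass v a b σ p i := by linarith
    obtain ⟨j, hj⟩ := exists_of_mass_pos hpos
    refine realMap_eq_realizationPoint σ _ hj.obj_eq fun l hl => ?_
    rw [push_apply, hsum, clusterWeight_eq_zero hab hb σ p hi' hl]
    simp
  · intro m σ p
    refine ⟨_, ⟨⟨fun t => push (clusterWeight_nonneg hab σ p)
      (sum_clusterWeight_le_one hab hb σ p) p t, ?_⟩, ?_, rfl⟩, hD σ p⟩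
    · refine Continuous.subtype_mk (continuous_pi fun i => ?_) _
      fun_prop
    · refine stdSimplex.ext (funext fun i => ?_)
      change push (clusterWeight_nonneg hab σ p) (sum_clusterWeight_le_one hab hb σ p) p 0 i =
        p i
      rw [push_apply]
      simp

end LocalLieGroupoid

/-! ### Generation of the fundamental groupoid -/

instance : ContractibleSpace unitInterval :=
  (convex_Icc (0 : ℝ) 1).contractibleSpace ⟨0, by simp⟩

/-- A property of arrows of the fundamental groupoid is insensitive to a change of the expressions
of the end points of a path. -/
lemma Path.Homotopic.Quotient.property_congr {Y : Type*} [TopologicalSpace Y]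
    {P : ∀ {a b : Y}, (FundamentalGroupoid.mk a ⟶ FundamentalGroupoid.mk b) → Prop}
    {a b a' b' : Y} (p : Path a b) (q : Path a' b') (h : ∀ t, p t = q t)
    (hp : P (FundamentalGroupoid.fromPath (Path.Homotopic.Quotient.mk p))) :
    P (FundamentalGroupoid.fromPath (Path.Homotopic.Quotient.mk q)) := by
  obtain rfl : a = a' := by rw [← p.source, ← q.source, h]
  obtain rfl : b = b' := by rw [← p.target, ← q.target, h]
  obtain rfl : p = q := Path.ext (funext h)
  exact hp

/-- A property of arrows of the fundamental groupoid which is stable under composition and holds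
for the paths contained in the members of an open cover holds for all arrows. -/
lemma FundamentalGroupoid.induction_of_open_cover {Y : Type*} [TopologicalSpace Y]
    {P : ∀ {a b : Y}, (FundamentalGroupoid.mk a ⟶ FundamentalGroupoid.mk b) → Prop}
    (comp : ∀ {a b c : Y} (f : FundamentalGroupoid.mk a ⟶ FundamentalGroupoid.mk b)
      (g : FundamentalGroupoid.mk b ⟶ FundamentalGroupoid.mk c), P f → P g → P (f ≫ g))
    (U : Y → Set Y) (hU : ∀ y, IsOpen (U y)) (hyU : ∀ y, y ∈ U y)
    (hP : ∀ (y : Y) {a b : Y} (p : Path a b), (∀ t, p t ∈ U y) →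
      P (FundamentalGroupoid.fromPath (Path.Homotopic.Quotient.mk p)))
    {a b : Y} (f : FundamentalGroupoid.mk a ⟶ FundamentalGroupoid.mk b) : P f := by
  obtain ⟨γ, rfl⟩ := Quotient.exists_rep f
  rcases γ with ⟨γ, h₀, h₁⟩
  obtain rfl : γ 0 = a := h₀
  obtain rfl : γ 1 = b := h₁
  let Γ := FundamentalGroupoid.map γ
  obtain ⟨t, ht₀, ht, ⟨N, hN⟩, htU⟩ := exists_monotone_Icc_subset_open_cover_unitInterval
    (c := fun y => γ ⁻¹' U y) (fun y => (hU y).preimage γ.continuous)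
    (fun r _ => mem_iUnion.2 ⟨γ r, hyU _⟩)
  have short : ∀ (r r' : unitInterval), r ≤ r' → (∃ y, Icc r r' ⊆ γ ⁻¹' U y) →
      ∀ g : FundamentalGroupoid.mk r ⟶ FundamentalGroupoid.mk r', P (Γ.map g) := by
    rintro r r' hr ⟨y, hy⟩ g
    let p : Path r r' :=
      { toFun := fun v => max r (min r' v)
        continuous_toFun := by fun_prop
        source' := by simp
        target' := by simp [unitInterval.le_one', hr] }
    have hg : g = FundamentalGroupoid.fromPath (Path.Homotopic.Quotient.mk p) :=
      Subsingleton.elim (α := Path.Homotopic.Quotient r r') _ _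
    rw [hg]
    exact hP y (p.map γ.continuous) fun v => hy ⟨le_max_left _ _, max_le hr (min_le_left _ _)⟩
  have key : ∀ (k : ℕ) (g : FundamentalGroupoid.mk 0 ⟶ FundamentalGroupoid.mk (t k)),
      P (Γ.map g) := by
    intro k
    induction k with
    | zero =>
      obtain ⟨y, hy⟩ := htU 0
      refine short _ _ unitInterval.nonneg' ⟨y, fun v hv => hy ⟨?_, ?_⟩⟩
      · rw [ht₀]; exact hv.1
      · exact hv.2.trans (ht (Nat.le_succ 0))
    | succ k ih =>
      intro g
      let g₁ : FundamentalGroupoid.mk (0 : unitInterval) ⟶ FundamentalGroupoid.mk (t k) :=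
        FundamentalGroupoid.fromPath (Path.Homotopic.Quotient.mk (PathConnectedSpace.somePath _ _))
      let g₂ : FundamentalGroupoid.mk (t k) ⟶ FundamentalGroupoid.mk (t (k + 1)) :=
        FundamentalGroupoid.fromPath (Path.Homotopic.Quotient.mk (PathConnectedSpace.somePath _ _))
      have hg : g = g₁ ≫ g₂ :=
        Subsingleton.elim (α := Path.Homotopic.Quotient (0 : unitInterval) (t (k + 1))) _ _
      rw [hg, Functor.map_comp]
      exact comp _ _ (ih g₁) (short _ _ (ht (Nat.le_succ k)) (htU k) g₂)
  have hN' := key N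
  rw [hN N le_rfl] at hN'
  exact hN' (FundamentalGroupoid.fromPath
    (Path.Homotopic.Quotient.mk ⟨ContinuousMap.id _, rfl, rfl⟩))

namespace LocalLieGroupoid

open Realization
open scoped Simplicial

variable {d n : ℕ} {M G : Type u}
    [TopologicalSpace M] [ChartedSpace (EuclideanSpace ℝ (Fin d)) M] [IsManifold (𝓡 d) ∞ M]
    [T2Space M]
    [TopologicalSpace G] [ChartedSpace (EuclideanSpace ℝ (Fin n)) G] [IsManifold (𝓡 n) ∞ G]
    {𝒢 : LocalLieGroupoid d n M G}

/-- The fundamental groupoid of the realization of the nerve is generated by the paths contained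
in a simplex: a path in one of the contractible open sets of `exists_contraction` is homotopic to
the track of its initial point followed by the inverse of the track of its end point. -/
lemma fundamentalGroupoid_induction
    {P : ∀ {a b : SSet.toTop.obj 𝒢.nerve},
      (FundamentalGroupoid.mk a ⟶ FundamentalGroupoid.mk b) → Prop}
    (comp : ∀ {a b c : SSet.toTop.obj 𝒢.nerve}
      (f : FundamentalGroupoid.mk a ⟶ FundamentalGroupoid.mk b)
      (g : FundamentalGroupoid.mk b ⟶ FundamentalGroupoid.mk c), P f → P g → P (f ≫ g))
    (simplex : ∀ {m : ℕ} (σ : 𝒢.nerve _⦋m⦌) (p q : stdSimplex ℝ (Fin (m + 1)))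
      {a b : SSet.toTop.obj 𝒢.nerve} (h : realMap σ p = a) (h' : realMap σ q = b),
      P (simplexHom σ p q h h'))
    {a b : SSet.toTop.obj 𝒢.nerve}
    (f : FundamentalGroupoid.mk a ⟶ FundamentalGroupoid.mk b) : P f := by
  choose v U D hU hUmem hD₁ hD using exists_contraction (𝒢 := 𝒢)
  refine FundamentalGroupoid.induction_of_open_cover comp U hU hUmem ?_ f
  intro y a b δ hδ
  let H : C(unitInterval × unitInterval, SSet.toTop.obj 𝒢.nerve) :=
    ContinuousMap.uncurry ((D y).comp δ.toContinuousMap)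
  have hD₀ : ∀ e, D y e 0 = e := by
    intro e
    obtain ⟨m, σ, p, rfl⟩ := exists_realMap_eq e
    obtain ⟨q, γ, hγ⟩ := hD y σ p
    rw [hγ, γ.source]
  -- the four sides of the square
  let I₀₁ : Path (0 : unitInterval) 1 := ⟨ContinuousMap.id _, rfl, rfl⟩
  let bottom : Path ((0, 0) : unitInterval × unitInterval) (1, 0) := I₀₁.prod (Path.refl 0)
  let left : Path ((0, 0) : unitInterval × unitInterval) (0, 1) := (Path.refl 0).prod I₀₁
  let top : Path ((0, 1) : unitInterval × unitInterval) (1, 1) := I₀₁.prod (Path.refl 1)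
  let right : Path ((1, 0) : unitInterval × unitInterval) (1, 1) := (Path.refl 1).prod I₀₁
  let Φ := FundamentalGroupoid.map H
  have hsq : FundamentalGroupoid.fromPath (Path.Homotopic.Quotient.mk bottom) =
      FundamentalGroupoid.fromPath (Path.Homotopic.Quotient.mk left) ≫
      FundamentalGroupoid.fromPath (Path.Homotopic.Quotient.mk top) ≫
      FundamentalGroupoid.fromPath (Path.Homotopic.Quotient.mk right.symm) :=
    Subsingleton.elim (α := Path.Homotopic.Quotient ((0, 0) : unitInterval × unitInterval) (1, 0))
      _ _
  have hleft : P (FundamentalGroupoid.fromPath (Path.Homotopic.Quotient.mk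
      (left.map H.continuous))) := by
    obtain ⟨m, σ, p, hp⟩ := exists_realMap_eq (δ 0)
    obtain ⟨q, γ, hγ⟩ := hD y σ p
    have h : ∀ t, left.map H.continuous t = realMap σ (γ t) := fun t => by
      rw [← hγ, hp]; rfl
    have h₀ := h 0
    have h₁ := h 1
    rw [γ.source, Path.source] at h₀
    rw [γ.target, Path.target] at h₁
    rw [← simplexHom_eq σ γ h₀.symm h₁.symm _ h]
    exact simplex _ _ _ _ _
  have hright : P (FundamentalGroupoid.fromPath (Path.Homotopic.Quotient.mk
      (right.symm.map H.continuous))) := by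
    obtain ⟨m, σ, p, hp⟩ := exists_realMap_eq (δ 1)
    obtain ⟨q, γ, hγ⟩ := hD y σ p
    have h : ∀ t, right.symm.map H.continuous t = realMap σ (γ.symm t) := fun t => by
      change _ = realMap σ (γ (unitInterval.symm t))
      rw [← hγ, hp]; rfl
    have h₀ := h 0
    have h₁ := h 1
    rw [γ.symm.source, Path.source] at h₀
    rw [γ.symm.target, Path.target] at h₁
    rw [← simplexHom_eq σ γ.symm h₀.symm h₁.symm _ h]
    exact simplex _ _ _ _ _
  have htop : P (FundamentalGroupoid.fromPath (Path.Homotopic.Quotient.mk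
      (top.map H.continuous))) := by
    have h : ∀ t, top.map H.continuous t = realMap (𝒢.vertex (v y))
        ((Path.refl (stdSimplex.vertex 0)) t) := fun t => by
      refine (hD₁ y _ (hδ t)).trans ?_
      rw [realizationPoint_eq]; rfl
    have h₀ := h 0
    have h₁ := h 1
    rw [Path.source, Path.source] at h₀
    rw [Path.target, Path.target] at h₁
    rw [← simplexHom_eq _ _ h₀.symm h₁.symm _ h]
    exact simplex _ _ _ _ _
  refine Path.Homotopic.Quotient.property_congr (P := P) (bottom.map H.continuous) δ
    (fun t => hD₀ (δ t)) ?_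
  have h := congrArg (fun g => Φ.map g) hsq
  rw [Functor.map_comp, Functor.map_comp] at h
  exact (congrArg P h).mpr (comp _ _ hleft (comp _ _ htop hright))

/-! ### Fullness -/

lemma toFundamentalGroupoid_map_comp_assoc {x y z : AssocCompletion 𝒢} (f : x ⟶ y) (f' : y ⟶ z)
    {e : SSet.toTop.obj 𝒢.nerve}
    (c : FundamentalGroupoid.mk (𝒢.realizationPoint z.pt) ⟶ FundamentalGroupoid.mk e) :
    𝒢.toFundamentalGroupoid.map (f ≫ f') ≫ c =
      𝒢.toFundamentalGroupoid.map f ≫ 𝒢.toFundamentalGroupoid.map f' ≫ c := by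
  rw [Functor.map_comp]
  exact Category.assoc _ _ _

/-- If two points of two simplices represent the same point of the realization, then the classes
of the paths from the initial vertices of the two simplices to this point differ by an arrow of
the associative completion. The classes of paths to a point which differ from a given one by an
arrow of the completion form a set that does not depend on the simplex. -/
lemma exists_map_comp_simplexHom (hiso : ∀ (x y : AssocCompletion 𝒢) (f : x ⟶ y), IsIso f)
    {m k : ℕ} (σ : 𝒢.nerve _⦋m⦌) (τ : 𝒢.nerve _⦋k⦌) (p : stdSimplex ℝ (Fin (m + 1)))
    (q : stdSimplex ℝ (Fin (k + 1))) {e : SSet.toTop.obj 𝒢.nerve} (hp : realMap σ p = e)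
    (hq : realMap τ q = e) {x y : M} (hx : NerveSimplex.obj σ 0 = x)
    (hy : NerveSimplex.obj τ 0 = y) :
    ∃ f : (⟨x⟩ : AssocCompletion 𝒢) ⟶ ⟨y⟩,
      simplexHom σ (stdSimplex.vertex 0) p (realMap_vertex σ 0 hx) hp =
        𝒢.toFundamentalGroupoid.map f ≫
          simplexHom τ (stdSimplex.vertex 0) q (realMap_vertex τ 0 hy) hq := by
  subst hx hy
  let K : Type u := Σ (x : M) (e : SSet.toTop.obj 𝒢.nerve),
    (FundamentalGroupoid.mk (𝒢.realizationPoint x) ⟶ FundamentalGroupoid.mk e)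
  let F : ∀ {m : ℕ}, 𝒢.nerve _⦋m⦌ → stdSimplex ℝ (Fin (m + 1)) → Set K := fun {m} σ p =>
    {c | ∃ (f : (⟨c.1⟩ : AssocCompletion 𝒢) ⟶ ⟨NerveSimplex.obj (𝒢 := 𝒢) (m := m) σ 0⟩)
      (h : realMap σ p = c.2.1), c.2.2 = 𝒢.toFundamentalGroupoid.map f ≫
        simplexHom σ (stdSimplex.vertex 0) p (realMap_vertex σ 0 rfl) h}
  obtain ⟨κ, hκ⟩ := exists_function_realization (X := 𝒢.nerve) F (by
    intro m k θ τ p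
    let g := NerveSimplex.arr (𝒢 := 𝒢) (m := k) τ 0 (θ 0) (Fin.zero_le _)
    let f₀ : (⟨NerveSimplex.obj (𝒢 := 𝒢) (m := k) τ (θ 0)⟩ : AssocCompletion 𝒢) ⟶
        ⟨NerveSimplex.obj (𝒢 := 𝒢) (m := k) τ 0⟩ :=
      AssocCompletion.cls g (NerveSimplex.s_arr τ _ _ _) (NerveSimplex.t_arr τ _ _ _)
    -- the initial vertices of `τ` and of its image under `θ` are joined by an edge of `τ`
    have key : ∀ {e : SSet.toTop.obj 𝒢.nerve} (h : realMap (𝒢.nerve.map θ.op τ) p = e),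
        simplexHom (𝒢.nerve.map θ.op τ) (stdSimplex.vertex 0) p (realMap_vertex _ 0 rfl) h =
          𝒢.toFundamentalGroupoid.map f₀ ≫ simplexHom τ (stdSimplex.vertex 0) (stdSimplex.map θ p)
            (realMap_vertex τ 0 rfl) ((realMap_map θ τ p).symm.trans h) := by
      intro e h
      have h₁ : 𝒢.toFundamentalGroupoid.map f₀ = simplexHom τ (stdSimplex.vertex (θ 0))
          (stdSimplex.vertex 0) (realMap_vertex τ _ rfl) (realMap_vertex τ _ rfl) :=
        (toFundamentalGroupoid_cls g _ _).trans
          (simplexHom_vertex τ 0 (θ 0) (Fin.zero_le _) rfl rfl).symm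
      rw [h₁]
      refine Eq.trans ?_ (simplexHom_comp τ _ _ _ _ _ _).symm
      have h₂ := stdSimplex.map_vertex (S := ℝ) θ 0
      have h₃ : ∀ (r : stdSimplex ℝ (Fin (k + 1))) (hr : stdSimplex.map θ (stdSimplex.vertex 0) = r)
          (hr' : realMap τ r = 𝒢.realizationPoint (NerveSimplex.obj (𝒢 := 𝒢) (m := k) τ (θ 0))),
          simplexHom τ (stdSimplex.map θ (stdSimplex.vertex 0)) (stdSimplex.map θ p)
            (hr ▸ hr') ((realMap_map θ τ p).symm.trans h) =
          simplexHom τ r (stdSimplex.map θ p) hr' ((realMap_map θ τ p).symm.trans h) := by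
        rintro _ rfl _; rfl
      exact (simplexHom_map θ τ _ _ _ _).trans (h₃ _ h₂ (realMap_vertex τ _ rfl))
    ext ⟨x, e, c⟩
    constructor
    · rintro ⟨f, h, hc⟩
      refine ⟨f ≫ f₀, (realMap_map θ τ p).symm.trans h, hc.trans ?_⟩
      exact (congrArg (fun c => 𝒢.toFundamentalGroupoid.map f ≫ c) (key h)).trans
        (toFundamentalGroupoid_map_comp_assoc f f₀ _).symm
    · rintro ⟨f, h, hc⟩
      let i₀ := @asIso _ _ _ _ f₀ (hiso _ _ f₀)
      refine ⟨f ≫ i₀.inv, (realMap_map θ τ p).trans h, hc.trans ?_⟩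
      refine Eq.trans ?_ (congrArg
        (fun c => 𝒢.toFundamentalGroupoid.map (f ≫ i₀.inv) ≫ c)
        (key ((realMap_map θ τ p).trans h))).symm
      refine Eq.trans ?_ (toFundamentalGroupoid_map_comp_assoc _ f₀ _)
      rw [Category.assoc, show i₀.inv ≫ f₀ = 𝟙 _ from i₀.inv_hom_id, Category.comp_id])
  have h₁ : ∀ {e : SSet.toTop.obj 𝒢.nerve} (hp : realMap σ p = e),
      (⟨NerveSimplex.obj (𝒢 := 𝒢) (m := m) σ 0, e,
        simplexHom σ (stdSimplex.vertex 0) p (realMap_vertex σ 0 rfl) hp⟩ : K) ∈ κ e := by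
    rintro _ rfl
    refine (Set.ext_iff.1 (hκ σ p) _).2 ⟨𝟙 _, rfl, ?_⟩
    rw [CategoryTheory.Functor.map_id]
    exact (Category.id_comp _).symm
  have h₂ : κ e = F τ q := by rw [← hq, hκ]
  obtain ⟨f, h, hf⟩ := (Set.ext_iff.1 h₂ _).1 (h₁ hp)
  exact ⟨f, hf⟩

/-- Every path in the realization between points of `M` is homotopic to a path of edges, as this
may be checked on paths contained in a simplex. -/
lemma toFundamentalGroupoid_surjective (hiso : ∀ (x y : AssocCompletion 𝒢) (f : x ⟶ y), IsIso f)
    (x y : AssocCompletion 𝒢) :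
    Function.Surjective (𝒢.toFundamentalGroupoid.map : (x ⟶ y) → _) := by
  let P : ∀ {a b : SSet.toTop.obj 𝒢.nerve},
      (FundamentalGroupoid.mk a ⟶ FundamentalGroupoid.mk b) → Prop := fun {a b} γ =>
    ∀ {m k : ℕ} (σ : 𝒢.nerve _⦋m⦌) (τ : 𝒢.nerve _⦋k⦌) (p : stdSimplex ℝ (Fin (m + 1)))
      (q : stdSimplex ℝ (Fin (k + 1))) (hp : realMap σ p = a) (hq : realMap τ q = b) {x y : M}
      (hx : NerveSimplex.obj (𝒢 := 𝒢) (m := m) σ 0 = x)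
      (hy : NerveSimplex.obj (𝒢 := 𝒢) (m := k) τ 0 = y),
      ∃ f : (⟨x⟩ : AssocCompletion 𝒢) ⟶ ⟨y⟩,
        simplexHom σ (stdSimplex.vertex 0) p (realMap_vertex σ 0 hx) hp ≫ γ =
          𝒢.toFundamentalGroupoid.map f ≫
            simplexHom τ (stdSimplex.vertex 0) q (realMap_vertex τ 0 hy) hq
  have all : ∀ {a b : SSet.toTop.obj 𝒢.nerve}
      (γ : FundamentalGroupoid.mk a ⟶ FundamentalGroupoid.mk b), P γ := by
    refine fundamentalGroupoid_induction (P := P) ?_ ?_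
    · intro a b c γ γ' hγ hγ' m k σ τ p q hp hq x y hx hy
      obtain ⟨l, ρ, r, hr⟩ := exists_realMap_eq b
      obtain ⟨f, hf⟩ := hγ σ ρ p r hp hr hx rfl
      obtain ⟨f', hf'⟩ := hγ' ρ τ r q hr hq rfl hy
      refine ⟨f ≫ f', ?_⟩
      refine (Category.assoc _ _ _).symm.trans ((congrArg (fun c => c ≫ γ') hf).trans ?_)
      refine (Category.assoc _ _ _).trans ((congrArg
        (fun c => 𝒢.toFundamentalGroupoid.map f ≫ c) hf').trans ?_)
      exact (toFundamentalGroupoid_map_comp_assoc f f' _).symm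
    · intro l ρ r r' a b hr hr' m k σ τ p q hp hq x y hx hy
      obtain ⟨f, hf⟩ := exists_map_comp_simplexHom hiso σ ρ p r hp hr hx rfl
      obtain ⟨f', hf'⟩ := exists_map_comp_simplexHom hiso ρ τ r' q hr' hq rfl hy
      refine ⟨f ≫ f', ?_⟩
      refine (congrArg (fun c => c ≫ simplexHom ρ r r' hr hr') hf).trans ?_
      refine (Category.assoc _ _ _).trans ((congrArg
        (fun c => 𝒢.toFundamentalGroupoid.map f ≫ c)
        ((simplexHom_comp ρ _ _ _ _ _ _).trans hf')).trans ?_)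
      exact (toFundamentalGroupoid_map_comp_assoc f f' _).symm
  intro γ
  obtain ⟨f, hf⟩ := all γ (𝒢.vertex x.pt) (𝒢.vertex y.pt) (stdSimplex.vertex 0)
    (stdSimplex.vertex 0) (realMap_vertex _ 0 rfl) (realMap_vertex _ 0 rfl) (x := x.pt)
    (y := y.pt) rfl rfl
  rw [simplexHom_self, simplexHom_self] at hf
  exact ⟨f, ((Category.id_comp _).symm.trans (hf.trans (Category.comp_id _))).symm⟩

end LocalLieGroupoid

/-! ### The comparison theorem -/

theorem mainTheorem7 {d n : ℕ} {M G : Type u}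
    [TopologicalSpace M] [ChartedSpace (EuclideanSpace ℝ (Fin d)) M] [IsManifold (𝓡 d) ∞ M]
    [T2Space M]
    [TopologicalSpace G] [ChartedSpace (EuclideanSpace ℝ (Fin n)) G] [IsManifold (𝓡 n) ∞ G]
    (𝒢 : LocalLieGroupoid d n M G) (h3 : 𝒢.IsThreeAssociative) (hsc : 𝒢.StronglyConnected) :
    -- the associative completion is a groupoid
    (∀ (x y : LocalLieGroupoid.AssocCompletion 𝒢) (f : x ⟶ y), IsIso f) ∧
    -- it is isomorphic, over `M`, to the restriction to `M` of the fundamental groupoid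
    (∃ (Φ : LocalLieGroupoid.AssocCompletion 𝒢 ⥤ 𝒢.PiOne)
        (Ψ : 𝒢.PiOne ⥤ LocalLieGroupoid.AssocCompletion 𝒢),
      Φ ⋙ Ψ = 𝟭 _ ∧ Ψ ⋙ Φ = 𝟭 _ ∧ ∀ x : M, Φ.obj ⟨x⟩ = x) ∧
    -- the two equivalence relations on words agree
    (∀ w₁ w₂ : 𝒢.Word, w₁.Equiv w₂ ↔ MooreSmith.Equiv w₁.bar w₂.bar) := by
  have hiso : ∀ (x y : LocalLieGroupoid.AssocCompletion 𝒢) (f : x ⟶ y), IsIso f := fun _ _ f =>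
    LocalLieGroupoid.isIso_of_sourceConnected (fun g => (hsc.biRegular g).2) hsc.s_connected f
  obtain ⟨Ψ, h₁, h₂⟩ := LocalLieGroupoid.exists_inverse_toPiOne fun x y =>
    ⟨LocalLieGroupoid.toFundamentalGroupoid_injective hiso x y,
      LocalLieGroupoid.toFundamentalGroupoid_surjective hiso x y⟩
  exact ⟨hiso, ⟨𝒢.toPiOne, Ψ, h₁, h₂, fun _ => rfl⟩, fun _ _ =>
    ⟨LocalLieGroupoid.Word.Equiv.bar, LocalLieGroupoid.Word.Equiv.of_bar hiso⟩⟩
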